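/- Let $n\ge 0$ and $\mathbb T^n=U(1)^n$. All presheaves are presheaves of bicategories on the category of smooth manifolds; a 2-stack is a presheaf of bigroupoids satisfying descent along open covers, and a morphism $\mathcal A\to\mathcal S$ to a 2-stack is a 2-stackification if for every 2-stack $\mathcal Z$ (of the appropriate size) it induces an equivalence $\mathrm{Hom}(\mathcal S,\mathcal Z)\to\mathrm{Hom}(\mathcal A,\mathcal Z)$ of bicategories. A (topological) T-background over a manifold $X$ is a pair of a principal $\mathbb T^n$-bundle $E\to X$ and a $U(1)$-bundle gerbe $\mathcal G$ over $E$. A 1-morphism $(E,\mathcal G)\to(E',\mathcal G')$ is a pair of a bundle isomorphism $f:E\to E'$ and a 1-morphism $\mathcal G\to f^*\mathcal G'$ of bundle gerbes; 2-morphisms are the 2-morphisms of bundle gerbes between 1-morphisms with the same $f$. These form a presheaf $\mathrm{T\text{-}BG}$ of bigroupoids. Let $\mathcal F_2\subset \mathrm{T\text{-}BG}$ be the sub-presheaf that has over $X$ the single object $(X\times\mathbb T^n,\mathcal I)$, with $\mathcal I$ the trivial bundle gerbe, the 1-morphisms $(f,\mathrm{id}_{\mathcal I})$ (up to 2-isomorphism),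 and all 2-morphisms between these. Let $\mathrm{T\text{-}BG}^{F_2}$, the 2-stack of $F_2$ T-backgrounds, be a closure of $\mathcal F_2$ in $\mathrm{T\text{-}BG}$ under descent: a sub-presheaf of bicategories of $\mathrm{T\text{-}BG}$, given by a class of objects, a class of 1-morphisms, and all 2-morphisms between these, which contains $\mathcal F_2$, is a 2-stack, and for which the inclusion $\mathcal F_2\to \mathrm{T\text{-}BG}^{F_2}$ is a 2-stackification. Let $\mathbb{TB}^{F_2}$ be the Fréchet Lie 2-group with objects $\mathbb T^n$ and with automorphism group $C^\infty(\mathbb T^n,U(1))$ of every object, on which $\mathbb T^n$ acts by $({}^b\alpha)(a)=\alpha(a-b)$. The presheaf $\underline{B\mathbb{TB}^{F_2}}$ of smooth $B\mathbb{TB}^{F_2}$-valued functions has over $X$ a single object; its 1-morphisms are the smooth maps $g:X\to\mathbb T^n$, composed by pointwise addition; there are 2-morphisms only from a 1-morphism to itself, and these are the smooth maps $\tau:X\to C^\infty(\mathbb T^n,U(1))$, with pointwise addition as vertical composition and with the horizontal composite of $\tau_1:g_1\Rightarrow g_1$ followed by $\tau_2:g_2\Rightarrow g_2$ being $\tau_2+{}^{g_2}\tau_1$.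 The 2-functor $F_2:\underline{B\mathbb{TB}^{F_2}}\to\mathcal F_2$ sends the object to $(X\times\mathbb T^n,\mathcal I)$, a map $g$ to $(f_g,\mathrm{id}_{\mathcal I})$ with $f_g(x,a)=(x,g(x)+a)$, and $\tau:g\Rightarrow g$ to the 2-morphism given by the smooth function $\beta_\tau(x,a)=-\tau(x)(g(x)+a)$. Proposition. The 2-functor $F_2$ induces an equivalence $(\underline{B\mathbb{TB}^{F_2}})^+\cong \mathrm{T\text{-}BG}^{F_2}$ of 2-stacks. That is: for every 2-stackification $\iota:\underline{B\mathbb{TB}^{F_2}}\to(\underline{B\mathbb{TB}^{F_2}})^+$ there is a morphism $\Phi:(\underline{B\mathbb{TB}^{F_2}})^+\to \mathrm{T\text{-}BG}^{F_2}$ such that $\Phi\circ\iota$ is equivalent to the composition of $F_2$ with the inclusion $\mathcal F_2\to \mathrm{T\text{-}BG}^{F_2}$; it is unique up to equivalence; and every such $\Phi$ is an equivalence. -/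

import Mathlib

open CategoryTheory Bicategory

universe w v u w₁ v₁ u₁ w₂ v₂ u₂ w₃ v₃ u₃

noncomputable section

section Manifolds

open Manifold ContDiff

namespace TDual

/-- Finite-dimensional smooth manifolds (Hausdorff, second countable, without boundary). -/
structure Mfd : Type 1 where
  carrier : Type
  E : Type
  H : Type
  [normE : NormedAddCommGroup E]
  [spaceE : NormedSpace ℝ E]
  [finE : FiniteDimensional ℝ E]
  [topH : TopologicalSpace H]
  I : ModelWithCorners ℝ E H
  [bdry : I.Boundaryless]
  [top : TopologicalSpace carrier]
  [charted : ChartedSpace H carrier]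
  [mfd : IsManifold I ∞ carrier]
  [t2 : T2Space carrier]
  [sc : SecondCountableTopology carrier]

instance : CoeSort Mfd Type := ⟨Mfd.carrier⟩

attribute [instance] Mfd.normE Mfd.spaceE Mfd.finE Mfd.topH Mfd.bdry Mfd.top Mfd.charted
  Mfd.mfd Mfd.t2 Mfd.sc

namespace Mfd

/-- A smooth (i.e. `C^∞`) map. -/
def Smooth {M N : Mfd} (f : M → N) : Prop := ContMDiff M.I N.I ∞ f

/-- The category of smooth manifolds and smooth maps. -/
@[ext] structure Hom (M N : Mfd) : Type where
  toFun : M → N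
  smooth : Smooth toFun

instance : Category Mfd where
  Hom := Hom
  id M := ⟨fun x => x, contMDiff_id⟩
  comp f g := ⟨fun x => g.toFun (f.toFun x), ContMDiff.comp g.smooth f.smooth⟩

instance (M N : Mfd) : CoeFun (M ⟶ N) (fun _ => M → N) := ⟨Hom.toFun⟩

@[ext] theorem hom_ext {M N : Mfd} {f g : M ⟶ N} (h : ∀ x, f x = g x) : f = g :=
  Hom.ext (funext h)

@[simp] theorem id_apply (M : Mfd) (x : M) : (𝟙 M : M ⟶ M) x = x := rfl
@[simp] theorem comp_apply {M N K : Mfd} (f : M ⟶ N) (g : N ⟶ K) (x : M) :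
    (f ≫ g) x = g (f x) := rfl

/-- Open subsets of manifolds are manifolds. -/
def restrict (M : Mfd) (U : TopologicalSpace.Opens M) : Mfd where
  carrier := U
  E := M.E
  H := M.H
  I := M.I

def restrictIncl (M : Mfd) (U : TopologicalSpace.Opens M) : M.restrict U ⟶ M :=
  ⟨fun x => x.1, contMDiff_subtype_val (I := M.I) (U := U)⟩

@[simp] theorem restrictIncl_apply (M : Mfd) (U : TopologicalSpace.Opens M) (x : M.restrict U) :
    M.restrictIncl U x = x.1 := rfl

/-- Products of manifolds. -/
def prod (M N : Mfd) : Mfd where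
  carrier := M × N
  E := M.E × N.E
  H := ModelProd M.H N.H
  I := M.I.prod N.I
  bdry := by infer_instance

/-- The circle group `U(1)`. -/
def U1 : Mfd where
  carrier := Circle
  E := EuclideanSpace ℝ (Fin 1)
  H := EuclideanSpace ℝ (Fin 1)
  I := 𝓡 1
  mfd := IsManifold.of_le (n := ω) le_top
  sc := by infer_instance

/-- Smoothness is a local property. -/
theorem smooth_of_local {M N : Mfd} (f : M → N)
    (h : ∀ x : M, ∃ U : TopologicalSpace.Opens M, x ∈ U ∧
      Smooth (M := M.restrict U) (fun y => f y.1)) : Smooth f := by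
  intro x
  obtain ⟨U, hx, hU⟩ := h x
  exact (contMDiffAt_subtype_iff (I := M.I) (I' := N.I) (U := U) (f := f) (x := ⟨x, hx⟩)).1
    (hU ⟨x, hx⟩)

theorem Smooth.comp {M N K : Mfd} {f : M → N} {g : N → K} (hg : Smooth g) (hf : Smooth f) :
    Smooth (fun x => g (f x)) := ContMDiff.comp hg hf

theorem Smooth.prodMk {M N K : Mfd} {f : M → N} {g : M → K} (hf : Smooth f) (hg : Smooth g) :
    Smooth (N := prod N K) (fun x => (f x, g x)) := ContMDiff.prodMk hf hg

theorem smooth_fst {M N : Mfd} : Smooth (M := prod M N) (fun x => x.1) := contMDiff_fst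
theorem smooth_snd {M N : Mfd} : Smooth (M := prod M N) (fun x => x.2) := contMDiff_snd

theorem Smooth.continuous {M N : Mfd} {f : M → N} (hf : Smooth f) : Continuous f :=
  ContMDiff.continuous hf

theorem smooth_const {M N : Mfd} (c : N) : Smooth (fun _ : M => c) := contMDiff_const

theorem smooth_id {M : Mfd} : Smooth (fun x : M => x) := contMDiff_id

/-- A surjective submersion. -/
def IsSurjSubmersion {M N : Mfd} (f : M ⟶ N) : Prop :=
  Function.Surjective f ∧ IsSubmersion M.I N.I ∞ (f : M → N)

theorem isSurjSubmersion_id (M : Mfd) : IsSurjSubmersion (𝟙 M) :=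
  ⟨fun x => ⟨x, rfl⟩, IsSubmersion.id⟩

theorem isSurjSubmersion_fst (M N : Mfd) (c : N) :
    IsSurjSubmersion (⟨fun x => x.1, smooth_fst⟩ : prod M N ⟶ M) := by
  refine ⟨fun x => ⟨(x, c), rfl⟩, ?_⟩
  refine IsSubmersionOfComplement.isSubmersion (F := N.E) fun x => ?_
  refine IsSubmersionAtOfComplement.mk_of_continuousAt
    (Continuous.continuousAt (Smooth.continuous smooth_fst))
    (ContinuousLinearEquiv.refl ℝ (M.E × N.E))
    (chartAt _ x) (chartAt _ x.1) (mem_chart_source _ x) (mem_chart_source _ x.1)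
    (IsManifold.chart_mem_maximalAtlas x) (IsManifold.chart_mem_maximalAtlas x.1) ?_
  intro y hy
  have h1 : y.1 ∈ ((chartAt M.H x.1).extend M.I).target := by
    have : y ∈ ((chartAt M.H x.1).extend M.I).target ×ˢ ((chartAt N.H x.2).extend N.I).target := by
      have e : ((chartAt (M.prod N).H x).extend (M.prod N).I).target =
          ((chartAt M.H x.1).extend M.I).target ×ˢ ((chartAt N.H x.2).extend N.I).target := by
        change (((chartAt M.H x.1).prod (chartAt N.H x.2)).extend (M.I.prod N.I)).target = _
        rw [OpenPartialHomeomorph.extend_prod]; rfl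
      exact e ▸ hy
    exact this.1
  exact ((chartAt M.H x.1).extend M.I).right_inv h1

section Torus

/-- The model with corners of the torus. -/
def torusModel (n : ℕ) :
    ModelWithCorners ℝ (Fin n → EuclideanSpace ℝ (Fin 1))
      (ModelPi fun _ : Fin n => EuclideanSpace ℝ (Fin 1)) :=
  ModelWithCorners.pi fun _ => 𝓡 1

theorem torus_isManifold (n : ℕ) : IsManifold (torusModel n) ∞ (Fin n → Circle) := by
  have hc : IsManifold (𝓡 1) ∞ Circle := IsManifold.of_le (n := ω) le_top
  have hp : ∀ e ∈ atlas (ModelPi fun _ : Fin n => EuclideanSpace ℝ (Fin 1)) (Fin n → Circle),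
      ∃ e₁ : ∀ _ : Fin n, OpenPartialHomeomorph Circle (EuclideanSpace ℝ (Fin 1)),
        (∀ i, e₁ i ∈ atlas (EuclideanSpace ℝ (Fin 1)) Circle) ∧ OpenPartialHomeomorph.pi e₁ = e := by
    rintro e ⟨e₁, h, rfl⟩
    exact ⟨e₁, fun i => h i trivial, rfl⟩
  refine isManifold_of_contDiffOn _ _ _ fun e e' he he' => ?_
  obtain ⟨e, h1, rfl⟩ := hp e he
  obtain ⟨e', h2, rfl⟩ := hp e' he'
  refine contDiffOn_pi.2 fun i => ?_
  have key := (contDiffGroupoid ∞ (𝓡 1)).compatible (h1 i) (h2 i)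
  have key := (mem_groupoid_of_pregroupoid.1 key).1
  have key : ContDiffOn ℝ ∞ ((𝓡 1) ∘ ((e i).symm ≫ₕ e' i) ∘ (𝓡 1).symm)
    ((𝓡 1).symm ⁻¹' ((e i).symm ≫ₕ e' i).source ∩ Set.range (𝓡 1)) := key
  refine key.comp (contDiff_apply ℝ (EuclideanSpace ℝ (Fin 1)) i).contDiffOn ?_
  rintro y ⟨hy, -⟩
  refine ⟨?_, by simp⟩
  have h3 : (torusModel n).symm y ∈ (OpenPartialHomeomorph.pi e).symm.source := hy.1
  have h4 : (OpenPartialHomeomorph.pi e).symm ((torusModel n).symm y) ∈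
    (OpenPartialHomeomorph.pi e').source := hy.2
  exact ⟨h3 i trivial, h4 i trivial⟩

instance (n : ℕ) : (torusModel n).Boundaryless where
  range_eq_univ := by
    refine Set.eq_univ_of_forall fun y => ⟨y, rfl⟩

/-- The torus `T^n = U(1)^n`. -/
def T (n : ℕ) : Mfd where
  carrier := Fin n → Circle
  E := Fin n → EuclideanSpace ℝ (Fin 1)
  H := ModelPi fun _ : Fin n => EuclideanSpace ℝ (Fin 1)
  I := torusModel n
  mfd := torus_isManifold n

theorem smooth_torus_coord {n : ℕ} (i : Fin n) : Smooth (M := T n) (N := U1) (fun t => t i) := by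
  intro x
  refine contMDiffAt_iff.2 ⟨(continuous_apply i).continuousAt, ?_⟩
  have h : ∀ y ∈ (extChartAt (T n).I x).target, y i ∈ (extChartAt U1.I (M := U1) (x i)).target := by
    intro y hy
    exact ⟨Set.mem_univ _, hy.2 i trivial⟩
  refine ContDiffWithinAt.congr_of_eventuallyEq
    (f := fun y : (T n).E => y i) ?_ ?_ ?_
  · exact (contDiff_apply ℝ (EuclideanSpace ℝ (Fin 1)) i).contDiffWithinAt
  · refine Filter.eventuallyEq_of_mem (extChartAt_target_mem_nhdsWithin (I := (T n).I) x)
      fun y hy => ?_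
    exact (extChartAt U1.I (M := U1) (x i)).right_inv (h y hy)
  · exact (extChartAt U1.I (M := U1) (x i)).right_inv
      (mem_extChartAt_target (I := U1.I) (M := U1) (x i))

theorem smooth_torus_iff {M : Mfd} {n : ℕ} (f : M → T n) :
    Smooth f ↔ ∀ i, Smooth (N := U1) fun x => f x i := by
  constructor
  · intro h i x
    exact (smooth_torus_coord i).comp h x
  · intro h x
    refine contMDiffAt_iff_target.2 ⟨continuousAt_pi.2 fun i => (h i).continuous.continuousAt, ?_⟩
    refine contMDiffAt_pi_space.2 fun i => ?_
    exact (contMDiffAt_iff_target.1 (h i x)).2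

end Torus
instance : CommGroup U1 := inferInstanceAs (CommGroup Circle)
instance (n : ℕ) : CommGroup (T n) := inferInstanceAs (CommGroup (Fin n → Circle))

theorem smooth_U1_mul : Smooth (M := U1.prod U1) (N := U1) (fun x => x.1 * x.2) :=
  (contMDiff_mul (𝓡 1) ω (G := Circle)).of_le le_top

theorem smooth_U1_inv : Smooth (M := U1) (N := U1) (fun x => x⁻¹) :=
  (contMDiff_inv (𝓡 1) ω (G := Circle)).of_le le_top

theorem Smooth.mul_U1 {M : Mfd} {f g : M → U1} (hf : Smooth f) (hg : Smooth g) :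
    Smooth (fun x => f x * g x) := smooth_U1_mul.comp (hf.prodMk hg)

theorem Smooth.inv_U1 {M : Mfd} {f : M → U1} (hf : Smooth f) :
    Smooth (fun x => (f x)⁻¹) := smooth_U1_inv.comp hf

theorem Smooth.mul_T {M : Mfd} {n : ℕ} {f g : M → T n} (hf : Smooth f) (hg : Smooth g) :
    Smooth (fun x => f x * g x) :=
  (smooth_torus_iff _).2 fun i =>
    Smooth.mul_U1 ((smooth_torus_iff f).1 hf i) ((smooth_torus_iff g).1 hg i)

theorem Smooth.inv_T {M : Mfd} {n : ℕ} {f : M → T n} (hf : Smooth f) :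
    Smooth (fun x => (f x)⁻¹) :=
  (smooth_torus_iff _).2 fun i => Smooth.inv_U1 ((smooth_torus_iff f).1 hf i)

end Mfd
end TDual

end Manifolds

namespace TDual
open Mfd (Smooth U1 T)

/-- A `U(1)`-bundle gerbe over `M`: a surjective submersion `Y → M`, a principal `U(1)`-bundle
`(src, tgt) : P → Y ×_M Y`, and an associative bundle gerbe product `mul`, `U(1)`-equivariant in
both arguments. The unit section `one` of the product is uniquely determined by `mul`.
Smoothness on fibre products is tested on smooth families `K → P`, `K → P`. -/
structure BundleGerbe (M : Mfd) : Type 1 where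
  Y : Mfd
  proj : Y ⟶ M
  proj_submersion : Mfd.IsSurjSubmersion proj
  P : Mfd
  src : P ⟶ Y
  tgt : P ⟶ Y
  proj_src : ∀ p, proj (src p) = proj (tgt p)
  smul : U1 → P → P
  smul_smooth : Smooth (M := U1.prod P) (fun x => smul x.1 x.2)
  one_smul : ∀ p, smul 1 p = p
  mul_smul : ∀ c d p, smul (c * d) p = smul c (smul d p)
  src_smul : ∀ c p, src (smul c p) = src p
  tgt_smul : ∀ c p, tgt (smul c p) = tgt p
  simply_transitive : ∀ p q, src p = src q → tgt p = tgt q → ∃! c, smul c p = q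
  local_sections : ∀ (K : Mfd) (y z : K ⟶ Y), (∀ k, proj (y k) = proj (z k)) → ∀ k₀ : K,
    ∃ U : TopologicalSpace.Opens K, k₀ ∈ U ∧ ∃ p : K.restrict U ⟶ P,
      ∀ k, src (p k) = y k.1 ∧ tgt (p k) = z k.1
  mul : ∀ p q, tgt p = src q → P
  mul_smooth : ∀ (K : Mfd) (p q : K ⟶ P) (h : ∀ k, tgt (p k) = src (q k)),
    Smooth fun k => mul (p k) (q k) (h k)
  src_mul : ∀ p q h, src (mul p q h) = src p
  tgt_mul : ∀ p q h, tgt (mul p q h) = tgt q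
  mul_assoc : ∀ p q r h₁ h₂ h₃ h₄, mul (mul p q h₁) r h₂ = mul p (mul q r h₃) h₄
  smul_mul : ∀ c p q h h', mul (smul c p) q h' = smul c (mul p q h)
  mul_smul_right : ∀ c p q h h', mul p (smul c q) h' = smul c (mul p q h)
  one : Y ⟶ P
  src_one : ∀ y, src (one y) = y
  tgt_one : ∀ y, tgt (one y) = y
  one_mul : ∀ p h, mul (one (src p)) p h = p
  mul_one : ∀ p h, mul p (one (tgt p)) h = p

namespace BundleGerbe

variable {M : Mfd} (G : BundleGerbe M)

/-- The Lie groupoid of a bundle gerbe: objects are the points of `Y`, morphisms `y ⟶ z` are the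
points of the fibre of `P` over `(y, z)`, and composition is the bundle gerbe product. -/
instance : Category G.Y where
  Hom y z := {p : G.P // G.src p = y ∧ G.tgt p = z}
  id y := ⟨G.one y, G.src_one y, G.tgt_one y⟩
  comp f g := ⟨G.mul f.1 g.1 (f.2.2.trans g.2.1.symm),
    (G.src_mul _ _ _).trans f.2.1, (G.tgt_mul _ _ _).trans g.2.2⟩
  id_comp := by
    rintro y z ⟨f, rfl, rfl⟩
    exact Subtype.ext (G.one_mul f _)
  comp_id := by
    rintro y z ⟨f, rfl, rfl⟩
    exact Subtype.ext (G.mul_one f _)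
  assoc f g h := Subtype.ext (G.mul_assoc _ _ _ _ _ _ _)

variable {G}

/-- The point of `P` underlying a morphism. -/
def val {y z : G.Y} (f : y ⟶ z) : G.P := f.1

theorem val_injective {y z : G.Y} {f g : y ⟶ z} (h : val f = val g) : f = g := Subtype.ext h

@[simp] theorem src_val {y z : G.Y} (f : y ⟶ z) : G.src (val f) = y := f.2.1
@[simp] theorem tgt_val {y z : G.Y} (f : y ⟶ z) : G.tgt (val f) = z := f.2.2

variable (G) in
/-- The morphism given by a point of `P`. -/
def hom (p : G.P) : G.src p ⟶ G.tgt p := ⟨p, rfl, rfl⟩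

@[simp] theorem val_hom (p : G.P) : val (G.hom p) = p := rfl

/-- The action of `U(1)` on morphisms. -/
def act (c : U1) {y z : G.Y} (f : y ⟶ z) : y ⟶ z :=
  ⟨G.smul c f.1, (G.src_smul _ _).trans f.2.1, (G.tgt_smul _ _).trans f.2.2⟩

theorem act_comp (c : U1) {x y z : G.Y} (f : x ⟶ y) (g : y ⟶ z) :
    act c f ≫ g = act c (f ≫ g) := Subtype.ext (G.smul_mul _ _ _ _ _)

theorem comp_act (c : U1) {x y z : G.Y} (f : x ⟶ y) (g : y ⟶ z) :
    f ≫ act c g = act c (f ≫ g) := Subtype.ext (G.mul_smul_right _ _ _ _ _)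

theorem one_act {y z : G.Y} (f : y ⟶ z) : act 1 f = f := Subtype.ext (G.one_smul _)

theorem mul_act (c d : U1) {y z : G.Y} (f : y ⟶ z) : act (c * d) f = act c (act d f) :=
  Subtype.ext (G.mul_smul _ _ _)

theorem exists_act {y z : G.Y} (f g : y ⟶ z) : ∃ c, act c f = g := by
  obtain ⟨c, hc, -⟩ := G.simply_transitive f.1 g.1 (f.2.1.trans g.2.1.symm)
    (f.2.2.trans g.2.2.symm)
  exact ⟨c, Subtype.ext hc⟩

theorem act_injective {y z : G.Y} (f : y ⟶ z) {c d : U1} (h : act c f = act d f) : c = d := by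
  obtain ⟨e, -, he⟩ := G.simply_transitive f.1 (act d f).1 (f.2.1.trans (act d f).2.1.symm)
    (f.2.2.trans (act d f).2.2.symm)
  exact (he c (congrArg Subtype.val h)).trans (he d rfl).symm

theorem eq_id_of_idem {y : G.Y} (f : y ⟶ y) (h : f ≫ f = f) : f = 𝟙 y := by
  obtain ⟨c, rfl⟩ := exists_act (𝟙 y) f
  rw [act_comp, Category.id_comp, ← mul_act] at h
  have : c = 1 := by simpa using act_injective _ h
  rw [this, one_act]

theorem smooth_val_comp {K : Mfd} {x y z : K → G.Y} (f : ∀ k, x k ⟶ y k) (g : ∀ k, y k ⟶ z k)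
    (hf : Smooth fun k => val (f k)) (hg : Smooth fun k => val (g k)) :
    Smooth fun k => val (f k ≫ g k) :=
  G.mul_smooth K ⟨_, hf⟩ ⟨_, hg⟩ fun k => (f k).2.2.trans (g k).2.1.symm

theorem smooth_val_id {K : Mfd} (y : K → G.Y) (hy : Smooth y) :
    Smooth fun k => val (𝟙 (y k)) := G.one.smooth.comp hy

end BundleGerbe

open BundleGerbe

/-- A manifold together with a bundle gerbe over it. -/
structure GerbeOver : Type 1 where
  base : Mfd
  gerbe : BundleGerbe base

/-- A bundle gerbe 1-morphism `G → f^* G'` along a smooth map `f = base`: a smooth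
`U(1)`-equivariant functor over `f` from the groupoid of `G`, restricted along an open cover
`U` of `Y`, to the groupoid of `G'`. -/
structure GerbeMor (G G' : GerbeOver) : Type 1 where
  base : G.base ⟶ G'.base
  ι : Type
  U : ι → Set G.gerbe.Y
  isOpen : ∀ i, IsOpen (U i)
  cover : ∀ y, ∃ i, y ∈ U i
  obj : ∀ (i : ι) (y : G.gerbe.Y), y ∈ U i → G'.gerbe.Y
  proj_obj : ∀ i y h, G'.gerbe.proj (obj i y h) = base (G.gerbe.proj y)
  obj_smooth : ∀ (K : Mfd) (i : ι) (y : K ⟶ G.gerbe.Y) (h : ∀ k, y k ∈ U i),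
    Smooth fun k => obj i (y k) (h k)
  map : ∀ {i j : ι} {y z : G.gerbe.Y} (hi : y ∈ U i) (hj : z ∈ U j),
    (y ⟶ z) → (obj i y hi ⟶ obj j z hj)
  map_comp : ∀ {i j k : ι} {x y z : G.gerbe.Y} (hi : x ∈ U i) (hj : y ∈ U j) (hk : z ∈ U k)
    (f : x ⟶ y) (g : y ⟶ z), map hi hk (f ≫ g) = map hi hj f ≫ map hj hk g
  map_act : ∀ {i j : ι} {y z : G.gerbe.Y} (hi : y ∈ U i) (hj : z ∈ U j) (c : U1) (f : y ⟶ z),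
    map hi hj (act c f) = act c (map hi hj f)
  map_smooth : ∀ (K : Mfd) (i j : ι) (p : K ⟶ G.gerbe.P) (hi : ∀ k, G.gerbe.src (p k) ∈ U i)
    (hj : ∀ k, G.gerbe.tgt (p k) ∈ U j),
    Smooth fun k => val (map (hi k) (hj k) (G.gerbe.hom (p k)))

namespace GerbeMor

variable {G G' G'' G''' : GerbeOver}

@[simp] theorem map_id (u : GerbeMor G G') {i : u.ι} {y : G.gerbe.Y} (hi : y ∈ u.U i) :
    u.map hi hi (𝟙 y) = 𝟙 _ :=
  eq_id_of_idem _ (by rw [← u.map_comp, Category.comp_id])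

theorem map_val_smooth (u : GerbeMor G G') {K : Mfd} {i j : u.ι} {y z : K → G.gerbe.Y}
    (f : ∀ k, y k ⟶ z k) (hf : Smooth fun k => val (f k))
    (hi : ∀ k, y k ∈ u.U i) (hj : ∀ k, z k ∈ u.U j) :
    Smooth fun k => val (u.map (hi k) (hj k) (f k)) := by
  have h := u.map_smooth K i j ⟨_, hf⟩ (fun k => by simpa using hi k) (fun k => by simpa using hj k)
  convert h using 2 with k
  have : ∀ {y y' z z' : G.gerbe.Y} (f : y ⟶ z) (f' : y' ⟶ z') (h1 : y ∈ u.U i) (h2 : z ∈ u.U j)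
      (h1' : y' ∈ u.U i) (h2' : z' ∈ u.U j), val f = val f' →
      val (u.map h1 h2 f) = val (u.map h1' h2' f') := by
    rintro y y' z z' ⟨f, rfl, rfl⟩ ⟨f', rfl, rfl⟩ h1 h2 h1' h2' (rfl : f = f')
    rfl
  exact this _ _ _ _ _ _ rfl

/-- A bundle gerbe 2-morphism between 1-morphisms along the same map: a smooth natural
transformation over the common refinement of the two open covers. -/
@[ext] structure Hom₂ (u v : GerbeMor G G') : Type where
  base_eq : u.base = v.base
  app : ∀ {i : u.ι} {j : v.ι} {y : G.gerbe.Y} (hi : y ∈ u.U i) (hj : y ∈ v.U j),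
    u.obj i y hi ⟶ v.obj j y hj
  naturality : ∀ {i i' : u.ι} {j j' : v.ι} {y z : G.gerbe.Y} (hi : y ∈ u.U i) (hi' : z ∈ u.U i')
    (hj : y ∈ v.U j) (hj' : z ∈ v.U j') (f : y ⟶ z),
    app hi hj ≫ v.map hj hj' f = u.map hi hi' f ≫ app hi' hj'
  smooth : ∀ (K : Mfd) (i : u.ι) (j : v.ι) (y : K ⟶ G.gerbe.Y) (hi : ∀ k, y k ∈ u.U i)
    (hj : ∀ k, y k ∈ v.U j), Smooth fun k => val (app (hi k) (hj k))

namespace Hom₂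

variable {u v w : GerbeMor G G'}

@[simp]
theorem app_map_id (α : Hom₂ u v) {i j j' y} (hi : y ∈ u.U i) (hj : y ∈ v.U j) (hj' : y ∈ v.U j') :
    α.app hi hj ≫ v.map hj hj' (𝟙 y) = α.app hi hj' := by
  rw [α.naturality hi hi hj hj']; simp

@[simp]
theorem map_id_app (α : Hom₂ u v) {i i' j y} (hi : y ∈ u.U i) (hi' : y ∈ u.U i') (hj : y ∈ v.U j) :
    u.map hi hi' (𝟙 y) ≫ α.app hi' hj = α.app hi hj := by
  rw [← α.naturality hi hi' hj hj]; simp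

@[simp]
theorem app_map_id_assoc (α : Hom₂ u v) {i j j' y} (hi : y ∈ u.U i) (hj : y ∈ v.U j)
    (hj' : y ∈ v.U j') {t : G'.gerbe.Y} (f : v.obj j' y hj' ⟶ t) :
    α.app hi hj ≫ v.map hj hj' (𝟙 y) ≫ f = α.app hi hj' ≫ f := by
  rw [← Category.assoc, app_map_id]

@[simp]
theorem map_id_app_assoc (α : Hom₂ u v) {i i' j y} (hi : y ∈ u.U i) (hi' : y ∈ u.U i')
    (hj : y ∈ v.U j) {t : G'.gerbe.Y} (f : v.obj j y hj ⟶ t) :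
    u.map hi hi' (𝟙 y) ≫ α.app hi' hj ≫ f = α.app hi hj ≫ f := by
  rw [← Category.assoc, map_id_app]

def id (u : GerbeMor G G') : Hom₂ u u where
  base_eq := rfl
  app hi hj := u.map hi hj (𝟙 _)
  naturality hi hi' hj hj' f := by simp [← u.map_comp]
  smooth K i j y hi hj := u.map_val_smooth _ (smooth_val_id _ y.smooth) hi hj

theorem comp_indep (α : Hom₂ u v) (β : Hom₂ v w) {i j j' k y} (hi : y ∈ u.U i) (hj : y ∈ v.U j)
    (hj' : y ∈ v.U j') (hk : y ∈ w.U k) :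
    α.app hi hj ≫ β.app hj hk = α.app hi hj' ≫ β.app hj' hk := by
  rw [← α.app_map_id hi hj hj', Category.assoc, β.map_id_app]

def comp (α : Hom₂ u v) (β : Hom₂ v w) : Hom₂ u w where
  base_eq := α.base_eq.trans β.base_eq
  app {i k y} hi hk := α.app hi (v.cover y).choose_spec ≫ β.app (v.cover y).choose_spec hk
  naturality {i i' k k' y z} hi hi' hk hk' f := by
    rw [Category.assoc, β.naturality _ (v.cover z).choose_spec, ← Category.assoc,
      α.naturality hi hi', Category.assoc]
  smooth K i k y hi hk := by
    refine Mfd.smooth_of_local _ fun k₀ => ?_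
    obtain ⟨j, hj⟩ := v.cover (y k₀)
    refine ⟨⟨y ⁻¹' v.U j, (v.isOpen j).preimage y.smooth.continuous⟩, hj, ?_⟩
    set V : TopologicalSpace.Opens K := ⟨y ⁻¹' v.U j, (v.isOpen j).preimage y.smooth.continuous⟩
    have h1 := α.smooth (K.restrict V) i j (K.restrictIncl V ≫ y) (fun k => hi k.1) (fun k => k.2)
    have h2 := β.smooth (K.restrict V) j k (K.restrictIncl V ≫ y) (fun k => k.2) (fun k => hk k.1)
    refine Eq.mp (congrArg Smooth (funext fun k' => congrArg val ?_)) (smooth_val_comp _ _ h1 h2)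
    exact comp_indep α β (hi k'.1) _ _ (hk k'.1)

theorem comp_app (α : Hom₂ u v) (β : Hom₂ v w) {i j k y} (hi : y ∈ u.U i) (hj : y ∈ v.U j)
    (hk : y ∈ w.U k) : (comp α β).app hi hk = α.app hi hj ≫ β.app hj hk :=
  comp_indep α β hi _ hj hk

end Hom₂

instance : Category (GerbeMor G G') where
  Hom u v := Hom₂ u v
  id u := Hom₂.id u
  comp α β := Hom₂.comp α β
  id_comp {u v} α := by
    ext i j y hi hj
    rw [Hom₂.comp_app _ _ hi hi hj]
    exact α.map_id_app _ _ _
  comp_id {u v} α := by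
    ext i j y hi hj
    rw [Hom₂.comp_app _ _ hi hj hj]
    exact α.app_map_id _ _ _
  assoc {u v w x} α β γ := by
    ext i l y hi hl
    obtain ⟨j, hj⟩ := v.cover y
    obtain ⟨k, hk⟩ := w.cover y
    rw [Hom₂.comp_app _ _ hi hk hl, Hom₂.comp_app _ _ hi hj hk, Hom₂.comp_app _ _ hi hj hl,
      Hom₂.comp_app _ _ hj hk hl, Category.assoc]

@[ext] theorem hom₂_ext {u v : GerbeMor G G'} {α β : u ⟶ v}
    (h : ∀ i j y (hi : y ∈ u.U i) (hj : y ∈ v.U j), α.app hi hj = β.app hi hj) : α = β :=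
  Hom₂.ext (by funext i j y hi hj; exact h i j y hi hj)

theorem id_app (u : GerbeMor G G') {i j y} (hi : y ∈ u.U i) (hj : y ∈ u.U j) :
    Hom₂.app (𝟙 u) hi hj = u.map hi hj (𝟙 y) := rfl

theorem comp_app {u v w : GerbeMor G G'} (α : u ⟶ v) (β : v ⟶ w) {i j k y} (hi : y ∈ u.U i)
    (hj : y ∈ v.U j) (hk : y ∈ w.U k) : (α ≫ β).app hi hk = α.app hi hj ≫ β.app hj hk :=
  Hom₂.comp_app α β hi hj hk

end GerbeMor
end TDual

namespace TDual
open Mfd (Smooth U1 T)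
open BundleGerbe
namespace GerbeMor

variable {G G' G'' G''' G₄ : GerbeOver}

/-- The identity 1-morphism. -/
@[reducible] def idMor (G : GerbeOver) : GerbeMor G G where
  base := 𝟙 _
  ι := Unit
  U _ := Set.univ
  isOpen _ := isOpen_univ
  cover _ := ⟨(), trivial⟩
  obj _ y _ := y
  proj_obj _ _ _ := rfl
  obj_smooth _ _ y _ := y.smooth
  map _ _ f := f
  map_comp _ _ _ _ _ := rfl
  map_act _ _ _ _ := rfl
  map_smooth _ _ _ p _ _ := p.smooth

/-- Composition of 1-morphisms, over the refined open cover. -/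
@[reducible] def compMor (u : GerbeMor G G') (v : GerbeMor G' G'') : GerbeMor G G'' where
  base := u.base ≫ v.base
  ι := u.ι × v.ι
  U i := {y | ∃ h : y ∈ u.U i.1, u.obj i.1 y h ∈ v.U i.2}
  isOpen := by
    rintro ⟨i, j⟩
    let V : TopologicalSpace.Opens G.gerbe.Y := ⟨u.U i, u.isOpen i⟩
    have hc : Continuous fun y : V => u.obj i y.1 y.2 :=
      (u.obj_smooth (G.gerbe.Y.restrict V) i (G.gerbe.Y.restrictIncl V) (fun y => y.2)).continuous
    have h := V.isOpen.isOpenMap_subtype_val _ ((v.isOpen j).preimage hc)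
    convert h using 1
    ext y
    constructor
    · rintro ⟨h1, h2⟩
      exact ⟨⟨y, h1⟩, h2, rfl⟩
    · rintro ⟨⟨y, h1⟩, h2, rfl⟩
      exact ⟨h1, h2⟩
  cover y := by
    obtain ⟨i, hi⟩ := u.cover y
    obtain ⟨j, hj⟩ := v.cover (u.obj i y hi)
    exact ⟨(i, j), hi, hj⟩
  obj i y h := v.obj i.2 (u.obj i.1 y h.fst) h.snd
  proj_obj i y h := by rw [v.proj_obj, u.proj_obj]; rfl
  obj_smooth K i y h :=
    v.obj_smooth K i.2 ⟨_, u.obj_smooth K i.1 y fun k => (h k).fst⟩ fun k => (h k).snd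
  map hi hj f := v.map hi.snd hj.snd (u.map hi.fst hj.fst f)
  map_comp hi hj hk f g := by rw [u.map_comp hi.fst hj.fst hk.fst, v.map_comp]
  map_act hi hj c f := by rw [u.map_act, v.map_act]
  map_smooth K i j p hi hj := v.map_val_smooth _
    (u.map_smooth K i.1 j.1 p (fun k => (hi k).fst) fun k => (hj k).fst) _ _

instance : CategoryStruct GerbeOver where
  Hom := GerbeMor
  id := idMor
  comp := compMor

instance homCat (G G' : GerbeOver) : Category (G ⟶ G') :=
  inferInstanceAs (Category (GerbeMor G G'))

@[ext] theorem hom₂_ext' {u v : G ⟶ G'} {α β : u ⟶ v}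
    (h : ∀ i j y (hi : y ∈ u.U i) (hj : y ∈ v.U j), α.app hi hj = β.app hi hj) : α = β :=
  hom₂_ext h

theorem id_app' (u : G ⟶ G') {i j y} (hi : y ∈ u.U i) (hj : y ∈ u.U j) :
    Hom₂.app (𝟙 u) hi hj = u.map hi hj (𝟙 y) := rfl

theorem comp_app' {u v w : G ⟶ G'} (α : u ⟶ v) (β : v ⟶ w) {i j k y} (hi : y ∈ u.U i)
    (hj : y ∈ v.U j) (hk : y ∈ w.U k) : (α ≫ β).app hi hk = α.app hi hj ≫ β.app hj hk :=
  Hom₂.comp_app α β hi hj hk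

theorem whiskerLeft_indep (u : G ⟶ G') {v w : G' ⟶ G''} (β : v ⟶ w) {i i' j j' j'' k y}
    (hi : y ∈ u.U i) (hi' : y ∈ u.U i') (hj : u.obj i y hi ∈ v.U j)
    (hj' : u.obj i' y hi' ∈ v.U j') (hj'' : u.obj i' y hi' ∈ v.U j'')
    (hk : u.obj i' y hi' ∈ w.U k) :
    v.map hj hj' (u.map hi hi' (𝟙 y)) ≫ β.app hj' hk =
      v.map hj hj'' (u.map hi hi' (𝟙 y)) ≫ β.app hj'' hk := by
  rw [← β.map_id_app hj' hj'' hk, ← Category.assoc, ← v.map_comp, Category.comp_id]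

/-- Left whiskering. -/
def whiskerL (u : G ⟶ G') {v w : G' ⟶ G''} (β : v ⟶ w) : u ≫ v ⟶ u ≫ w where
  base_eq := congrArg (u.base ≫ ·) β.base_eq
  app {i k y} hi hk := v.map hi.snd (v.cover (u.obj k.1 y hk.fst)).choose_spec
    (u.map hi.fst hk.fst (𝟙 y)) ≫ β.app (v.cover (u.obj k.1 y hk.fst)).choose_spec hk.snd
  naturality {i i' k k' y z} hi hi' hk hk' f := by
    have e : u.map hk.fst hk'.fst f = u.map hk.fst hk'.fst f := rfl
    change (_ ≫ _) ≫ w.map hk.snd hk'.snd (u.map hk.fst hk'.fst f) =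
      v.map hi.snd hi'.snd (u.map hi.fst hi'.fst f) ≫ _ ≫ _
    rw [Category.assoc, β.naturality _ (v.cover (u.obj k'.1 z hk'.fst)).choose_spec,
      ← Category.assoc, ← Category.assoc, ← v.map_comp, ← v.map_comp, ← u.map_comp, ← u.map_comp,
      Category.id_comp, Category.comp_id]
  smooth K i k y hi hk := by
    refine Mfd.smooth_of_local _ fun k₀ => ?_
    let y' : K ⟶ G'.gerbe.Y := ⟨_, u.obj_smooth K k.1 y fun x => (hk x).fst⟩
    obtain ⟨j, hj⟩ := v.cover (y' k₀)
    let V : TopologicalSpace.Opens K := ⟨y' ⁻¹' v.U j, (v.isOpen j).preimage y'.smooth.continuous⟩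
    refine ⟨V, hj, ?_⟩
    have h0 := u.map_val_smooth (K := K.restrict V) (i := i.1) (j := k.1)
      (fun k => 𝟙 (y k.1)) (smooth_val_id _ (K.restrictIncl V ≫ y).smooth)
      (fun x => (hi x.1).fst) (fun x => (hk x.1).fst)
    have h1 := v.map_val_smooth (K := K.restrict V) (i := i.2) (j := j) _ h0
      (fun x => (hi x.1).snd) (fun x => x.2)
    have h2 := β.smooth (K.restrict V) j k.2 (K.restrictIncl V ≫ y') (fun k => k.2)
      (fun x => (hk x.1).snd)
    refine Eq.mp (congrArg Smooth (funext fun x => congrArg val ?_)) (smooth_val_comp _ _ h1 h2)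
    exact whiskerLeft_indep u β _ _ _ _ _ _

theorem whiskerL_app (u : G ⟶ G') {v w : G' ⟶ G''} (β : v ⟶ w) {i k y}
    (hi : y ∈ (u ≫ v).U i) (hk : y ∈ (u ≫ w).U k) {j} (hj : u.obj k.1 y hk.fst ∈ v.U j) :
    (whiskerL u β).app hi hk =
      v.map hi.snd hj (u.map hi.fst hk.fst (𝟙 y)) ≫ β.app hj hk.snd :=
  whiskerLeft_indep u β _ _ _ _ _ _

/-- Right whiskering. -/
def whiskerR {u v : G ⟶ G'} (α : u ⟶ v) (w : G' ⟶ G'') : u ≫ w ⟶ v ≫ w where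
  base_eq := congrArg (· ≫ w.base) α.base_eq
  app {i k y} hi hk := w.map hi.snd hk.snd (α.app hi.fst hk.fst)
  naturality {i i' k k' y z} hi hi' hk hk' f := by
    change w.map hi.snd hk.snd (α.app hi.fst hk.fst) ≫
      w.map hk.snd hk'.snd (v.map hk.fst hk'.fst f) =
      w.map hi.snd hi'.snd (u.map hi.fst hi'.fst f) ≫ w.map _ _ _
    rw [← w.map_comp, ← w.map_comp, α.naturality hi.fst hi'.fst]
  smooth K i k y hi hk := w.map_val_smooth _ (α.smooth K i.1 k.1 y (fun x => (hi x).fst)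
    (fun x => (hk x).fst)) _ _

/-- The canonical 2-isomorphisms relating the refined covers of iterated compositions. -/
def assocHom (u : G ⟶ G') (v : G' ⟶ G'') (w : G'' ⟶ G''') : (u ≫ v) ≫ w ⟶ u ≫ v ≫ w where
  base_eq := rfl
  app hi hj := w.map hi.snd hj.snd.snd
    (v.map hi.fst.snd hj.snd.fst (u.map hi.fst.fst hj.fst (𝟙 _)))
  naturality {i i' j j' y z} hi hi' hj hj' f := by
    change _ ≫ w.map hj.snd.snd hj'.snd.snd (v.map hj.snd.fst hj'.snd.fst (u.map hj.fst hj'.fst f)) =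
      w.map hi.snd hi'.snd (v.map hi.fst.snd hi'.fst.snd (u.map hi.fst.fst hi'.fst.fst f)) ≫ _
    rw [← w.map_comp, ← v.map_comp, ← u.map_comp, ← w.map_comp, ← v.map_comp, ← u.map_comp,
      Category.id_comp, Category.comp_id]
  smooth K i j y hi hj := w.map_val_smooth _ (v.map_val_smooth _ (u.map_val_smooth _
    (smooth_val_id _ y.smooth) (fun k => (hi k).fst.fst) (fun k => (hj k).fst))
    (fun k => (hi k).fst.snd) (fun k => (hj k).snd.fst)) _ _

def assocInv (u : G ⟶ G') (v : G' ⟶ G'') (w : G'' ⟶ G''') : u ≫ v ≫ w ⟶ (u ≫ v) ≫ w where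
  base_eq := rfl
  app hi hj := w.map hi.snd.snd hj.snd
    (v.map hi.snd.fst hj.fst.snd (u.map hi.fst hj.fst.fst (𝟙 _)))
  naturality {i i' j j' y z} hi hi' hj hj' f := by
    change _ ≫ w.map hj.snd hj'.snd (v.map hj.fst.snd hj'.fst.snd (u.map hj.fst.fst hj'.fst.fst f)) =
      w.map hi.snd.snd hi'.snd.snd (v.map hi.snd.fst hi'.snd.fst (u.map hi.fst hi'.fst f)) ≫ _
    rw [← w.map_comp, ← v.map_comp, ← u.map_comp, ← w.map_comp, ← v.map_comp, ← u.map_comp,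
      Category.id_comp, Category.comp_id]
  smooth K i j y hi hj := w.map_val_smooth _ (v.map_val_smooth _ (u.map_val_smooth _
    (smooth_val_id _ y.smooth) (fun k => (hi k).fst) (fun k => (hj k).fst.fst))
    (fun k => (hi k).snd.fst) (fun k => (hj k).fst.snd)) _ _

def assocIso (u : G ⟶ G') (v : G' ⟶ G'') (w : G'' ⟶ G''') : (u ≫ v) ≫ w ≅ u ≫ v ≫ w where
  hom := assocHom u v w
  inv := assocInv u v w
  hom_inv_id := by
    ext i j y hi hj
    have hm : y ∈ (u ≫ v ≫ w).U (i.1.1, i.1.2, i.2) := ⟨hi.fst.fst, hi.fst.snd, hi.snd⟩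
    rw [comp_app' _ _ hi hm hj, id_app']
    change w.map hi.snd hm.snd.snd
      (v.map hi.fst.snd hm.snd.fst (u.map hi.fst.fst hm.fst (𝟙 _))) ≫
      w.map hm.snd.snd hj.snd (v.map hm.snd.fst hj.fst.snd (u.map hm.fst hj.fst.fst (𝟙 _))) =
      w.map hi.snd hj.snd (v.map hi.fst.snd hj.fst.snd (u.map hi.fst.fst hj.fst.fst (𝟙 _)))
    rw [← w.map_comp, ← v.map_comp, ← u.map_comp, Category.id_comp]
  inv_hom_id := by
    ext i j y hi hj
    have hm : y ∈ ((u ≫ v) ≫ w).U ((i.1, i.2.1), i.2.2) := ⟨⟨hi.fst, hi.snd.fst⟩, hi.snd.snd⟩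
    rw [comp_app' _ _ hi hm hj, id_app']
    change w.map hi.snd.snd hm.snd
      (v.map hi.snd.fst hm.fst.snd (u.map hi.fst hm.fst.fst (𝟙 _))) ≫
      w.map hm.snd hj.snd.snd (v.map hm.fst.snd hj.snd.fst (u.map hm.fst.fst hj.fst (𝟙 _))) =
      w.map hi.snd.snd hj.snd.snd (v.map hi.snd.fst hj.snd.fst (u.map hi.fst hj.fst (𝟙 _)))
    rw [← w.map_comp, ← v.map_comp, ← u.map_comp, Category.id_comp]

def leftUnitIso (u : G ⟶ G') : 𝟙 G ≫ u ≅ u where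
  hom :=
    { base_eq := rfl
      app := fun hi hj => u.map hi.snd hj (𝟙 _)
      naturality := fun {i i' j j' y z} hi hi' hj hj' f => by
        change _ ≫ u.map hj hj' f = u.map hi.snd hi'.snd f ≫ _
        rw [← u.map_comp, ← u.map_comp, Category.id_comp, Category.comp_id]
      smooth := fun K i j y hi hj => u.map_val_smooth _ (smooth_val_id _ y.smooth) _ _ }
  inv :=
    { base_eq := rfl
      app := fun hi hj => u.map hi hj.snd (𝟙 _)
      naturality := fun {i i' j j' y z} hi hi' hj hj' f => by
        change _ ≫ u.map hj.snd hj'.snd f = u.map hi hi' f ≫ _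
        rw [← u.map_comp, ← u.map_comp, Category.id_comp, Category.comp_id]
      smooth := fun K i j y hi hj => u.map_val_smooth _ (smooth_val_id _ y.smooth) _ _ }
  hom_inv_id := by
    ext i j y hi hj
    rw [comp_app' _ _ hi hi.snd hj, id_app']
    change u.map hi.snd hi.snd (𝟙 _) ≫ u.map hi.snd hj.snd (𝟙 _) = u.map hi.snd hj.snd (𝟙 _)
    rw [← u.map_comp, Category.id_comp]
  inv_hom_id := by
    ext i j y hi hj
    have hm : y ∈ (𝟙 G ≫ u).U ((), i) := ⟨trivial, hi⟩
    rw [comp_app' _ _ hi hm hj, id_app']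
    change u.map hi hm.snd (𝟙 _) ≫ u.map hm.snd hj (𝟙 _) = u.map hi hj (𝟙 _)
    rw [← u.map_comp, Category.id_comp]
    rfl

def rightUnitIso (u : G ⟶ G') : u ≫ 𝟙 G' ≅ u where
  hom :=
    { base_eq := rfl
      app := fun hi hj => u.map hi.fst hj (𝟙 _)
      naturality := fun {i i' j j' y z} hi hi' hj hj' f => by
        change _ ≫ u.map hj hj' f = u.map hi.fst hi'.fst f ≫ _
        rw [← u.map_comp, ← u.map_comp, Category.id_comp, Category.comp_id]
      smooth := fun K i j y hi hj => u.map_val_smooth _ (smooth_val_id _ y.smooth) _ _ }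
  inv :=
    { base_eq := rfl
      app := fun hi hj => u.map hi hj.fst (𝟙 _)
      naturality := fun {i i' j j' y z} hi hi' hj hj' f => by
        change _ ≫ u.map hj.fst hj'.fst f = u.map hi hi' f ≫ _
        rw [← u.map_comp, ← u.map_comp, Category.id_comp, Category.comp_id]
      smooth := fun K i j y hi hj => u.map_val_smooth _ (smooth_val_id _ y.smooth) _ _ }
  hom_inv_id := by
    ext i j y hi hj
    rw [comp_app' _ _ hi hi.fst hj, id_app']
    change u.map hi.fst hi.fst (𝟙 _) ≫ u.map hi.fst hj.fst (𝟙 _) = u.map hi.fst hj.fst (𝟙 _)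
    rw [← u.map_comp, Category.id_comp]
  inv_hom_id := by
    ext i j y hi hj
    have hm : y ∈ (u ≫ 𝟙 G').U (i, ()) := ⟨hi, trivial⟩
    rw [comp_app' _ _ hi hm hj, id_app']
    change u.map hi hm.fst (𝟙 _) ≫ u.map hm.fst hj (𝟙 _) = u.map hi hj (𝟙 _)
    rw [← u.map_comp, Category.id_comp]

theorem whiskerR_app {u v : G ⟶ G'} (α : u ⟶ v) (w : G' ⟶ G'') {i k y}
    (hi : y ∈ (u ≫ w).U i) (hk : y ∈ (v ≫ w).U k) :
    (whiskerR α w).app hi hk = w.map hi.snd hk.snd (α.app hi.fst hk.fst) := rfl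

theorem assocIso_hom_app (u : G ⟶ G') (v : G' ⟶ G'') (w : G'' ⟶ G''') {i k y}
    (hi : y ∈ ((u ≫ v) ≫ w).U i) (hj : y ∈ (u ≫ v ≫ w).U k) :
    (assocIso u v w).hom.app hi hj = w.map hi.snd hj.snd.snd
      (v.map hi.fst.snd hj.snd.fst (u.map hi.fst.fst hj.fst (𝟙 _))) := rfl

theorem assocIso_inv_app (u : G ⟶ G') (v : G' ⟶ G'') (w : G'' ⟶ G''') {i k y}
    (hi : y ∈ (u ≫ v ≫ w).U k) (hj : y ∈ ((u ≫ v) ≫ w).U i) :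
    (assocIso u v w).inv.app hi hj = w.map hi.snd.snd hj.snd
      (v.map hi.snd.fst hj.fst.snd (u.map hi.fst hj.fst.fst (𝟙 _))) := rfl

theorem compMor_map (u : G ⟶ G') (v : G' ⟶ G'') {i j y z} (hi : y ∈ (u ≫ v).U i)
    (hj : z ∈ (u ≫ v).U j) (f : y ⟶ z) :
    (u ≫ v).map hi hj f = v.map hi.snd hj.snd (u.map hi.fst hj.fst f) := rfl

instance : Bicategory GerbeOver where
  whiskerLeft u _ _ β := whiskerL u β
  whiskerRight α w := whiskerR α w
  associator u v w := assocIso u v w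
  leftUnitor u := leftUnitIso u
  rightUnitor u := rightUnitIso u
  whiskerLeft_id {a b c} u v := by
    ext i k y hi hk
    obtain ⟨j, hj⟩ := v.cover (u.obj k.1 y hk.fst)
    rw [whiskerL_app u _ hi hk hj, id_app', id_app']
    change v.map _ _ _ ≫ v.map _ _ _ = v.map hi.snd hk.snd (u.map hi.fst hk.fst (𝟙 y))
    rw [← v.map_comp, Category.comp_id]
  whiskerLeft_comp {a b c} u v w x β γ := by
    ext i l y hi hl
    obtain ⟨j, hj⟩ := v.cover (u.obj l.1 y hl.fst)
    obtain ⟨k, hk⟩ := w.cover (u.obj l.1 y hl.fst)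
    have hm : y ∈ (u ≫ w).U (l.1, k) := ⟨hl.fst, hk⟩
    rw [comp_app' _ _ hi hm hl, whiskerL_app u _ hi hl hj, whiskerL_app u _ hi hm hj,
      whiskerL_app u _ hm hl hk, comp_app' _ _ hj hk hl.snd, map_id u, map_id w]
    simp
  id_whiskerLeft {a b} u v α := by
    ext i k y hi hk
    have h1 : y ∈ u.U i.2 := hi.snd
    have h2 : y ∈ (𝟙 a ≫ v).U ((), k.2) := ⟨trivial, hk.snd⟩
    rw [comp_app' _ _ hi h1 hk, comp_app' _ _ h1 hk.snd hk, whiskerL_app _ _ hi hk h1]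
    change u.map h1 h1 (𝟙 y) ≫ _ = u.map h1 h1 (𝟙 y) ≫ _ ≫ v.map hk.snd hk.snd (𝟙 y)
    simp
  comp_whiskerLeft {a b c d} f g h h' η := by
    ext i k y hi hk
    have e {D : GerbeOver} {p q r : D.gerbe.Y} (x : p ⟶ q) (z : q ⟶ r) :
        x ≫ z = x ≫ 𝟙 q ≫ 𝟙 q ≫ z := by simp
    obtain ⟨j, hj⟩ := h.cover ((f ≫ g).obj k.1 y hk.fst)
    have h2 : y ∈ (f ≫ g ≫ h).U (k.1.1, k.1.2, j) := ⟨hk.fst.fst, hk.fst.snd, hj⟩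
    have h3 : y ∈ (f ≫ g ≫ h').U (k.1.1, k.1.2, k.2) := ⟨hk.fst.fst, hk.fst.snd, hk.snd⟩
    have h4 : f.obj k.1.1 y hk.fst.fst ∈ (g ≫ h).U (k.1.2, j) := ⟨hk.fst.snd, hj⟩
    have h5 : f.obj k.1.1 y hk.fst.fst ∈ (g ≫ h').U (k.1.2, k.2) := ⟨hk.fst.snd, hk.snd⟩
    rw [comp_app' _ _ hi h2 hk, comp_app' _ _ h2 h3 hk, whiskerL_app _ _ hi hk hj,
      whiskerL_app f _ h2 h3 h4, whiskerL_app g η h4 h5 hj, assocIso_hom_app, assocIso_inv_app]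
    simp only [compMor_map, map_id]
    erw [Category.comp_id]
    exact e _ _
  id_whiskerRight {a b c} f g := by
    ext i k y hi hk
    rw [whiskerR_app, id_app', id_app', compMor_map]
  comp_whiskerRight {a b c} f g h η θ w := by
    ext i k y hi hk
    obtain ⟨j, hj⟩ := (g ≫ w).cover y
    rw [comp_app' _ _ hi hj hk, whiskerR_app, whiskerR_app, whiskerR_app,
      comp_app' _ _ hi.fst hj.fst hk.fst, w.map_comp]
  whiskerRight_id {a b} f g η := by
    ext i k y hi hk
    have h1 : y ∈ f.U i.1 := hi.fst
    rw [comp_app' _ _ hi h1 hk, comp_app' _ _ h1 hk.fst hk, whiskerR_app]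
    change η.app _ _ = f.map h1 h1 (𝟙 y) ≫ _ ≫ g.map hk.fst hk.fst (𝟙 y)
    simp
  whiskerRight_comp {a b c d} f f' η g h := by
    ext i k y hi hk
    have h1 : y ∈ ((f ≫ g) ≫ h).U ((i.1, i.2.1), i.2.2) := ⟨⟨hi.fst, hi.snd.fst⟩, hi.snd.snd⟩
    have h2 : y ∈ ((f' ≫ g) ≫ h).U ((k.1, k.2.1), k.2.2) := ⟨⟨hk.fst, hk.snd.fst⟩, hk.snd.snd⟩
    rw [comp_app' _ _ hi h1 hk, comp_app' _ _ h1 h2 hk, assocIso_hom_app, assocIso_inv_app,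
      whiskerR_app, whiskerR_app, whiskerR_app, compMor_map]
    simp only [map_id]
    erw [Category.id_comp, map_id, Category.comp_id]
  whisker_assoc {a b c d} f g g' η h := by
    ext i k y hi hk
    obtain ⟨j, hj⟩ := g.cover (f.obj k.1.1 y hk.fst.fst)
    obtain ⟨l, hl⟩ := h.cover (g.obj _ _ hj)
    have h1 : y ∈ (f ≫ g ≫ h).U (k.1.1, j, l) := ⟨hk.fst.fst, hj, hl⟩
    have h2 : y ∈ (f ≫ g' ≫ h).U (k.1.1, k.1.2, k.2) := ⟨hk.fst.fst, hk.fst.snd, hk.snd⟩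
    have h3 : f.obj k.1.1 y hk.fst.fst ∈ (g ≫ h).U (j, l) := ⟨hj, hl⟩
    rw [comp_app' _ _ hi h1 hk, comp_app' _ _ h1 h2 hk, assocIso_hom_app, assocIso_inv_app,
      whiskerR_app, whiskerL_app _ _ hi.fst hk.fst hj, whiskerL_app _ _ h1 h2 h3, whiskerR_app,
      compMor_map]
    simp only [map_id]
    erw [Category.id_comp, Category.comp_id]
    exact h.map_comp _ _ _ _ _
  whisker_exchange {a b c} f g h i η θ := by
    ext p r y hp hr
    obtain ⟨j, hj⟩ := f.cover y
    obtain ⟨k, hk⟩ := i.cover (f.obj j y hj)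
    obtain ⟨l, hl⟩ := h.cover (g.obj _ _ hr.fst)
    obtain ⟨m, hm⟩ := h.cover (f.obj _ _ hj)
    have h1 : y ∈ (f ≫ i).U (j, k) := ⟨hj, hk⟩
    have h2 : y ∈ (g ≫ h).U (r.1, l) := ⟨hr.fst, hl⟩
    rw [comp_app' _ _ hp h1 hr, comp_app' _ _ hp h2 hr, whiskerL_app _ _ hp h1 hm, whiskerR_app,
      whiskerR_app, whiskerL_app _ _ h2 hr hl]
    simp only [map_id, Category.id_comp]
    rw [Category.assoc, θ.naturality hm hl hk hr.snd, ← Category.assoc, ← h.map_comp,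
      η.map_id_app]
  pentagon {a b c d e} f g h i := by
    ext p r y hp hr
    have e1 {D : GerbeOver} {p q : D.gerbe.Y} (x : p ⟶ q) :
        x ≫ 𝟙 q ≫ 𝟙 q ≫ 𝟙 q = x ≫ 𝟙 q := by simp
    have h1 : y ∈ (f ≫ ((g ≫ h) ≫ i)).U (r.1, (r.2.1, r.2.2.1), r.2.2.2) :=
      ⟨hr.fst, ⟨hr.snd.fst, hr.snd.snd.fst⟩, hr.snd.snd.snd⟩
    have h2 : y ∈ ((f ≫ (g ≫ h)) ≫ i).U ((r.1, (r.2.1, r.2.2.1)), r.2.2.2) :=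
      ⟨⟨hr.fst, ⟨hr.snd.fst, hr.snd.snd.fst⟩⟩, hr.snd.snd.snd⟩
    have h3 : y ∈ ((f ≫ g) ≫ (h ≫ i)).U ((r.1, r.2.1), (r.2.2.1, r.2.2.2)) :=
      ⟨⟨hr.fst, hr.snd.fst⟩, hr.snd.snd.fst, hr.snd.snd.snd⟩
    rw [comp_app' _ _ hp h2 hr, comp_app' _ _ h2 h1 hr, comp_app' _ _ hp h3 hr,
      whiskerR_app, whiskerL_app _ _ h1 hr h1.snd, assocIso_hom_app, assocIso_hom_app,
      assocIso_hom_app, assocIso_hom_app, assocIso_hom_app]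
    simp only [map_id, compMor_map]
    erw [map_id, map_id, map_id]
    exact e1 _
  triangle {a b c} f g := by
    ext p r y hp hr
    have h1 : y ∈ (f ≫ 𝟙 b ≫ g).U (r.1, (), r.2) := ⟨hr.fst, trivial, hr.snd⟩
    rw [comp_app' _ _ hp h1 hr, whiskerL_app _ _ h1 hr h1.snd, assocIso_hom_app, whiskerR_app]
    change g.map _ _ _ ≫ g.map _ _ _ ≫ g.map hr.snd hr.snd (𝟙 _) = _
    simp only [map_id, Category.comp_id]
    rfl

end GerbeMor
end TDual

namespace TDual

section SubBicategory

/-- Data for a locally full sub-bicategory of `B` with objects indexed by `C`. -/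
structure SubData (B : Type u) [Bicategory.{w, v} B] (C : Type u₁) where
  obj : C → B
  mor : ∀ a b : C, (obj a ⟶ obj b) → Prop
  id_mem : ∀ a, mor a a (𝟙 (obj a))
  comp_mem : ∀ a b c f g, mor a b f → mor b c g → mor a c (f ≫ g)

variable {B : Type u} [Bicategory.{w, v} B] {C : Type u₁}

/-- The objects of the sub-bicategory. -/
structure SubData.Obj (S : SubData B C) : Type u₁ where
  val : C

/-- The 1-morphisms of the sub-bicategory. -/
structure SubData.Hom (S : SubData B C) (a b : S.Obj) : Type v where
  hom : S.obj a.val ⟶ S.obj b.val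
  mem : S.mor a.val b.val hom

variable (S : SubData B C)

instance SubData.categoryStruct : CategoryStruct S.Obj where
  Hom a b := S.Hom a b
  id a := ⟨𝟙 (S.obj a.val), S.id_mem a.val⟩
  comp f g := ⟨f.hom ≫ g.hom, S.comp_mem _ _ _ _ _ f.mem g.mem⟩

/-- The 2-morphisms of the sub-bicategory are all 2-morphisms of `B`. -/
@[ext] structure SubData.Hom₂ {S : SubData B C} {a b : S.Obj} (f g : a ⟶ b) : Type w where
  hom : f.hom ⟶ g.hom

instance SubData.homCategory (a b : S.Obj) : Category (a ⟶ b) where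
  Hom f g := SubData.Hom₂ f g
  id f := ⟨𝟙 f.hom⟩
  comp α β := ⟨α.hom ≫ β.hom⟩

variable {S} in
@[ext] theorem SubData.hom₂_ext {a b : S.Obj} {f g : a ⟶ b} {α β : f ⟶ g}
    (h : α.hom = β.hom) : α = β := SubData.Hom₂.ext h

variable {S} in
/-- Constructor for 2-isomorphisms. -/
def SubData.isoMk {a b : S.Obj} {f g : a ⟶ b} (e : f.hom ≅ g.hom) : f ≅ g where
  hom := ⟨e.hom⟩
  inv := ⟨e.inv⟩
  hom_inv_id := SubData.hom₂_ext e.hom_inv_id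
  inv_hom_id := SubData.hom₂_ext e.inv_hom_id

instance SubData.bicategory : Bicategory S.Obj where
  homCategory := SubData.homCategory S
  whiskerLeft f _ _ α := SubData.Hom₂.mk (f.hom ◁ α.hom)
  whiskerRight α h := SubData.Hom₂.mk (α.hom ▷ h.hom)
  associator f g h := isoMk (α_ f.hom g.hom h.hom)
  leftUnitor f := isoMk (λ_ f.hom)
  rightUnitor f := isoMk (ρ_ f.hom)
  whiskerLeft_id _ _ := hom₂_ext (whiskerLeft_id _ _)
  whiskerLeft_comp _ _ _ _ _ _ := hom₂_ext (whiskerLeft_comp _ _ _)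
  id_whiskerLeft _ := hom₂_ext (id_whiskerLeft _)
  comp_whiskerLeft _ _ _ _ _ := hom₂_ext (comp_whiskerLeft _ _ _)
  id_whiskerRight _ _ := hom₂_ext (id_whiskerRight _ _)
  comp_whiskerRight _ _ _ := hom₂_ext (comp_whiskerRight _ _ _)
  whiskerRight_id _ := hom₂_ext (whiskerRight_id _)
  whiskerRight_comp _ _ _ := hom₂_ext (whiskerRight_comp _ _ _)
  whisker_assoc _ _ _ _ _ := hom₂_ext (whisker_assoc _ _ _)
  whisker_exchange _ _ := hom₂_ext (whisker_exchange _ _)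
  pentagon _ _ _ _ := hom₂_ext (pentagon _ _ _ _)
  triangle _ _ := hom₂_ext (triangle _ _)

/-- The inclusion of a sub-bicategory, as a (strict) pseudofunctor. -/
def SubData.incl : S.Obj ⥤ᵖ B where
  obj a := S.obj a.val
  map f := SubData.Hom.hom f
  map₂ α := SubData.Hom₂.hom α
  map₂_id _ := rfl
  map₂_comp _ _ := rfl
  mapId a := Iso.refl _
  mapComp f g := Iso.refl _
  map₂_whisker_left f g h α := by
    refine Eq.trans ?_ (Category.id_comp _).symm
    exact (Category.comp_id _).symm
  map₂_whisker_right {a b c f g} α h := by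
    refine Eq.trans ?_ (Category.id_comp _).symm
    exact (Category.comp_id _).symm
  map₂_associator {a b c d} f g h := by
    change (α_ (SubData.Hom.hom f) (SubData.Hom.hom g) (SubData.Hom.hom h)).hom =
      𝟙 _ ≫ 𝟙 _ ▷ _ ≫ (α_ (SubData.Hom.hom f) (SubData.Hom.hom g) (SubData.Hom.hom h)).hom ≫
      _ ◁ 𝟙 _ ≫ 𝟙 _
    rw [id_whiskerRight, whiskerLeft_id, Category.id_comp, Category.id_comp, Category.comp_id,
      Category.comp_id]
  map₂_left_unitor f := by
    change (λ_ (SubData.Hom.hom f)).hom = 𝟙 _ ≫ 𝟙 _ ▷ _ ≫ (λ_ (SubData.Hom.hom f)).hom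
    rw [id_whiskerRight, Category.id_comp, Category.id_comp]
  map₂_right_unitor f := by
    change (ρ_ (SubData.Hom.hom f)).hom = 𝟙 _ ≫ _ ◁ 𝟙 _ ≫ (ρ_ (SubData.Hom.hom f)).hom
    rw [whiskerLeft_id, Category.id_comp, Category.id_comp]

end SubBicategory

/-! ### Bicategories over the category of manifolds -/

/-- A bicategory over the category of smooth manifolds (a strict projection to `Mfd`, where `Mfd`
has only identity 2-morphisms). A presheaf of bicategories on manifolds is encoded by its
Grothendieck construction: the objects over `X` and the morphisms over `f : X ⟶ Y` are the
sections over `X` and the morphisms from a section over `X` to the pullback along `f` of a section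
over `Y`. -/
class OverMfd (B : Type u) [Bicategory.{w, v} B] where
  pobj : B → Mfd
  pmap : ∀ {a b : B}, (a ⟶ b) → (pobj a ⟶ pobj b)
  pmap_id : ∀ a : B, pmap (𝟙 a) = 𝟙 (pobj a)
  pmap_comp : ∀ {a b c : B} (f : a ⟶ b) (g : b ⟶ c), pmap (f ≫ g) = pmap f ≫ pmap g
  pmap_eq : ∀ {a b : B} {f g : a ⟶ b}, (f ⟶ g) → pmap f = pmap g

open OverMfd

section Over

variable {A : Type u₁} [Bicategory.{w₁, v₁} A] [OverMfd A]
variable {B : Type u₂} [Bicategory.{w₂, v₂} B] [OverMfd B]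
variable {Z : Type u₃} [Bicategory.{w₃, v₃} Z] [OverMfd Z]

variable (A B) in
/-- A pseudofunctor over the category of manifolds. -/
structure OverFunctor where
  functor : A ⥤ᵖ B
  obj_eq : ∀ a, pobj (functor.obj a) = pobj a
  map_eq : ∀ {a b : A} (f : a ⟶ b),
    pmap (functor.map f) = eqToHom (obj_eq a) ≫ pmap f ≫ eqToHom (obj_eq b).symm

namespace OverFunctor

variable (A) in
/-- The identity. -/
def id : OverFunctor A A where
  functor := Pseudofunctor.id A
  obj_eq _ := rfl
  map_eq f := by
    exact ((Category.id_comp _).trans (Category.comp_id _)).symm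

/-- Composition. -/
def comp (F : OverFunctor A B) (G : OverFunctor B Z) : OverFunctor A Z where
  functor := F.functor.comp G.functor
  obj_eq a := (G.obj_eq _).trans (F.obj_eq a)
  map_eq f := by
    refine (G.map_eq (F.functor.map f)).trans ?_
    rw [F.map_eq]
    simp only [Category.assoc, eqToHom_trans, eqToHom_trans_assoc]
    rfl

end OverFunctor

open scoped Pseudofunctor.StrongTrans

variable (A Z) in
/-- Strong transformations between pseudofunctors over the category of manifolds are required to
have vertical components. -/
def homOverData : SubData (A ⥤ᵖ Z) (OverFunctor A Z) where
  obj F := F.functor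
  mor F G σ := ∀ a, pmap (Pseudofunctor.StrongTrans.app σ a) =
    eqToHom ((F.obj_eq a).trans (G.obj_eq a).symm)
  id_mem F a := pmap_id _
  comp_mem F G H σ τ hσ hτ a := by
    refine (pmap_comp _ _).trans ?_
    exact (congrArg₂ CategoryStruct.comp (hσ a) (hτ a)).trans (eqToHom_trans _ _)

variable (A Z) in
/-- The bicategory of pseudofunctors `A → Z` over the category of manifolds, strong transformations
with vertical components, and modifications. -/
abbrev HomOver := (homOverData A Z).Obj

/-- A pseudofunctor over the category of manifolds, as an object of `HomOver`. -/
abbrev OverFunctor.toObj (F : OverFunctor A Z) : HomOver A Z := ⟨F⟩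

/-- Precomposition of a strong transformation with a pseudofunctor. -/
def precompTrans (k : A ⥤ᵖ B) {F G : B ⥤ᵖ Z} (σ : F ⟶ G) : k.comp F ⟶ k.comp G where
  app a := Pseudofunctor.StrongTrans.app σ (k.obj a)
  naturality f := Pseudofunctor.StrongTrans.naturality σ (k.map f)
  naturality_naturality η := σ.naturality_naturality (k.map₂ η)
  naturality_id a := by
    have h := σ.naturality_naturality (k.mapId a).hom
    have h2 := σ.naturality_id (k.obj a)
    change (σ.naturality (k.map (𝟙 a))).hom ≫ σ.app (k.obj a) ◁ (G.map₂ (k.mapId a).hom ≫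
      (G.mapId (k.obj a)).hom) = (F.map₂ (k.mapId a).hom ≫ (F.mapId (k.obj a)).hom) ▷
      σ.app (k.obj a) ≫ (λ_ (σ.app (k.obj a))).hom ≫ (ρ_ (σ.app (k.obj a))).inv
    rw [whiskerLeft_comp, ← Category.assoc, ← h, Category.assoc, h2, comp_whiskerRight,
      Category.assoc]
  naturality_comp {a b c} f g := by
    have h := σ.naturality_naturality (k.mapComp f g).hom
    have h2 := σ.naturality_comp (k.map f) (k.map g)
    change (σ.naturality (k.map (f ≫ g))).hom ≫ σ.app (k.obj a) ◁ (G.map₂ (k.mapComp f g).hom ≫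
      (G.mapComp (k.map f) (k.map g)).hom) = (F.map₂ (k.mapComp f g).hom ≫
      (F.mapComp (k.map f) (k.map g)).hom) ▷ σ.app (k.obj c) ≫ _
    rw [whiskerLeft_comp, ← Category.assoc, ← h, Category.assoc, h2, comp_whiskerRight]
    exact (Category.assoc _ _ _).symm

/-- Precomposition with `k`, as a pseudofunctor on the hom-categories. -/
def precomp (k : OverFunctor A B) (F G : HomOver B Z) :
    (F ⟶ G) ⥤ ((k.comp F.val).toObj ⟶ (k.comp G.val).toObj) where
  obj σ := SubData.Hom.mk (precompTrans k.functor (SubData.Hom.hom σ)) fun a =>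
    (SubData.Hom.mem σ) (k.functor.obj a)
  map m := SubData.Hom₂.mk ⟨⟨fun a => (SubData.Hom₂.hom m).as.app (k.functor.obj a),
    fun f => (SubData.Hom₂.hom m).as.naturality (k.functor.map f)⟩⟩
  map_id _ := rfl
  map_comp _ _ := rfl

/-- Precomposition with `k` induces an equivalence of bicategories
`HomOver B Z ≃ HomOver A Z`, i.e., it is essentially surjective and locally an equivalence
of categories. -/
def IsOrthogonal (k : OverFunctor A B) (Z : Type u₃) [Bicategory.{w₃, v₃} Z] [OverMfd Z] : Prop :=
  (∀ F : OverFunctor A Z, ∃ G : OverFunctor B Z, Nonempty ((k.comp G).toObj ≌ F.toObj)) ∧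
  ∀ F G : HomOver B Z, (precomp k F G).IsEquivalence

/-- `A` and `B` are equivalent over the category of manifolds via `F`. -/
def OverFunctor.IsEquiv (F : OverFunctor A B) : Prop :=
  ∃ G : OverFunctor B A, Nonempty ((F.comp G).toObj ≌ (OverFunctor.id A).toObj) ∧
    Nonempty ((G.comp F).toObj ≌ (OverFunctor.id B).toObj)

end Over

section Stack

/-- A category with a functor to manifolds, as a locally discrete bicategory over manifolds. -/
abbrev overOfFunctor {C : Type u} [Category.{v} C] (P : C ⥤ Mfd) :
    OverMfd (LocallyDiscrete C) where
  pobj a := P.obj a.as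
  pmap f := P.map f.as
  pmap_id a := P.map_id a.as
  pmap_comp f g := P.map_comp f.as g.as
  pmap_eq η := congrArg (fun f => P.map f.as) (LocallyDiscrete.eq_of_hom η)

/-- The representable presheaf of a manifold `X`. -/
instance (X : Mfd) : OverMfd (LocallyDiscrete (Over X)) := overOfFunctor (Over.forget X)

/-- A sieve, as a subpresheaf of a representable presheaf. -/
instance {X : Mfd} (R : Sieve X) : OverMfd (LocallyDiscrete R.arrows.category) :=
  overOfFunctor R.arrows.diagram

/-- The inclusion of a sieve on `X` into the presheaf represented by `X`. -/
def sieveIncl {X : Mfd} (R : Sieve X) :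
    OverFunctor (LocallyDiscrete R.arrows.category) (LocallyDiscrete (Over X)) where
  functor := (ObjectProperty.ι _).toPseudofunctor
  obj_eq _ := rfl
  map_eq _ := ((Category.id_comp _).trans (Category.comp_id _)).symm

/-- A sieve is covering if it contains the inclusions of an open cover. -/
def IsCovering {X : Mfd} (R : Sieve X) : Prop :=
  ∀ x : X, ∃ U : TopologicalSpace.Opens X, x ∈ U ∧ R (X.restrictIncl U)

/-- A 2-stack (of bigroupoids) on the category of smooth manifolds: a 2-fibration in bigroupoids
which satisfies descent along open covers, i.e., for which restriction from `X` (i.e., from the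
presheaf represented by `X`) to a covering sieve `R` of `X` is an equivalence of bicategories. -/
structure Is2Stack (Z : Type u) [Bicategory.{w, v} Z] [OverMfd Z] : Prop where
  isIso : ∀ {a b : Z} {f g : a ⟶ b} (α : f ⟶ g), IsIso α
  lift : ∀ {X : Mfd} (b : Z) (f : X ⟶ pobj b),
    ∃ (a : Z) (h : pobj a = X) (u : a ⟶ b), pmap u = eqToHom h ≫ f
  factor : ∀ {a b c : Z} (u : a ⟶ b) (v : c ⟶ b) (h : pobj c ⟶ pobj a), h ≫ pmap u = pmap v →
    ∃ w : c ⟶ a, pmap w = h ∧ Nonempty (w ≫ u ≅ v)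
  factor₂ : ∀ {a b c : Z} (u : a ⟶ b) (w w' : c ⟶ a), pmap w = pmap w' →
    Function.Bijective fun α : w ⟶ w' => α ▷ u
  descent : ∀ {X : Mfd} (R : Sieve X), IsCovering R → IsOrthogonal (sieveIncl R) Z

/-- `η : A → S` is a 2-stackification: `S` is a 2-stack, and restriction along `η` is an
equivalence from the bicategory of morphisms `S → Z` to the bicategory of morphisms `A → Z`, for
every 2-stack `Z`. -/
structure IsTwoStackification {A : Type u₁} [Bicategory.{w₁, v₁} A] [OverMfd A]
    {S : Type u₂} [Bicategory.{w₂, v₂} S] [OverMfd S] (η : OverFunctor A S) : Prop where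
  is2Stack : Is2Stack S
  isOrthogonal : ∀ (Z : Type 1) [Bicategory.{0, 1} Z] [OverMfd Z], Is2Stack Z → IsOrthogonal η Z

end Stack
end TDual

namespace TDual
open Mfd (Smooth U1 T)
open BundleGerbe

section TrivialGerbe

/-- The trivial bundle gerbe. -/
def trivialGerbe (M : Mfd) : BundleGerbe M where
  Y := M
  proj := 𝟙 M
  proj_submersion := Mfd.isSurjSubmersion_id M
  P := M.prod U1
  src := ⟨fun p => p.1, Mfd.smooth_fst⟩
  tgt := ⟨fun p => p.1, Mfd.smooth_fst⟩
  proj_src _ := rfl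
  smul c p := (p.1, c * p.2)
  smul_smooth := (Mfd.smooth_fst.comp Mfd.smooth_snd).prodMk
    (Smooth.mul_U1 Mfd.smooth_fst (Mfd.smooth_snd.comp Mfd.smooth_snd))
  one_smul p := Prod.ext rfl (one_mul _)
  mul_smul c d p := Prod.ext rfl (mul_assoc _ _ _)
  src_smul _ _ := rfl
  tgt_smul _ _ := rfl
  simply_transitive p q h _ := ⟨q.2 * p.2⁻¹, Prod.ext h (inv_mul_cancel_right _ _), fun c hc => by
    have : c * p.2 = q.2 := congrArg Prod.snd hc
    exact eq_mul_inv_of_mul_eq this⟩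
  local_sections K y z h k₀ := ⟨⊤, trivial,
    ⟨fun k => (y k.1, 1), ((y.smooth.comp (K.restrictIncl ⊤).smooth)).prodMk
      (Mfd.smooth_const _)⟩, fun k => ⟨rfl, h k.1⟩⟩
  mul p q _ := (p.1, p.2 * q.2)
  mul_smooth K p q _ := (Mfd.smooth_fst.comp p.smooth).prodMk
    (Smooth.mul_U1 (Mfd.smooth_snd.comp p.smooth) (Mfd.smooth_snd.comp q.smooth))
  src_mul _ _ _ := rfl
  tgt_mul _ _ h := h
  mul_assoc _ _ _ _ _ _ _ := Prod.ext rfl (mul_assoc _ _ _)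
  smul_mul _ _ _ _ _ := Prod.ext rfl (mul_assoc _ _ _)
  mul_smul_right _ _ _ _ _ := Prod.ext rfl (mul_left_comm _ _ _)
  one := ⟨fun y => (y, 1), Mfd.smooth_id.prodMk (Mfd.smooth_const _)⟩
  src_one _ := rfl
  tgt_one _ := rfl
  one_mul _ _ := Prod.ext rfl (one_mul _)
  mul_one _ _ := Prod.ext rfl (mul_one _)

/-- A manifold with the trivial bundle gerbe. -/
abbrev triv (M : Mfd) : GerbeOver := ⟨M, trivialGerbe M⟩

variable {M N K : Mfd}

/-- The `U(1)`-component of a morphism in the groupoid of the trivial bundle gerbe. -/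
def comp₂ {y z : (trivialGerbe M).Y} (f : y ⟶ z) : U1 := (val f).2

/-- The morphism of the groupoid of the trivial bundle gerbe given by an element of `U(1)`. -/
def homOf {y z : (trivialGerbe M).Y} (h : y = z) (c : U1) : y ⟶ z := ⟨(y, c), rfl, h⟩

theorem triv_ext {y z : (trivialGerbe M).Y} {f g : y ⟶ z} (h : comp₂ f = comp₂ g) : f = g :=
  Subtype.ext (Prod.ext (f.2.1.trans g.2.1.symm) h)

theorem comp₂_comp {x y z : (trivialGerbe M).Y} (f : x ⟶ y) (g : y ⟶ z) :
    comp₂ (f ≫ g) = comp₂ f * comp₂ g := rfl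

theorem comp₂_id (y : (trivialGerbe M).Y) : comp₂ (𝟙 y) = 1 := rfl

theorem comp₂_homOf {y z : (trivialGerbe M).Y} (h : y = z) (c : U1) : comp₂ (homOf h c) = c := rfl

/-- The 1-morphism `id : I → f^* I = I` along a smooth map `f`. -/
def trivMor (f : M ⟶ N) : triv M ⟶ triv N where
  base := f
  ι := Unit
  U _ := Set.univ
  isOpen _ := isOpen_univ
  cover _ := ⟨(), trivial⟩
  obj _ y _ := f y
  proj_obj _ _ _ := rfl
  obj_smooth _ _ y _ := f.smooth.comp y.smooth
  map _ _ p := ⟨(f (val p).1, (val p).2), congrArg f p.2.1, congrArg f p.2.2⟩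
  map_comp _ _ _ _ _ := rfl
  map_act _ _ _ _ := rfl
  map_smooth _ _ _ p _ _ := (f.smooth.comp (Mfd.smooth_fst.comp p.smooth)).prodMk
    (Mfd.smooth_snd.comp p.smooth)

/-- A 1-morphism between trivial bundle gerbes which preserves the `U(1)`-components. -/
def IsStrict (u : triv M ⟶ triv N) : Prop :=
  ∀ (i j : u.ι) (y z : (trivialGerbe M).Y) (hi : y ∈ u.U i) (hj : z ∈ u.U j) (p : y ⟶ z),
    comp₂ (M := N) (u.map hi hj p) = comp₂ p

theorem isStrict_trivMor (f : M ⟶ N) : IsStrict (trivMor f) := fun _ _ _ _ _ _ _ => rfl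

theorem isStrict_id (M : Mfd) : IsStrict (𝟙 (triv M)) := fun _ _ _ _ _ _ _ => rfl

theorem IsStrict.comp {u : triv M ⟶ triv N} {v : triv N ⟶ triv K} (hu : IsStrict u)
    (hv : IsStrict v) : IsStrict (u ≫ v) := fun i j _ _ hi hj p =>
  (hv i.2 j.2 _ _ hi.snd hj.snd _).trans (hu i.1 j.1 _ _ hi.fst hj.fst p)

theorem obj_eq (u : triv M ⟶ triv N) {i : u.ι} {y : M} (hi : y ∈ u.U i) :
    u.obj i y hi = u.base y := u.proj_obj i y hi

/-- The 2-morphism between strict 1-morphisms given by a smooth `U(1)`-valued function. -/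
def mkHom₂ {u v : triv M ⟶ triv N} (hu : IsStrict u) (hv : IsStrict v) (hb : u.base = v.base)
    (c : M → U1) (hc : Smooth c) : u ⟶ v where
  base_eq := hb
  app {i j y} hi hj := homOf (M := N) ((obj_eq u hi).trans ((congrArg (fun f : M ⟶ N => f y) hb).trans
    (obj_eq v hj).symm)) (c y)
  naturality {i i' j j' y z} hi hi' hj hj' p := by
    obtain rfl : y = z := p.2.1.symm.trans p.2.2
    refine triv_ext ?_
    refine (congrArg (c y * ·) (hv j j' y y hj hj' p)).trans ?_
    refine (mul_comm _ _).trans ?_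
    exact (congrArg (· * c y) (hu i i' y y hi hi' p)).symm
  smooth K i j y hi hj := (u.obj_smooth K i y hi).prodMk (hc.comp y.smooth)

/-- The `U(1)`-valued function corresponding to a 2-morphism between strict 1-morphisms. -/
def phase {u v : triv M ⟶ triv N} (α : u ⟶ v) (y : M) : U1 :=
  comp₂ (M := N) (α.app (u.cover y).choose_spec (v.cover y).choose_spec)

theorem phase_eq {u v : triv M ⟶ triv N} (hu : IsStrict u) (hv : IsStrict v) (α : u ⟶ v)
    {i j} {y : M} (hi : y ∈ u.U i) (hj : y ∈ v.U j) :
    phase α y = comp₂ (M := N) (α.app hi hj) := by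
  let y' : (trivialGerbe M).Y := y
  have h := congrArg (comp₂ (M := N)) (α.naturality hi (u.cover y).choose_spec hj
    (v.cover y).choose_spec (𝟙 y'))
  have h1 := hv _ _ _ _ hj (v.cover y).choose_spec (𝟙 y')
  have h2 := hu _ _ _ _ hi (u.cover y).choose_spec (𝟙 y')
  rw [comp₂_comp, comp₂_comp, h1, h2] at h
  exact (_root_.one_mul _).symm.trans (h.symm.trans (_root_.mul_one _))

theorem phase_ext {u v : triv M ⟶ triv N} (hu : IsStrict u) (hv : IsStrict v) {α β : u ⟶ v}
    (h : ∀ y, phase α y = phase β y) : α = β := by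
  ext i j y hi hj
  refine triv_ext ?_
  exact (phase_eq hu hv α hi hj).symm.trans ((h y).trans (phase_eq hu hv β hi hj))

theorem phase_mkHom₂ {u v : triv M ⟶ triv N} (hu : IsStrict u) (hv : IsStrict v)
    (hb : u.base = v.base) (c : M → U1) (hc : Smooth c) (y : M) :
    phase (mkHom₂ hu hv hb c hc) y = c y := rfl

theorem phase_id (u : triv M ⟶ triv N) (hu : IsStrict u) (y : M) : phase (𝟙 u) y = 1 :=
  hu _ _ _ _ _ _ _

theorem phase_comp {u v w : triv M ⟶ triv N} (hu : IsStrict u) (hv : IsStrict v) (hw : IsStrict w)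
    (α : u ⟶ v) (β : v ⟶ w) (y : M) : phase (α ≫ β) y = phase α y * phase β y := by
  obtain ⟨i, hi⟩ := u.cover y
  obtain ⟨j, hj⟩ := v.cover y
  obtain ⟨k, hk⟩ := w.cover y
  rw [phase_eq hu hw _ hi hk, phase_eq hu hv _ hi hj, phase_eq hv hw _ hj hk,
    GerbeMor.comp_app' α β hi hj hk, comp₂_comp]

theorem phase_whiskerLeft (u : triv M ⟶ triv N) {v w : triv N ⟶ triv K} (hu : IsStrict u)
    (hv : IsStrict v) (hw : IsStrict w) (β : v ⟶ w) (y : M) :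
    phase (u ◁ β) y = phase β (u.base y) := by
  obtain ⟨i, hi⟩ := (u ≫ v).cover y
  obtain ⟨k, hk⟩ := (u ≫ w).cover y
  obtain ⟨j, hj⟩ := v.cover (u.obj k.1 y hk.fst)
  rw [phase_eq (hu.comp hv) (hu.comp hw) _ hi hk]
  refine (congrArg (comp₂ (M := K)) (GerbeMor.whiskerL_app u β hi hk hj)).trans ?_
  rw [comp₂_comp, ← obj_eq u hk.fst, phase_eq hv hw β hj hk.snd]
  have h1 := hv _ _ _ _ hi.snd hj (u.map hi.fst hk.fst (𝟙 _))
  have h2 := hu _ _ _ _ hi.fst hk.fst (𝟙 _)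
  refine (congrArg (· * _) (h1.trans h2)).trans (_root_.one_mul _)

theorem phase_whiskerRight {u v : triv M ⟶ triv N} (w : triv N ⟶ triv K) (hu : IsStrict u)
    (hv : IsStrict v) (hw : IsStrict w) (α : u ⟶ v) (y : M) :
    phase (α ▷ w) y = phase α y := by
  obtain ⟨i, hi⟩ := (u ≫ w).cover y
  obtain ⟨k, hk⟩ := (v ≫ w).cover y
  rw [phase_eq (hu.comp hw) (hv.comp hw) _ hi hk, phase_eq hu hv _ hi.fst hk.fst]
  exact hw _ _ _ _ hi.snd hk.snd _

theorem phase_associator_hom {L : Mfd} (u : triv M ⟶ triv N) (v : triv N ⟶ triv K)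
    (w : triv K ⟶ triv L) (hu : IsStrict u) (hv : IsStrict v) (hw : IsStrict w) (y : M) :
    phase (α_ u v w).hom y = 1 :=
  (hw _ _ _ _ _ _ _).trans ((hv _ _ _ _ _ _ _).trans (hu _ _ _ _ _ _ _))

theorem phase_leftUnitor_hom (u : triv M ⟶ triv N) (hu : IsStrict u) (y : M) :
    phase (λ_ u).hom y = 1 := hu _ _ _ _ _ _ _

theorem phase_rightUnitor_hom (u : triv M ⟶ triv N) (hu : IsStrict u) (y : M) :
    phase (ρ_ u).hom y = 1 := hu _ _ _ _ _ _ _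

/-- The canonical 2-isomorphism between strict 1-morphisms along the same map. -/
def canIso {u v : triv M ⟶ triv N} (hu : IsStrict u) (hv : IsStrict v) (hb : u.base = v.base) :
    u ≅ v where
  hom := mkHom₂ hu hv hb (fun _ => 1) (Mfd.smooth_const _)
  inv := mkHom₂ hv hu hb.symm (fun _ => 1) (Mfd.smooth_const _)
  hom_inv_id := phase_ext hu hu fun y => by
    rw [phase_comp hu hv hu, phase_id u hu, phase_mkHom₂, phase_mkHom₂, _root_.one_mul]
  inv_hom_id := phase_ext hv hv fun y => by
    rw [phase_comp hv hu hv, phase_id v hv, phase_mkHom₂, phase_mkHom₂, _root_.one_mul]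

theorem phase_canIso_hom {u v : triv M ⟶ triv N} (hu : IsStrict u) (hv : IsStrict v)
    (hb : u.base = v.base) (y : M) : phase (canIso hu hv hb).hom y = 1 := rfl

theorem phase_canIso_inv {u v : triv M ⟶ triv N} (hu : IsStrict u) (hv : IsStrict v)
    (hb : u.base = v.base) (y : M) : phase (canIso hu hv hb).inv y = 1 := rfl

end TrivialGerbe

section TBackground

/-- A principal `T^n`-bundle over `X`. -/
structure TorusBundle (n : ℕ) (X : Mfd) : Type 1 where
  total : Mfd
  proj : total ⟶ X
  proj_submersion : Mfd.IsSurjSubmersion proj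
  act : T n → total → total
  act_smooth : Smooth (M := (T n).prod total) fun x => act x.1 x.2
  one_act : ∀ e, act 1 e = e
  mul_act : ∀ s t e, act (s * t) e = act s (act t e)
  proj_act : ∀ t e, proj (act t e) = proj e
  simply_transitive : ∀ e e', proj e = proj e' → ∃! t, act t e = e'

/-- The trivial principal `T^n`-bundle `X × T^n → X`. -/
def trivialBundle (n : ℕ) (X : Mfd) : TorusBundle n X where
  total := X.prod (T n)
  proj := ⟨fun p => p.1, Mfd.smooth_fst⟩
  proj_submersion := Mfd.isSurjSubmersion_fst X (T n) 1
  act t e := (e.1, t * e.2)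
  act_smooth := (Mfd.smooth_fst.comp Mfd.smooth_snd).prodMk
    (Smooth.mul_T Mfd.smooth_fst (Mfd.smooth_snd.comp Mfd.smooth_snd))
  one_act e := Prod.ext rfl (one_mul _)
  mul_act s t e := Prod.ext rfl (mul_assoc _ _ _)
  proj_act _ _ := rfl
  simply_transitive p q h := ⟨q.2 * p.2⁻¹, Prod.ext h (inv_mul_cancel_right _ _), fun c hc => by
    have : c * p.2 = q.2 := congrArg Prod.snd hc
    exact eq_mul_inv_of_mul_eq this⟩

/-- A topological T-background over `base`: a principal torus bundle, and a `U(1)`-bundle gerbe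
over its total space. -/
structure TBackground (n : ℕ) : Type 1 where
  base : Mfd
  bundle : TorusBundle n base
  gerbe : BundleGerbe bundle.total

/-- A T-background, regarded as a manifold with a bundle gerbe. -/
abbrev TBackground.toGerbeOver {n : ℕ} (B : TBackground n) : GerbeOver := ⟨B.bundle.total, B.gerbe⟩

/-- T-backgrounds, as a sub-bicategory of the bicategory of manifolds with bundle gerbes: a
1-morphism covering `φ : X ⟶ X'` is a smooth `T^n`-equivariant map `f : E → E'` covering `φ`
together with a bundle gerbe 1-morphism `G → f^* G'`; 2-morphisms are bundle gerbe 2-morphisms. -/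
def tbaData (n : ℕ) : SubData GerbeOver (TBackground n) where
  obj B := B.toGerbeOver
  mor B B' u := (∀ t e, u.base (B.bundle.act t e) = B'.bundle.act t (u.base e)) ∧
    ∃ φ : B.base ⟶ B'.base, ∀ e, B'.bundle.proj (u.base e) = φ (B.bundle.proj e)
  id_mem B := ⟨fun _ _ => rfl, 𝟙 _, fun _ => rfl⟩
  comp_mem B B' B'' u v hu hv := by
    obtain ⟨h1, φ, h2⟩ := hu
    obtain ⟨h3, ψ, h4⟩ := hv
    refine ⟨fun t e => ?_, φ ≫ ψ, fun e => ?_⟩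
    · exact (congrArg v.base (h1 t e)).trans (h3 t _)
    · exact (h4 _).trans (congrArg ψ (h2 e))

/-- The presheaf of bicategories of T-backgrounds. -/
abbrev TBA (n : ℕ) := (tbaData n).Obj

theorem tba_cover_unique {n : ℕ} {B B' : TBackground n} {φ ψ : B.base ⟶ B'.base}
    {f : B.bundle.total ⟶ B'.bundle.total}
    (h : ∀ e, B'.bundle.proj (f e) = φ (B.bundle.proj e))
    (h' : ∀ e, B'.bundle.proj (f e) = ψ (B.bundle.proj e)) : φ = ψ := by
  ext x
  obtain ⟨e, rfl⟩ := B.bundle.proj_submersion.1 x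
  rw [← h, h']

instance (n : ℕ) : OverMfd (TBA n) where
  pobj B := B.val.base
  pmap u := (SubData.Hom.mem u).2.choose
  pmap_id B := tba_cover_unique (f := 𝟙 _) (SubData.Hom.mem (𝟙 B)).2.choose_spec fun _ => rfl
  pmap_comp u v := tba_cover_unique (SubData.Hom.mem (u ≫ v)).2.choose_spec fun e =>
    ((SubData.Hom.mem v).2.choose_spec _).trans
      (congrArg _ ((SubData.Hom.mem u).2.choose_spec e))
  pmap_eq {_ _ u v} α := tba_cover_unique (SubData.Hom.mem u).2.choose_spec fun e => by
    have h : (SubData.Hom.hom u).base = (SubData.Hom.hom v).base := (SubData.Hom₂.hom α).base_eq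
    rw [h]
    exact (SubData.Hom.mem v).2.choose_spec e

/-- The trivial T-background over `X`. -/
def trivialTB (n : ℕ) (X : Mfd) : TBackground n := ⟨X, trivialBundle n X, trivialGerbe _⟩

end TBackground
end TDual

namespace TDual
open Mfd (Smooth U1 T)

section Bastiani
open Filter Topology ContDiff

/-- A map from an open subset `U` of a normed space to a topological vector space is `C^k` (in the
sense of Michal and Bastiani) if it is continuous and, for `k > 0`, all its directional derivatives
exist and the map `dF : U × E → W` is `C^(k-1)`. -/
def IsBastiani {W : Type} [AddCommGroup W] [Module ℝ W] [TopologicalSpace W] :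
    ℕ → ∀ {E : Type} [NormedAddCommGroup E] [NormedSpace ℝ E], Set E → (E → W) → Prop
  | 0, _, _, _, U, F => ContinuousOn F U
  | k + 1, E, _, _, U, F => ContinuousOn F U ∧ ∃ dF : E × E → W,
      (∀ x ∈ U, ∀ v : E, Tendsto (fun t : ℝ => t⁻¹ • (F (x + t • v) - F x)) (𝓝[≠] 0)
        (𝓝 (dF (x, v)))) ∧ IsBastiani k (U ×ˢ (Set.univ : Set E)) dF

/-- The iterated partial derivatives of a function on `ℝ^n`. -/
def partialD {n : ℕ} : List (Fin n) → ((Fin n → ℝ) → ℝ) → (Fin n → ℝ) → ℝ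
  | [], f => f
  | i :: L, f => fun y => fderiv ℝ (partialD L f) y (Pi.single i 1)

theorem contDiff_partialD {n : ℕ} (L : List (Fin n)) {f : (Fin n → ℝ) → ℝ} (hf : ContDiff ℝ ∞ f) :
    ContDiff ℝ ∞ (partialD L f) := by
  induction L with
  | nil => exact hf
  | cons i L ih => exact (ih.fderiv_right (m := ∞) le_rfl).clm_apply contDiff_const

/-- The real vector space `C^∞(T^n, ℝ)`, where smooth functions on `T^n = ℝ^n / (2πℤ)^n` are regarded
as periodic smooth functions on `ℝ^n`. -/
def smoothPeriodic (n : ℕ) : Submodule ℝ ((Fin n → ℝ) → ℝ) where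
  carrier := {f | ContDiff ℝ ∞ f ∧ ∀ y i, f (y + Pi.single i (2 * Real.pi)) = f y}
  add_mem' := fun ⟨hf, hf'⟩ ⟨hg, hg'⟩ => ⟨hf.add hg, fun y i => congrArg₂ (· + ·) (hf' y i) (hg' y i)⟩
  zero_mem' := ⟨contDiff_const, fun _ _ => rfl⟩
  smul_mem' c _ hf := ⟨contDiff_const.smul hf.1, fun y i => congrArg (c * ·) (hf.2 y i)⟩

/-- The Fréchet space `C^∞(T^n, ℝ)`. -/
def TorusFun (n : ℕ) : Type := smoothPeriodic n

namespace TorusFun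

variable {n : ℕ}

instance : AddCommGroup (TorusFun n) := inferInstanceAs (AddCommGroup (smoothPeriodic n))
instance : Module ℝ (TorusFun n) := inferInstanceAs (Module ℝ (smoothPeriodic n))

/-- The underlying function on `ℝ^n`. -/
def fn (f : TorusFun n) : (Fin n → ℝ) → ℝ := f.1

theorem contDiff (f : TorusFun n) : ContDiff ℝ ∞ f.fn := f.2.1

/-- The iterated partial derivatives, as continuous functions. -/
def deriv (L : List (Fin n)) (f : TorusFun n) : C(Fin n → ℝ, ℝ) :=
  ⟨partialD L f.fn, (contDiff_partialD L f.contDiff).continuous⟩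

/-- The `C^∞`-topology: uniform convergence of all iterated partial derivatives (on compact subsets
of `ℝ^n`, equivalently, by periodicity, on `ℝ^n`). -/
instance : TopologicalSpace (TorusFun n) :=
  ⨅ L : List (Fin n), TopologicalSpace.induced (deriv L) inferInstance

theorem tendsto_iff {α : Type} {l : Filter α} {F : α → TorusFun n} {f : TorusFun n} :
    Tendsto F l (𝓝 f) ↔ ∀ L, Tendsto (fun a => deriv L (F a)) l (𝓝 (deriv L f)) := by
  have : 𝓝 f = ⨅ L : List (Fin n), comap (deriv L) (𝓝 (deriv L f)) := by
    rw [nhds_iInf]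
    simp_rw [nhds_induced]
  simp_rw [this, tendsto_iInf, tendsto_comap_iff]
  rfl

theorem continuous_deriv (L : List (Fin n)) : Continuous (deriv L : TorusFun n → _) :=
  continuous_iff_continuousAt.2 fun _ => tendsto_iff.1 tendsto_id L

theorem continuousOn_iff {E : Type} [TopologicalSpace E] {U : Set E} {F : E → TorusFun n} :
    ContinuousOn F U ↔ ∀ L, ContinuousOn (fun x => deriv L (F x)) U :=
  ⟨fun h L x hx => tendsto_iff.1 (h x hx) L, fun h x hx => tendsto_iff.2 fun L => h L x hx⟩

theorem fn_sub (f g : TorusFun n) (y : Fin n → ℝ) : (f - g).fn y = f.fn y - g.fn y := rfl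
theorem fn_smul (c : ℝ) (f : TorusFun n) (y : Fin n → ℝ) : (c • f).fn y = c * f.fn y := rfl

theorem deriv_smul_sub (L : List (Fin n)) (c : ℝ) (f g : TorusFun n) (y : Fin n → ℝ) :
    deriv L (c • (f - g)) y = c * (deriv L f y - deriv L g y) := by
  change partialD L (c • (f.fn - g.fn)) y = c * (partialD L f.fn y - partialD L g.fn y)
  induction L generalizing y with
  | nil => rfl
  | cons i L ih =>
    change fderiv ℝ (partialD L (c • (f.fn - g.fn))) y _ = c * (fderiv ℝ _ y _ - fderiv ℝ _ y _)
    have e : partialD L (c • (f.fn - g.fn)) = c • (partialD L f.fn - partialD L g.fn) := funext ih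
    have hf := ((contDiff_partialD L f.contDiff).differentiable (by simp)) y
    have hg := ((contDiff_partialD L g.contDiff).differentiable (by simp)) y
    rw [e, fderiv_const_smul (hf.sub hg), fderiv_sub hf hg]
    rfl

/-- Partial differentiation. -/
def D (i : Fin n) (f : TorusFun n) : TorusFun n :=
  ⟨partialD [i] f.fn, contDiff_partialD [i] f.contDiff, fun y j => by
    have h : (fun z => f.fn (z + Pi.single j (2 * Real.pi))) = f.fn := funext fun z => f.2.2 z j
    change fderiv ℝ f.fn (y + Pi.single j (2 * Real.pi)) _ = fderiv ℝ f.fn y _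
    rw [← fderiv_comp_add_right, h]⟩

theorem deriv_D (i : Fin n) (L : List (Fin n)) (f : TorusFun n) :
    deriv L (D i f) = deriv (L ++ [i]) f := by
  ext y
  change partialD L (partialD [i] f.fn) y = partialD (L ++ [i]) f.fn y
  induction L generalizing y with
  | nil => rfl
  | cons j L ih =>
    change fderiv ℝ (partialD L (partialD [i] f.fn)) y _ = fderiv ℝ (partialD (L ++ [i]) f.fn) y _
    rw [funext ih]

theorem continuous_D (i : Fin n) : Continuous (D i : TorusFun n → TorusFun n) :=
  continuous_iff_continuousAt.2 fun f => tendsto_iff.2 fun L => by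
    simp_rw [deriv_D]
    exact (continuous_deriv (L ++ [i])).continuousAt

theorem D_smul_sub (i : Fin n) (c : ℝ) (f g : TorusFun n) :
    D i (c • (f - g)) = c • (D i f - D i g) :=
  Subtype.ext (funext fun y => deriv_smul_sub [i] c f g y)

end TorusFun

variable {E : Type} [NormedAddCommGroup E] [NormedSpace ℝ E] {n : ℕ}

theorem IsBastiani.continuousOn {W : Type} [AddCommGroup W] [Module ℝ W] [TopologicalSpace W] {k : ℕ}
    {U : Set E} {F : E → W} (h : IsBastiani k U F) : ContinuousOn F U := by
  cases k with
  | zero => exact h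
  | succ k => exact h.1

theorem IsBastiani.of_succ {W : Type} [AddCommGroup W] [Module ℝ W] [TopologicalSpace W] {k : ℕ}
    {U : Set E} {F : E → W} (h : IsBastiani (k + 1) U F) : IsBastiani k U F := by
  induction k generalizing E with
  | zero => exact h.1
  | succ k ih =>
    obtain ⟨h1, dF, h2, h3⟩ := h
    exact ⟨h1, dF, h2, ih h3⟩

theorem IsBastiani.D {k : ℕ} {U : Set E} {F : E → TorusFun n} (h : IsBastiani k U F) (i : Fin n) :
    IsBastiani k U fun x => TorusFun.D i (F x) := by
  induction k generalizing E with
  | zero => exact (TorusFun.continuous_D i).comp_continuousOn h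
  | succ k ih =>
    obtain ⟨h1, dF, h2, h3⟩ := h
    refine ⟨(TorusFun.continuous_D i).comp_continuousOn h1, fun p => TorusFun.D i (dF p), ?_, ih h3⟩
    intro x hx v
    simp_rw [← TorusFun.D_smul_sub]
    exact ((TorusFun.continuous_D i).tendsto _).comp (h2 x hx v)

/-! #### From jointly smooth functions to smooth maps into the Fréchet space -/

/-- Iterated partial derivatives in the second variable. -/
def jointD : List (Fin n) → (E × (Fin n → ℝ) → ℝ) → E × (Fin n → ℝ) → ℝ
  | [], G => G
  | i :: L, G => fun p => fderiv ℝ (jointD L G) p (0, Pi.single i 1)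

theorem contDiffOn_fderiv_apply {G : E → ℝ} {O : Set E} (hO : IsOpen O) (hG : ContDiffOn ℝ ∞ G O)
    (w : E) : ContDiffOn ℝ ∞ (fun p => fderiv ℝ G p w) O :=
  (hG.fderiv_of_isOpen hO (m := ∞) le_rfl).clm_apply contDiffOn_const

theorem contDiffOn_jointD {G : E × (Fin n → ℝ) → ℝ} {O : Set (E × (Fin n → ℝ))} (hO : IsOpen O)
    (hG : ContDiffOn ℝ ∞ G O) (L : List (Fin n)) : ContDiffOn ℝ ∞ (jointD L G) O := by
  induction L with
  | nil => exact hG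
  | cons i L ih => exact contDiffOn_fderiv_apply hO ih _

theorem differentiableAt_of_contDiffOn {G : E → ℝ} {O : Set E} (hO : IsOpen O)
    (hG : ContDiffOn ℝ ∞ G O) {p : E} (hp : p ∈ O) : DifferentiableAt ℝ G p :=
  (hG.contDiffAt (hO.mem_nhds hp)).differentiableAt (by simp)

theorem partialD_eq_jointD {G : E × (Fin n → ℝ) → ℝ} {U : Set E} (hU : IsOpen U)
    (hG : ContDiffOn ℝ ∞ G (U ×ˢ Set.univ)) (L : List (Fin n)) {x : E} (hx : x ∈ U)
    (y : Fin n → ℝ) : partialD L (fun y => G (x, y)) y = jointD L G (x, y) := by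
  induction L generalizing y with
  | nil => rfl
  | cons i L ih =>
    change fderiv ℝ (partialD L fun y => G (x, y)) y _ = fderiv ℝ (jointD L G) (x, y) _
    rw [funext ih]
    have hd := differentiableAt_of_contDiffOn (hU.prod isOpen_univ)
      (contDiffOn_jointD (hU.prod isOpen_univ) hG L) (p := (x, y)) ⟨hx, trivial⟩
    have h2 : HasFDerivAt (fun y : Fin n → ℝ => (x, y)) (ContinuousLinearMap.inr ℝ E (Fin n → ℝ)) y :=
      hasFDerivAt_prodMk_right x y
    exact congrArg (fun A => A (Pi.single i 1)) (hd.hasFDerivAt.comp y h2).fderiv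

theorem jointD_fderiv {G : E × (Fin n → ℝ) → ℝ} {O : Set (E × (Fin n → ℝ))} (hO : IsOpen O)
    (hG : ContDiffOn ℝ ∞ G O) (L : List (Fin n)) (w : E × (Fin n → ℝ)) {p : E × (Fin n → ℝ)}
    (hp : p ∈ O) : jointD L (fun q => fderiv ℝ G q w) p = fderiv ℝ (jointD L G) p w := by
  induction L generalizing p with
  | nil => rfl
  | cons i L ih =>
    change fderiv ℝ (jointD L fun q => fderiv ℝ G q w) p _ =
      fderiv ℝ (fun q => fderiv ℝ (jointD L G) q _) p w
    have e : (jointD L fun q => fderiv ℝ G q w) =ᶠ[𝓝 p] fun q => fderiv ℝ (jointD L G) q w :=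
      eventually_of_mem (hO.mem_nhds hp) fun q hq => ih hq
    rw [e.fderiv_eq]
    have hc := contDiffOn_jointD hO hG L
    have hd : DifferentiableAt ℝ (fderiv ℝ (jointD L G)) p :=
      ((hc.fderiv_of_isOpen hO (m := ∞) le_rfl).contDiffAt (hO.mem_nhds hp)).differentiableAt
        (by simp)
    rw [fderiv_clm_apply hd (differentiableAt_const _), fderiv_clm_apply hd (differentiableAt_const _)]
    have hs : IsSymmSndFDerivAt ℝ (jointD L G) p :=
      (hc.contDiffAt (hO.mem_nhds hp)).isSymmSndFDerivAt (by
        simp only [minSmoothness_of_isRCLikeNormedField]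
        exact WithTop.coe_le_coe.2 (le_top : (2 : ℕ∞) ≤ ⊤))
    simpa using hs.eq _ _

theorem continuousOn_of_joint {U : Set E} (hU : IsOpen U) {F : E → TorusFun n}
    (h : ContDiffOn ℝ ∞ (fun p : E × (Fin n → ℝ) => (F p.1).fn p.2) (U ×ˢ Set.univ)) :
    ContinuousOn F U := by
  refine TorusFun.continuousOn_iff.2 fun L => continuousOn_iff_continuous_domRestrict.2 ?_
  refine ContinuousMap.continuous_of_continuous_uncurry _ ?_
  have h1 := (contDiffOn_jointD (hU.prod isOpen_univ) h L).continuousOn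
  have h2 : Continuous fun q : U × (Fin n → ℝ) =>
      jointD L (fun p : E × (Fin n → ℝ) => (F p.1).fn p.2) (q.1.1, q.2) :=
    h1.comp_continuous (by fun_prop) fun q => ⟨q.1.2, trivial⟩
  exact h2.congr fun q => (partialD_eq_jointD hU h L q.1.2 q.2).symm

/-- The difference quotients of a smooth function converge locally uniformly in a parameter. -/
theorem slope_bound {H : E × (Fin n → ℝ) → ℝ} {U : Set E} (hU : IsOpen U)
    (hH : ContDiffOn ℝ ∞ H (U ×ˢ Set.univ)) {x : E} (hx : x ∈ U) (v : E) (y₀ : Fin n → ℝ) {r : ℝ}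
    (hr : 0 < r) : ∃ s ∈ 𝓝 y₀, ∀ᶠ t : ℝ in 𝓝[≠] 0, ∀ y ∈ s,
      dist (fderiv ℝ H (x, y) (v, 0)) (t⁻¹ * (H (x + t • v, y) - H (x, y))) < r := by
  have hO : IsOpen (U ×ˢ (Set.univ : Set (Fin n → ℝ))) := hU.prod isOpen_univ
  set g : E × (Fin n → ℝ) → ℝ := fun p => fderiv ℝ H p (v, 0) with hg
  have hgc : ContinuousOn g (U ×ˢ Set.univ) := (contDiffOn_fderiv_apply hO hH (v, 0)).continuousOn
  set γ : ℝ × (Fin n → ℝ) → E × (Fin n → ℝ) := fun q => (x + q.1 • v, q.2) with hγ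
  have hγc : Continuous γ := by fun_prop
  have hγ0 : γ (0, y₀) = (x, y₀) := by simp [hγ]
  have hmem : ∀ᶠ q in 𝓝 ((0 : ℝ), y₀), γ q ∈ U ×ˢ (Set.univ : Set (Fin n → ℝ)) :=
    hγc.continuousAt.preimage_mem_nhds (by rw [hγ0]; exact hO.mem_nhds ⟨hx, trivial⟩)
  have hcont : ContinuousAt (fun q => g (γ q)) ((0 : ℝ), y₀) := by
    refine ContinuousAt.comp (g := g) ?_ hγc.continuousAt
    rw [hγ0]
    exact hgc.continuousAt (hO.mem_nhds ⟨hx, trivial⟩)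
  have hball : ∀ᶠ q in 𝓝 ((0 : ℝ), y₀), dist (g (γ q)) (g (γ (0, y₀))) < r / 3 :=
    Metric.tendsto_nhds.1 hcont (r / 3) (by positivity)
  obtain ⟨δ, hδ, hδ'⟩ := Metric.eventually_nhds_iff_ball.1 (hmem.and hball)
  refine ⟨Metric.ball y₀ δ, Metric.ball_mem_nhds _ hδ, ?_⟩
  have ht : ∀ᶠ t : ℝ in 𝓝[≠] 0, t ≠ 0 ∧ t ∈ Metric.ball (0 : ℝ) δ :=
    (eventually_mem_nhdsWithin).and (mem_nhdsWithin_of_mem_nhds (Metric.ball_mem_nhds _ hδ))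
  filter_upwards [ht] with t ht y hy
  have key : ∀ s ∈ Metric.ball (0 : ℝ) δ, γ (s, y) ∈ U ×ˢ (Set.univ : Set (Fin n → ℝ)) ∧
      dist (g (γ (s, y))) (g (γ (0, y₀))) < r / 3 := fun s hs => hδ' (s, y) (by
    rw [Metric.mem_ball, Prod.dist_eq]
    exact max_lt hs hy)
  set c : ℝ := g (γ (0, y₀)) with hc
  have hder : ∀ s ∈ Metric.ball (0 : ℝ) δ, HasDerivWithinAt (fun s : ℝ => H (γ (s, y)) - s * c)
      (g (γ (s, y)) - c) (Metric.ball (0 : ℝ) δ) s := by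
    intro s hs
    have h1 : HasDerivAt (fun s : ℝ => γ (s, y)) (v, 0) s := by
      have : HasDerivAt (fun s : ℝ => x + s • v) v s := by
        simpa using ((hasDerivAt_id s).smul_const v).const_add x
      exact this.prodMk (hasDerivAt_const s y)
    have h2 := (differentiableAt_of_contDiffOn hO hH (key s hs).1).hasFDerivAt.comp_hasDerivAt s h1
    have h3 : HasDerivAt (fun s : ℝ => s * c) c s := by
      simpa using (hasDerivAt_id s).mul_const c
    exact (h2.sub h3).hasDerivWithinAt
  have hb := (convex_ball (0 : ℝ) δ).norm_image_sub_le_of_norm_hasDerivWithin_le hder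
    (C := r / 3) (fun s hs => by
      have := (key s hs).2
      rw [Real.dist_eq] at this
      exact this.le) (Metric.mem_ball_self hδ) ht.2
  have h0 : γ (0, y) = (x, y) := by simp [hγ]
  have h1 : dist (g (x, y)) c < r / 3 := by
    have := (key 0 (Metric.mem_ball_self hδ)).2
    rwa [h0] at this
  have ht0 : 0 < |t| := abs_pos.2 ht.1
  have h2 : |t⁻¹ * (H (x + t • v, y) - H (x, y)) - c| ≤ r / 3 := by
    have e : t⁻¹ * (H (x + t • v, y) - H (x, y)) - c =
        t⁻¹ * (H (γ (t, y)) - t * c - (H (γ (0, y)) - 0 * c)) := by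
      rw [h0]
      simp only [hγ]
      field_simp [ht.1]
      ring
    rw [e, abs_mul, abs_inv, inv_mul_le_iff₀ ht0, mul_comm |t|]
    simpa using hb
  rw [Real.dist_eq] at h1 ⊢
  have h3 : fderiv ℝ H (x, y) (v, 0) - t⁻¹ * (H (x + t • v, y) - H (x, y)) =
      (g (x, y) - c) - (t⁻¹ * (H (x + t • v, y) - H (x, y)) - c) := by
    simp only [hg]; ring
  rw [h3]
  refine (abs_sub _ _).trans_lt ?_
  linarith

/-- The directional derivative of a jointly smooth function, as a function into `C^∞(T^n, ℝ)`. -/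
def dirDeriv {U : Set E} (hU : IsOpen U) {F : E → TorusFun n}
    (h : ContDiffOn ℝ ∞ (fun p : E × (Fin n → ℝ) => (F p.1).fn p.2) (U ×ˢ Set.univ)) (x : E)
    (hx : x ∈ U) (v : E) : TorusFun n :=
  ⟨fun y => fderiv ℝ (fun p : E × (Fin n → ℝ) => (F p.1).fn p.2) (x, y) (v, 0),
    (contDiffOn_fderiv_apply (hU.prod isOpen_univ) h (v, 0)).comp_contDiff
      (contDiff_const.prodMk contDiff_id) fun _ => ⟨hx, trivial⟩, fun y i => by
    have e : (fun q : E × (Fin n → ℝ) => (fun p : E × (Fin n → ℝ) => (F p.1).fn p.2)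
        (q + (0, Pi.single i (2 * Real.pi)))) = fun p => (F p.1).fn p.2 := by
      funext q
      have := (F q.1).2.2 q.2 i
      simpa [TorusFun.fn] using this
    have e2 := fderiv_comp_add_right (𝕜 := ℝ) (f := fun p : E × (Fin n → ℝ) => (F p.1).fn p.2)
      (x := (x, y)) (0, Pi.single i (2 * Real.pi))
    rw [e] at e2
    have e3 : ((x, y) : E × (Fin n → ℝ)) + (0, Pi.single i (2 * Real.pi)) =
      (x, y + Pi.single i (2 * Real.pi)) := by simp
    rw [e3] at e2
    change fderiv ℝ _ _ _ = fderiv ℝ _ _ _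
    rw [e2]⟩

open Classical in
theorem isBastiani_of_joint (k : ℕ) {U : Set E} (hU : IsOpen U) {F : E → TorusFun n}
    (h : ContDiffOn ℝ ∞ (fun p : E × (Fin n → ℝ) => (F p.1).fn p.2) (U ×ˢ Set.univ)) :
    IsBastiani k U F := by
  induction k generalizing E with
  | zero => exact continuousOn_of_joint hU h
  | succ k ih =>
    have hO : IsOpen (U ×ˢ (Set.univ : Set (Fin n → ℝ))) := hU.prod isOpen_univ
    refine ⟨continuousOn_of_joint hU h,
      fun p => if hp : p.1 ∈ U then dirDeriv hU h p.1 hp p.2 else 0, fun x hx v => ?_, ?_⟩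
    · simp only [dif_pos hx]
      refine TorusFun.tendsto_iff.2 fun L => ContinuousMap.tendsto_iff_tendstoLocallyUniformly.2 <|
        Metric.tendstoLocallyUniformly_iff.2 fun r hr y₀ => ?_
      obtain ⟨s, hs, hst⟩ := slope_bound hU (contDiffOn_jointD hO h L) hx v y₀ hr
      refine ⟨s, hs, ?_⟩
      have hU' : ∀ᶠ t : ℝ in 𝓝[≠] 0, x + t • v ∈ U := by
        refine mem_nhdsWithin_of_mem_nhds ?_
        have hc : Continuous fun t : ℝ => x + t • v := by fun_prop
        exact hc.continuousAt.preimage_mem_nhds (hU.mem_nhds (by simpa using hx))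
      filter_upwards [hst, hU'] with t ht htU y hy
      have e1 : TorusFun.deriv L (dirDeriv hU h x hx v) y =
          fderiv ℝ (jointD L fun p : E × (Fin n → ℝ) => (F p.1).fn p.2) (x, y) (v, 0) := by
        rw [← jointD_fderiv hO h L (v, 0) ⟨hx, trivial⟩]
        exact partialD_eq_jointD hU (contDiffOn_fderiv_apply hO h (v, 0)) L hx y
      rw [e1, TorusFun.deriv_smul_sub]
      have e2 := partialD_eq_jointD hU h L hx y
      have e3 := partialD_eq_jointD hU h L htU y
      have := ht y hy
      rw [← e2, ← e3] at this
      exact this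
    · refine ih (hU.prod isOpen_univ) ?_
      have h1 : ContDiffOn ℝ ∞ (fun q : (E × E) × (Fin n → ℝ) =>
          fderiv ℝ (fun p : E × (Fin n → ℝ) => (F p.1).fn p.2) (q.1.1, q.2) (q.1.2, 0))
          ((U ×ˢ Set.univ) ×ˢ Set.univ) := by
        refine ContDiffOn.clm_apply ?_ (by fun_prop)
        exact (h.fderiv_of_isOpen hO (m := ∞) le_rfl).comp (by fun_prop) fun q hq =>
          ⟨hq.1.1, trivial⟩
      refine h1.congr fun q hq => ?_
      simp only [dif_pos hq.1.1]
      rfl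

/-! #### From smooth maps into the Fréchet space to jointly smooth functions -/

theorem hasDerivAt_line {f : E → ℝ} {U : Set E} {d : E × E → ℝ}
    (hf : ∀ x ∈ U, ∀ v : E, Tendsto (fun t : ℝ => t⁻¹ * (f (x + t • v) - f x)) (𝓝[≠] 0)
      (𝓝 (d (x, v)))) (x v : E) (s : ℝ) (hs : x + s • v ∈ U) :
    HasDerivAt (fun s : ℝ => f (x + s • v)) (d (x + s • v, v)) s := by
  refine hasDerivAt_iff_tendsto_slope_zero.2 ?_
  have := hf _ hs v
  simpa only [add_smul, add_assoc, smul_eq_mul] using this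

theorem hasDerivAt_line_add {f : E → ℝ} {U : Set E} (hU : IsOpen U) {d : E × E → ℝ}
    (hd : ContinuousOn d (U ×ˢ Set.univ))
    (hf : ∀ x ∈ U, ∀ v : E, Tendsto (fun t : ℝ => t⁻¹ * (f (x + t • v) - f x)) (𝓝[≠] 0)
      (𝓝 (d (x, v)))) {x : E} (hx : x ∈ U) (v w : E) : d (x, v + w) = d (x, v) + d (x, w) := by
  have hc : Continuous fun q : ℝ × ℝ => x + q.1 • v + q.2 • w := by fun_prop
  have hU0 : ∀ᶠ q in 𝓝 ((0 : ℝ), (0 : ℝ)), x + q.1 • v + q.2 • w ∈ U :=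
    hc.continuousAt.preimage_mem_nhds (hU.mem_nhds (by simpa using hx))
  have hcd : ∀ z : E, ContinuousAt (fun q : ℝ × ℝ => d (x + q.1 • v + q.2 • w, z)) (0, 0) := by
    intro z
    refine ContinuousAt.comp (g := d) (f := fun q : ℝ × ℝ => (x + q.1 • v + q.2 • w, z)) ?_
      (hc.continuousAt.prodMk continuousAt_const)
    refine hd.continuousAt ((hU.prod isOpen_univ).mem_nhds ⟨?_, trivial⟩)
    simpa using hx
  have key := hasStrictFDerivAt_uncurry_coprod (𝕜 := ℝ) (u := ((0 : ℝ), (0 : ℝ)))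
    (f := fun a b => f (x + a • v + b • w))
    (f₁ := fun a b => ContinuousLinearMap.toSpanSingleton ℝ (d (x + a • v + b • w, v)))
    (f₂ := fun a b => ContinuousLinearMap.toSpanSingleton ℝ (d (x + a • v + b • w, w)))
    (by
      filter_upwards [hU0] with q hq
      have e : ∀ a : ℝ, x + a • v + q.2 • w = (x + q.2 • w) + a • v := fun a => by abel
      have := hasDerivAt_line hf (x + q.2 • w) v q.1 (by rw [← e]; exact hq)
      simp_rw [← e] at this
      exact this.hasFDerivAt)
    (by
      filter_upwards [hU0] with q hq
      exact (hasDerivAt_line hf (x + q.1 • v) w q.2 hq).hasFDerivAt)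
    ((ContinuousLinearMap.toSpanSingletonCLE (𝕜 := ℝ) (E := ℝ)).continuous.continuousAt.comp (hcd v))
    ((ContinuousLinearMap.toSpanSingletonCLE (𝕜 := ℝ) (E := ℝ)).continuous.continuousAt.comp (hcd w))
  have hdiag : HasDerivAt (fun t : ℝ => (t, t)) ((1 : ℝ), (1 : ℝ)) 0 :=
    (hasDerivAt_id 0).prodMk (hasDerivAt_id 0)
  have h1 := HasFDerivAt.comp_hasDerivAt (f := fun t : ℝ => (t, t)) (0 : ℝ) key.hasFDerivAt hdiag
  have h2 := hasDerivAt_line hf x (v + w) 0 (by simpa using hx)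
  have e : (fun t : ℝ => f (x + t • (v + w))) =
      (Function.uncurry fun a b => f (x + a • v + b • w)) ∘ fun t : ℝ => (t, t) := by
    funext t
    simp [smul_add, add_assoc]
  rw [e] at h2
  simpa [Function.HasUncurry.uncurry] using h2.unique h1

theorem hasFDerivAt_of_line [FiniteDimensional ℝ E] {f : E → ℝ} {U : Set E} (hU : IsOpen U)
    {d : E × E → ℝ} (hd : ContinuousOn d (U ×ˢ Set.univ))
    (hf : ∀ x ∈ U, ∀ v : E, Tendsto (fun t : ℝ => t⁻¹ * (f (x + t • v) - f x)) (𝓝[≠] 0)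
      (𝓝 (d (x, v)))) :
    ∃ A : E → E →L[ℝ] ℝ, (∀ x ∈ U, HasFDerivAt f (A x) x) ∧ ∀ x ∈ U, ∀ v, A x v = d (x, v) := by
  classical
  have hsmul : ∀ x ∈ U, ∀ (c : ℝ) (v : E), d (x, c • v) = c * d (x, v) := by
    intro x hx c v
    have h1 := hasDerivAt_line hf x v 0 (by simpa using hx)
    have h2 := hasDerivAt_line hf x (c • v) 0 (by simpa using hx)
    have h3 : HasDerivAt (fun s : ℝ => s * c) c 0 := by simpa using (hasDerivAt_id (0 : ℝ)).mul_const c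
    have h1' : HasDerivAt (fun s : ℝ => f (x + s • v)) (d (x + (0 : ℝ) • v, v)) ((0 : ℝ) * c) := by
      simpa using h1
    have h4 := h1'.comp (0 : ℝ) h3
    have e : (fun s : ℝ => f (x + s • c • v)) = (fun s : ℝ => f (x + s • v)) ∘ fun s => s * c := by
      funext s
      simp [mul_smul]
    rw [e] at h2
    have := h2.unique h4
    simpa [mul_comm] using this
  let A : E → E →L[ℝ] ℝ := fun x => if hx : x ∈ U then LinearMap.toContinuousLinearMap
    { toFun := fun v => d (x, v)
      map_add' := hasDerivAt_line_add hU hd hf hx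
      map_smul' := hsmul x hx } else 0
  have hA : ∀ x ∈ U, ∀ v, A x v = d (x, v) := by
    intro x hx v
    simp only [A, dif_pos hx]
    rfl
  refine ⟨A, fun x hx => ?_, hA⟩
  have hAc : ContinuousOn A U := continuousOn_clm_apply.2 fun v =>
    (hd.comp (f := fun x => (x, v)) (by fun_prop) fun x hx => ⟨hx, trivial⟩).congr fun x hx => hA x hx v
  refine HasFDerivAt.of_isLittleO (Asymptotics.isLittleO_iff.2 fun r hr => ?_)
  have hAx := Metric.tendsto_nhds.1 (hAc.continuousAt (hU.mem_nhds hx)) r hr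
  obtain ⟨δ, hδ, hδ'⟩ := Metric.eventually_nhds_iff_ball.1 (hAx.and (hU.mem_nhds hx))
  filter_upwards [Metric.ball_mem_nhds x hδ] with z hz
  set h := z - x with hh
  have hseg : ∀ s ∈ Set.Icc (0 : ℝ) 1, x + s • h ∈ Metric.ball x δ := by
    intro s hs
    rw [Metric.mem_ball, dist_eq_norm] at hz ⊢
    rw [add_sub_cancel_left, norm_smul, Real.norm_of_nonneg hs.1]
    exact (mul_le_of_le_one_left (norm_nonneg _) hs.2).trans_lt hz
  have hb := norm_image_sub_le_of_norm_deriv_le_segment_01'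
    (f := fun s : ℝ => f (x + s • h) - s * A x h) (f' := fun s => A (x + s • h) h - A x h)
    (C := r * ‖h‖) (fun s hs => by
      have h1 := hasDerivAt_line hf x h s (hδ' _ (hseg s hs)).2
      rw [← hA _ (hδ' _ (hseg s hs)).2] at h1
      have h3 : HasDerivAt (fun s : ℝ => s * A x h) (A x h) s := by
        simpa using (hasDerivAt_id s).mul_const (A x h)
      exact (h1.sub h3).hasDerivWithinAt) (fun s hs => by
      have h1 := (hδ' _ (hseg s ⟨hs.1, hs.2.le⟩)).1
      rw [dist_eq_norm] at h1
      rw [← sub_apply]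
      exact ((A (x + s • h) - A x).le_opNorm h).trans
        (mul_le_mul_of_nonneg_right h1.le (norm_nonneg _)))
  have e : f z - f x - A x h = f (x + (1 : ℝ) • h) - 1 * A x h - (f (x + (0 : ℝ) • h) - 0 * A x h) := by
    simp [hh]
    ring
  rw [e]
  exact hb

theorem continuousOn_joint {X : Type} [TopologicalSpace X] {U : Set X} {F : X → TorusFun n}
    (h : ContinuousOn F U) :
    ContinuousOn (fun p : X × (Fin n → ℝ) => (F p.1).fn p.2) (U ×ˢ Set.univ) := by
  have h1 : ContinuousOn (fun p : X × (Fin n → ℝ) => TorusFun.deriv [] (F p.1)) (U ×ˢ Set.univ) :=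
    (TorusFun.continuousOn_iff.1 h []).comp continuousOn_fst fun p hp => hp.1
  exact h1.eval continuousOn_snd

theorem fderiv_eq_sum (f : TorusFun n) (y w : Fin n → ℝ) :
    fderiv ℝ f.fn y w = ∑ i, w i * (TorusFun.D i f).fn y := by
  conv_lhs => rw [← Finset.univ_sum_single w, map_sum]
  refine Finset.sum_congr rfl fun i _ => ?_
  have : (Pi.single i (w i) : Fin n → ℝ) = w i • Pi.single i 1 := by
    rw [← Pi.single_smul]; simp
  rw [this, map_smul]
  rfl

theorem IsBastiani.contDiffOn [FiniteDimensional ℝ E] {k : ℕ} {U : Set E} (hU : IsOpen U)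
    {F : E → TorusFun n} (h : IsBastiani k U F) :
    ContDiffOn ℝ k (fun p : E × (Fin n → ℝ) => (F p.1).fn p.2) (U ×ˢ Set.univ) := by
  induction k generalizing E with
  | zero => exact contDiffOn_zero.2 (continuousOn_joint h.continuousOn)
  | succ k ih =>
    have hO : IsOpen (U ×ˢ (Set.univ : Set (Fin n → ℝ))) := hU.prod isOpen_univ
    have hD : ∀ i, ContDiffOn ℝ k (fun p : E × (Fin n → ℝ) => (TorusFun.D i (F p.1)).fn p.2)
        (U ×ˢ Set.univ) := fun i => ih hU (h.of_succ.D i)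
    obtain ⟨h1, dF, h2, h3⟩ := h
    have hdF := ih (hU.prod isOpen_univ) h3
    have hline : ∀ y : Fin n → ℝ, ∀ x ∈ U, ∀ v : E,
        Tendsto (fun t : ℝ => t⁻¹ * ((F (x + t • v)).fn y - (F x).fn y)) (𝓝[≠] 0)
          (𝓝 ((dF (x, v)).fn y)) := fun y x hx v =>
      ((continuous_eval_const (F := C(Fin n → ℝ, ℝ)) y).tendsto _).comp (TorusFun.tendsto_iff.1 (h2 x hx v) [])
    have hdc : ∀ y : Fin n → ℝ, ContinuousOn (fun p : E × E => (dF p).fn y) (U ×ˢ Set.univ) :=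
      fun y => by
        have hj := continuousOn_joint h3.continuousOn
        have hi : ContinuousOn (fun p : E × E => (p, y)) (U ×ˢ Set.univ) := by fun_prop
        exact ContinuousOn.comp (g := fun q : (E × E) × (Fin n → ℝ) => (dF q.1).fn q.2) hj hi
          fun p hp => ⟨hp, trivial⟩
    have hex : ∀ y : Fin n → ℝ, ∃ A : E → E →L[ℝ] ℝ,
        (∀ x ∈ U, HasFDerivAt (fun x => (F x).fn y) (A x) x) ∧
          ∀ x ∈ U, ∀ v, A x v = (dF (x, v)).fn y := fun y =>
      hasFDerivAt_of_line (f := fun x => (F x).fn y) (d := fun p => (dF p).fn y) hU (hdc y) (hline y)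
    choose A hA hA' using hex
    have hstrict : ∀ p ∈ U ×ˢ (Set.univ : Set (Fin n → ℝ)),
        HasStrictFDerivAt (fun p : E × (Fin n → ℝ) => (F p.1).fn p.2)
          ((A p.2 p.1).coprod (fderiv ℝ (F p.1).fn p.2)) p := by
      intro p hp
      refine hasStrictFDerivAt_uncurry_coprod (𝕜 := ℝ) (f := fun x y => (F x).fn y)
        (f₁ := fun x y => A y x) (f₂ := fun x y => fderiv ℝ (F x).fn y) ?_ ?_ ?_ ?_
      · filter_upwards [hO.mem_nhds hp] with q hq
        exact hA q.2 q.1 hq.1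
      · filter_upwards with q
        exact ((F q.1).contDiff.differentiable (by simp) q.2).hasFDerivAt
      · refine ContinuousOn.continuousAt (s := U ×ˢ Set.univ) ?_ (hO.mem_nhds hp)
        refine continuousOn_clm_apply.2 fun v => ?_
        refine ContinuousOn.congr (f := fun q : E × (Fin n → ℝ) => (dF (q.1, v)).fn q.2) ?_
          fun q hq => hA' q.2 q.1 hq.1 v
        have hj := continuousOn_joint h3.continuousOn
        have hi : ContinuousOn (fun q : E × (Fin n → ℝ) => (((q.1, v), q.2) : (E × E) × (Fin n → ℝ)))
            (U ×ˢ Set.univ) := by fun_prop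
        exact ContinuousOn.comp (g := fun q : (E × E) × (Fin n → ℝ) => (dF q.1).fn q.2) hj hi
          fun q hq => ⟨⟨hq.1, trivial⟩, trivial⟩
      · refine ContinuousOn.continuousAt (s := U ×ˢ Set.univ) ?_ (hO.mem_nhds hp)
        refine continuousOn_clm_apply.2 fun w => ?_
        refine ContinuousOn.congr
          (f := fun q : E × (Fin n → ℝ) => ∑ i, w i * (TorusFun.D i (F q.1)).fn q.2) ?_
          fun q hq => fderiv_eq_sum (F q.1) q.2 w
        exact continuousOn_finsetSum _ fun i _ => continuousOn_const.mul (hD i).continuousOn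
    have hfd : ∀ p ∈ U ×ˢ (Set.univ : Set (Fin n → ℝ)),
        fderiv ℝ (fun p : E × (Fin n → ℝ) => (F p.1).fn p.2) p =
          (A p.2 p.1).coprod (fderiv ℝ (F p.1).fn p.2) := fun p hp => (hstrict p hp).hasFDerivAt.fderiv
    push_cast
    refine contDiffOn_succ_of_fderiv_apply
      (fun p hp => (hstrict p hp).hasFDerivAt.differentiableAt.differentiableWithinAt)
      (fun hk => absurd hk (by simp)) fun w => ?_
    refine ContDiffOn.congr (f := fun p : E × (Fin n → ℝ) => (dF (p.1, w.1)).fn p.2 +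
      ∑ i, w.2 i * (TorusFun.D i (F p.1)).fn p.2) ?_ fun p hp => ?_
    · refine ContDiffOn.add ?_ (ContDiffOn.sum fun i _ => contDiffOn_const.mul (hD i))
      have hi : ContDiffOn ℝ k
          (fun q : E × (Fin n → ℝ) => (((q.1, w.1), q.2) : (E × E) × (Fin n → ℝ)))
          (U ×ˢ Set.univ) := by fun_prop
      exact ContDiffOn.comp (g := fun q : (E × E) × (Fin n → ℝ) => (dF q.1).fn q.2) hdF hi
        fun q hq => ⟨⟨hq.1, trivial⟩, trivial⟩
    · rw [fderivWithin_of_isOpen hO hp, hfd p hp, ← fderiv_eq_sum, ← hA' p.2 p.1 hp.1]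
      rfl

end Bastiani
end TDual

namespace TDual
open Mfd (Smooth U1 T)

section Frechet
open Filter Topology ContDiff

variable {n : ℕ}

/-- The quotient map `ℝ^n → T^n`. -/
def expT (y : Fin n → ℝ) : T n := fun i => Circle.exp (y i)

/-- The exponential map `t ↦ exp(it)` from `ℝ` to `U(1)`. -/
def expU (t : ℝ) : U1 := Circle.exp t

/-- Smoothness of maps from a manifold to the Fréchet Lie group `C^∞(T^n, U(1))`: near every point
`x₀` the map is smooth in the chart `f ↦ τ(x₀) · exp(if)` around `τ(x₀)`, defined on a neighbourhood of
`0` in the Fréchet space `C^∞(T^n, ℝ)`. -/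
def FrechetSmooth {X : Mfd} (τ : X → (T n ⟶ U1)) : Prop :=
  ∀ x₀ : X, ∃ W : Set X.E, IsOpen W ∧ extChartAt X.I x₀ x₀ ∈ W ∧ W ⊆ (extChartAt X.I x₀).target ∧
    ∃ φ : X.E → TorusFun n, (∀ k, IsBastiani k W φ) ∧ ∀ z ∈ W, ∀ y : Fin n → ℝ,
      τ ((extChartAt X.I x₀).symm z) (expT y) = τ x₀ (expT y) * expU ((φ z).fn y)

theorem smooth_expU : ContMDiff (modelWithCornersSelf ℝ ℝ) U1.I ∞ (expU : ℝ → U1) :=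
  contMDiff_circleExp (m := ∞)

theorem smooth_expT : ContMDiff (modelWithCornersSelf ℝ (Fin n → ℝ)) (T n).I ∞
    (expT : (Fin n → ℝ) → T n) := by
  let M : Mfd := { carrier := Fin n → ℝ, E := Fin n → ℝ, H := Fin n → ℝ,
                   I := modelWithCornersSelf ℝ (Fin n → ℝ) }
  exact (Mfd.smooth_torus_iff (M := M) expT).2 fun i =>
    smooth_expU.comp (contDiff_apply ℝ ℝ i).contMDiff

/-- The inclusion of `U(1)` into the complex numbers. -/
def coeU (z : U1) : ℂ := Subtype.val (p := (· ∈ Submonoid.unitSphere ℂ)) z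

/-- The argument. -/
def argU (z : U1) : ℝ := Complex.arg (coeU z)

theorem expU_argU (z : U1) : expU (argU z) = z := Circle.exp_arg z
theorem coeU_mul_inv (z : U1) : coeU (z * z⁻¹) ∈ Complex.slitPlane := by
  rw [mul_inv_cancel]
  exact Complex.one_mem_slitPlane
theorem expU_add (s t : ℝ) : expU (s + t) = expU s * expU t := Circle.exp_add s t
theorem continuous_coeU : Continuous coeU := continuous_subtype_val (p := (· ∈ Submonoid.unitSphere ℂ))

theorem contMDiffAt_argU {z : U1} (hz : coeU z ∈ Complex.slitPlane) :
    ContMDiffAt U1.I (modelWithCornersSelf ℝ ℝ) ∞ argU z := by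
  have : Fact (Module.finrank ℝ ℂ = 1 + 1) := finrank_real_complex_fact'
  have h1 : ContMDiffAt U1.I (modelWithCornersSelf ℝ ℂ) ∞ coeU z :=
    contMDiff_coe_sphere (E := ℂ) (n := 1) z
  have h2 : ContDiffAt ℝ ∞ (fun w : ℂ => (Complex.log w).im) (coeU z) :=
    Complex.imCLM.contDiff.contDiffAt.comp _ ((Complex.contDiffAt_log hz).restrict_scalars ℝ)
  have h3 := ContMDiffAt.comp z h2.contMDiffAt h1
  refine h3.congr_of_eventuallyEq (Eventually.of_forall fun w => ?_)
  exact (Complex.log_im _).symm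

theorem expT_add_single (y : Fin n → ℝ) (i : Fin n) :
    expT (y + Pi.single i (2 * Real.pi)) = expT y := by
  funext j
  change Circle.exp (y j + (Pi.single i (2 * Real.pi) : Fin n → ℝ) j) = Circle.exp (y j)
  by_cases h : j = i
  · subst h
    rw [Pi.single_eq_same, Circle.exp_add_two_pi]
  · rw [Pi.single_eq_of_ne h, add_zero]

theorem smooth_of_frechetSmooth {X : Mfd} {τ : X → (T n ⟶ U1)} (h : FrechetSmooth τ) :
    Smooth (M := X.prod (T n)) (fun p => τ p.1 p.2) := by
  rintro ⟨x₀, t₀⟩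
  obtain ⟨W, hW, hx, hWt, φ, hφ, hτ⟩ := h x₀
  have hjoint : ContDiffOn ℝ ∞ (fun p : X.E × (Fin n → ℝ) => (φ p.1).fn p.2) (W ×ˢ Set.univ) :=
    contDiffOn_infty.2 fun k => (hφ k).contDiffOn hW
  let lift : T n → (Fin n → ℝ) := fun t i =>
    argU (t₀ i) + argU (t i * (t₀ i)⁻¹ : U1)
  have hlift : ∀ t, expT (lift t) = t := fun t => by
    funext i
    have key : ∀ a b : U1, expU (argU a + argU (b * a⁻¹)) = b := fun a b => by
      rw [expU_add, expU_argU, expU_argU]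
      exact mul_inv_cancel_comm_assoc a b
    exact key (t₀ i) (t i)
  have hlc : ContMDiffAt (T n).I (modelWithCornersSelf ℝ (Fin n → ℝ)) ∞ lift t₀ := by
    refine contMDiffAt_pi_space.2 fun i => ?_
    refine ContMDiffAt.add contMDiffAt_const ?_
    have h1 : Smooth (M := T n) (N := U1) fun t => t i * (t₀ i)⁻¹ :=
      Smooth.mul_U1 (Mfd.smooth_torus_coord i) (Mfd.smooth_const (M := T n) (N := U1) (t₀ i)⁻¹)
    refine ContMDiffAt.comp (g := argU) t₀ (contMDiffAt_argU (coeU_mul_inv (t₀ i))) (h1 t₀)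
  have hin : ContMDiffAt (X.I.prod (T n).I) (modelWithCornersSelf ℝ (X.E × (Fin n → ℝ))) ∞
      (fun p : X × T n => (extChartAt X.I x₀ p.1, lift p.2)) (x₀, t₀) := by
    refine ContMDiffAt.prodMk_space ?_ ?_
    · exact ContMDiffAt.comp (I' := X.I) (g := extChartAt X.I x₀) (f := fun p : X × T n => p.1)
        (x₀, t₀) (contMDiffAt_extChartAt (I := X.I) (x := x₀)) contMDiffAt_fst
    · exact ContMDiffAt.comp (I' := (T n).I) (g := lift) (f := fun p : X × T n => p.2)
        (x₀, t₀) hlc contMDiffAt_snd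
  have hG : ContMDiffAt (modelWithCornersSelf ℝ (X.E × (Fin n → ℝ))) (modelWithCornersSelf ℝ ℝ) ∞
      (fun p : X.E × (Fin n → ℝ) => (φ p.1).fn p.2) (extChartAt X.I x₀ x₀, lift t₀) :=
    (hjoint.contDiffAt ((hW.prod isOpen_univ).mem_nhds ⟨hx, trivial⟩)).contMDiffAt
  have hE : ContMDiffAt (X.I.prod (T n).I) U1.I ∞
      (fun p : X × T n => expU ((φ (extChartAt X.I x₀ p.1)).fn (lift p.2))) (x₀, t₀) :=
    ContMDiffAt.comp (g := fun q : X.E × (Fin n → ℝ) => expU ((φ q.1).fn q.2)) (x₀, t₀)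
      (ContMDiffAt.comp (g := expU) (extChartAt X.I x₀ x₀, lift t₀) (smooth_expU _) hG) hin
  have h0 : Smooth (M := X.prod (T n)) (fun p => τ x₀ p.2) := (τ x₀).smooth.comp Mfd.smooth_snd
  have hmul : ContMDiffAt (X.I.prod (T n).I) U1.I ∞ (fun p : X × T n =>
      τ x₀ p.2 * expU ((φ (extChartAt X.I x₀ p.1)).fn (lift p.2))) (x₀, t₀) :=
    ContMDiffAt.comp (I' := U1.I.prod U1.I) (M' := U1 × U1) (g := fun q : U1 × U1 => q.1 * q.2)
      (f := fun p : X × T n => (τ x₀ p.2, expU ((φ (extChartAt X.I x₀ p.1)).fn (lift p.2))))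
      (x₀, t₀) (Mfd.smooth_U1_mul _) (ContMDiffAt.prodMk (h0 (x₀, t₀)) hE)
  refine ContMDiffAt.congr_of_eventuallyEq hmul ?_
  have hn : ∀ᶠ p : X × T n in 𝓝 (x₀, t₀), p.1 ∈ (extChartAt X.I x₀).source ∧
      extChartAt X.I x₀ p.1 ∈ W := by
    refine continuousAt_fst.eventually (p := fun x : X => x ∈ (extChartAt X.I x₀).source ∧
      extChartAt X.I x₀ x ∈ W)
      (Filter.Eventually.and (extChartAt_source_mem_nhds (I := X.I) x₀) ?_)
    exact (continuousAt_extChartAt (I := X.I) x₀).preimage_mem_nhds (hW.mem_nhds hx)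
  filter_upwards [hn] with p hp
  have := hτ _ hp.2 (lift p.2)
  rw [hlift, (extChartAt X.I x₀).left_inv hp.1] at this
  exact this

open Classical in
theorem frechetSmooth_of_smooth {X : Mfd} {τ : X → (T n ⟶ U1)}
    (h : Smooth (M := X.prod (T n)) (fun p => τ p.1 p.2)) : FrechetSmooth τ := by
  intro x₀
  let R : X × T n → U1 := fun p => τ p.1 p.2 * (τ x₀ p.2)⁻¹
  have hR0 : Smooth (M := X.prod (T n)) (N := U1) R :=
    h.mul_U1 ((τ x₀).smooth.comp Mfd.smooth_snd).inv_U1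
  have hR : ContMDiff (X.I.prod (T n).I) U1.I ∞ R := hR0
  have hO : IsOpen (R ⁻¹' {z : U1 | coeU z ∈ Complex.slitPlane}) :=
    (Complex.isOpen_slitPlane.preimage continuous_coeU).preimage hR.continuous
  have : CompactSpace (T n) := inferInstanceAs (CompactSpace (Fin n → Circle))
  obtain ⟨V, V', hV, hV', hxV, hV'u, hVO⟩ := generalized_tube_lemma (isCompact_singleton (x := x₀))
    (isCompact_univ (X := T n)) hO (by
      rintro ⟨x, t⟩ ⟨hx, -⟩
      obtain rfl : x = x₀ := hx
      exact coeU_mul_inv (τ x t))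
  have hV2 : ∀ x ∈ V, ∀ t, coeU (R (x, t)) ∈ Complex.slitPlane := fun x hx t =>
    hVO (show (x, t) ∈ V ×ˢ V' from ⟨hx, hV'u trivial⟩)
  let W : Set X.E := (extChartAt X.I x₀).target ∩ (extChartAt X.I x₀).symm ⁻¹' V
  have hW : IsOpen W := (continuousOn_extChartAt_symm (I := X.I) x₀).isOpen_inter_preimage
    (isOpen_extChartAt_target x₀) hV
  have hWV : ∀ z ∈ W, (extChartAt X.I x₀).symm z ∈ V := fun z hz => hz.2
  have hsm : ContDiffOn ℝ ∞ (fun p : X.E × (Fin n → ℝ) =>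
      argU (R ((extChartAt X.I x₀).symm p.1, expT p.2))) (W ×ˢ Set.univ) := by
    refine contMDiffOn_iff_contDiffOn.1 ?_
    rintro ⟨z, y⟩ ⟨hz, -⟩
    refine ContMDiffAt.contMDiffWithinAt ?_
    have h1 : ContMDiffAt (modelWithCornersSelf ℝ (X.E × (Fin n → ℝ))) (X.I.prod (T n).I) ∞
        (fun p : X.E × (Fin n → ℝ) => ((extChartAt X.I x₀).symm p.1, expT p.2)) (z, y) := by
      refine ContMDiffAt.prodMk (J' := (T n).I) ?_ ?_
      · have h2 : ContMDiffAt (modelWithCornersSelf ℝ X.E) X.I ∞ (extChartAt X.I x₀).symm z :=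
          (contMDiffOn_extChartAt_symm (I := X.I) x₀).contMDiffAt
            ((isOpen_extChartAt_target x₀).mem_nhds hz.1)
        exact ContMDiffAt.comp (z, y) h2 contDiff_fst.contMDiff.contMDiffAt
      · exact ContMDiffAt.comp (z, y) (smooth_expT y) contDiff_snd.contMDiff.contMDiffAt
    exact ContMDiffAt.comp (I' := U1.I) (g := argU)
      (f := fun p : X.E × (Fin n → ℝ) => R ((extChartAt X.I x₀).symm p.1, expT p.2)) (z, y)
      (contMDiffAt_argU (hV2 _ (hWV z hz) (expT y)))
      (ContMDiffAt.comp (I' := X.I.prod (T n).I) (g := R) (z, y) (hR _) h1)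
  let φ : X.E → TorusFun n := fun z => if hz : z ∈ W then
    ⟨fun y => argU (R ((extChartAt X.I x₀).symm z, expT y)),
      ContDiffOn.comp_contDiff (g := fun p : X.E × (Fin n → ℝ) =>
        argU (R ((extChartAt X.I x₀).symm p.1, expT p.2))) (f := fun y => (z, y)) hsm (contDiff_const.prodMk contDiff_id) fun _ => ⟨hz, trivial⟩,
      fun y i => by simp only [expT_add_single]⟩ else 0
  have hφ : ∀ z ∈ W, ∀ y, (φ z).fn y = argU (R ((extChartAt X.I x₀).symm z, expT y)) := by
    intro z hz y
    have : φ z = ⟨fun y => argU (R ((extChartAt X.I x₀).symm z, expT y)), _⟩ := dif_pos hz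
    rw [this]
    rfl
  refine ⟨W, hW, ⟨mem_extChartAt_target x₀, ?_⟩, Set.inter_subset_left, φ,
    fun k => isBastiani_of_joint k hW (hsm.congr fun p hp => hφ p.1 hp.1 p.2), fun z hz y => ?_⟩
  · change (extChartAt X.I x₀).symm (extChartAt X.I x₀ x₀) ∈ V
    rw [extChartAt_to_inv]
    exact hxV rfl
  · rw [hφ z hz, expU_argU]
    change _ = τ x₀ (expT y) * (τ _ (expT y) * (τ x₀ (expT y))⁻¹)
    exact (mul_inv_cancel_comm_assoc (G := Circle) _ _).symm

/-- A map to `C^∞(T^n, U(1))` is smooth if and only if the corresponding function of two variables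
is smooth. -/
theorem frechetSmooth_iff {X : Mfd} (τ : X → (T n ⟶ U1)) :
    FrechetSmooth τ ↔ Smooth (M := X.prod (T n)) (fun p => τ p.1 p.2) :=
  ⟨smooth_of_frechetSmooth, frechetSmooth_of_smooth⟩

end Frechet
end TDual

namespace TDual
open Mfd (Smooth U1 T)

section BTB

variable {n : ℕ}

/-- The group `C^∞(T^n, U(1))` of smooth maps, with pointwise multiplication. -/
instance : CommGroup (T n ⟶ U1) where
  mul α β := ⟨fun a => α a * β a, α.smooth.mul_U1 β.smooth⟩
  one := ⟨fun _ => 1, Mfd.smooth_const _⟩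
  inv α := ⟨fun a => (α a)⁻¹, α.smooth.inv_U1⟩
  mul_assoc α β γ := Mfd.hom_ext fun a => mul_assoc (α a) (β a) (γ a)
  one_mul α := Mfd.hom_ext fun a => one_mul (α a)
  mul_one α := Mfd.hom_ext fun a => mul_one (α a)
  inv_mul_cancel α := Mfd.hom_ext fun a => inv_mul_cancel (α a)
  mul_comm α β := Mfd.hom_ext fun a => mul_comm (α a) (β a)

/-- The action of `T^n` on `C^∞(T^n, U(1))`, given by `(^b α)(a) = α(a - b)`. -/
def translate (b : T n) (α : T n ⟶ U1) : T n ⟶ U1 :=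
  ⟨fun a => α (a * b⁻¹), α.smooth.comp (Smooth.mul_T Mfd.smooth_id (Mfd.smooth_const _))⟩

@[simp] theorem mul_apply (α β : T n ⟶ U1) (a : T n) : (α * β) a = α a * β a := rfl
@[simp] theorem one_apply (a : T n) : (1 : T n ⟶ U1) a = 1 := rfl
@[simp] theorem translate_apply (b : T n) (α : T n ⟶ U1) (a : T n) :
    translate b α a = α (a * b⁻¹) := rfl

theorem frechetSmooth_one {X : Mfd} : FrechetSmooth (fun _ : X => (1 : T n ⟶ U1)) :=
  (frechetSmooth_iff _).2 (Mfd.smooth_const _)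

theorem FrechetSmooth.mul {X : Mfd} {σ τ : X → (T n ⟶ U1)} (hσ : FrechetSmooth σ)
    (hτ : FrechetSmooth τ) : FrechetSmooth fun x => σ x * τ x :=
  (frechetSmooth_iff _).2 (((frechetSmooth_iff _).1 hσ).mul_U1 ((frechetSmooth_iff _).1 hτ))

theorem FrechetSmooth.comp {X Y : Mfd} {τ : Y → (T n ⟶ U1)} (hτ : FrechetSmooth τ) (φ : X ⟶ Y) :
    FrechetSmooth fun x => τ (φ x) :=
  (frechetSmooth_iff _).2 (((frechetSmooth_iff _).1 hτ).comp
    ((φ.smooth.comp Mfd.smooth_fst).prodMk Mfd.smooth_snd))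

theorem FrechetSmooth.translate {X : Mfd} {τ : X → (T n ⟶ U1)} (hτ : FrechetSmooth τ)
    (g : X ⟶ T n) : FrechetSmooth fun x => translate (g x) (τ x) :=
  (frechetSmooth_iff _).2 (((frechetSmooth_iff _).1 hτ).comp (Mfd.smooth_fst.prodMk
    (Smooth.mul_T Mfd.smooth_snd (g.smooth.comp Mfd.smooth_fst).inv_T)))

/-- The objects of the presheaf of bicategories of smooth `BTB^F2`-valued functions: there is a
single object over each manifold. -/
structure BTB (n : ℕ) : Type 1 where
  base : Mfd

/-- The 1-morphisms: smooth `T^n`-valued functions. -/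
@[ext] structure BTB.Hom {n : ℕ} (X Y : BTB n) : Type where
  base : X.base ⟶ Y.base
  g : X.base ⟶ T n

instance : CategoryStruct (BTB n) where
  Hom X Y := BTB.Hom X Y
  id X := ⟨𝟙 X.base, ⟨fun _ => 1, Mfd.smooth_const _⟩⟩
  comp u v := ⟨u.base ≫ v.base,
    ⟨fun x => u.g x * v.g (u.base x), u.g.smooth.mul_T (v.g.smooth.comp u.base.smooth)⟩⟩

/-- The 2-morphisms: there are only 2-morphisms from `g` to itself, namely the smooth maps `τ` to
the Fréchet Lie group `C^∞(T^n, U(1))`. -/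
@[ext] structure BTB.Hom₂ {X Y : BTB n} (u v : X ⟶ Y) : Type where
  eq : u = v
  τ : X.base → (T n ⟶ U1)
  smooth : FrechetSmooth τ

namespace BTB

variable {X Y Z W : BTB n}

theorem ext_hom {u v : X ⟶ Y} (h : ∀ x, u.base x = v.base x) (h' : ∀ x, u.g x = v.g x) : u = v :=
  Hom.ext (Mfd.hom_ext h) (Mfd.hom_ext h')

instance homCategory (X Y : BTB n) : Category (X ⟶ Y) where
  Hom u v := Hom₂ u v
  id u := ⟨rfl, fun _ => 1, frechetSmooth_one⟩
  comp σ τ := ⟨σ.eq.trans τ.eq, fun x => σ.τ x * τ.τ x, σ.smooth.mul τ.smooth⟩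
  id_comp _ := Hom₂.ext (funext fun _ => one_mul _)
  comp_id _ := Hom₂.ext (funext fun _ => mul_one _)
  assoc _ _ _ := Hom₂.ext (funext fun _ => mul_assoc _ _ _)

theorem hom₂_ext {u v : X ⟶ Y} {σ τ : u ⟶ v} (h : ∀ x a, σ.τ x a = τ.τ x a) : σ = τ :=
  Hom₂.ext (funext fun x => Mfd.hom_ext (h x))

/-- The 2-isomorphism between equal 1-morphisms. -/
def isoOfEq {u v : X ⟶ Y} (h : u = v) : u ≅ v where
  hom := ⟨h, fun _ => 1, frechetSmooth_one⟩
  inv := ⟨h.symm, fun _ => 1, frechetSmooth_one⟩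
  hom_inv_id := hom₂_ext fun _ _ => one_mul _
  inv_hom_id := hom₂_ext fun _ _ => one_mul _

/-- The bicategory structure. The horizontal composition of `τ₁` with `τ₂ : g₂ ⟶ g₂` is
`τ₂ + ^{g₂}τ₁` (where `τ₂` and `g₂` are pulled back along the map of manifolds). -/
instance : Bicategory (BTB n) where
  homCategory := BTB.homCategory
  whiskerLeft u _ _ τ := BTB.Hom₂.mk (congrArg (u ≫ ·) τ.eq) (fun x => τ.τ (u.base x))
    (τ.smooth.comp u.base)
  whiskerRight {_ _ _ u _} τ v := BTB.Hom₂.mk (congrArg (· ≫ v) τ.eq)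
    (fun x => translate (v.g (u.base x)) (τ.τ x)) (τ.smooth.translate (u.base ≫ v.g))
  associator u v w := isoOfEq (ext_hom (fun _ => rfl) fun _ => mul_assoc _ _ _)
  leftUnitor u := isoOfEq (ext_hom (fun _ => rfl) fun _ => one_mul _)
  rightUnitor u := isoOfEq (ext_hom (fun _ => rfl) fun _ => mul_one _)
  whiskerLeft_id _ _ := rfl
  whiskerLeft_comp _ _ _ _ _ _ := rfl
  id_whiskerLeft τ := hom₂_ext fun x a => by
    change τ.τ x a = 1 * (τ.τ x a * 1)
    rw [mul_one, one_mul]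
  comp_whiskerLeft u v _ _ τ := hom₂_ext fun x a => by
    change τ.τ (v.base (u.base x)) a = 1 * (τ.τ (v.base (u.base x)) a * 1)
    rw [mul_one, one_mul]
  id_whiskerRight _ _ := rfl
  comp_whiskerRight {_ _ _ u v _} σ τ w := hom₂_ext fun x a => by
    obtain rfl := σ.eq
    rfl
  whiskerRight_id τ := hom₂_ext fun x a => by
    change τ.τ x (a * 1⁻¹) = 1 * (τ.τ x a * 1)
    rw [mul_one, one_mul, inv_one, mul_one]
  whiskerRight_comp {_ _ _ _ u _} τ v w := hom₂_ext fun x a => by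
    change τ.τ x (a * (v.g (u.base x) * w.g (v.base (u.base x)))⁻¹) =
      1 * (τ.τ x (a * (w.g (v.base (u.base x)))⁻¹ * (v.g (u.base x))⁻¹) * 1)
    rw [mul_one, one_mul, mul_inv_rev, mul_assoc]
  whisker_assoc u v _ τ w := hom₂_ext fun x a => by
    change τ.τ (u.base x) (a * (w.g (v.base (u.base x)))⁻¹) =
      1 * (τ.τ (u.base x) (a * (w.g (v.base (u.base x)))⁻¹) * 1)
    rw [mul_one, one_mul]
  whisker_exchange {_ _ _ u v w z} σ τ := hom₂_ext fun x a => by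
    obtain rfl := σ.eq
    obtain rfl := τ.eq
    exact mul_comm _ _
  pentagon _ _ _ _ := hom₂_ext fun x a => by
    change (1 : U1) * (1 * 1) = 1 * 1
    rw [mul_one, mul_one]
  triangle _ _ := hom₂_ext fun x a => by
    change (1 : U1) * 1 = 1
    rw [mul_one]

instance : OverMfd (BTB n) where
  pobj X := X.base
  pmap u := u.base
  pmap_id _ := rfl
  pmap_comp _ _ := rfl
  pmap_eq τ := congrArg BTB.Hom.base τ.eq

end BTB
end BTB
end TDual

namespace TDual
open Mfd (Smooth U1 T)
open OverMfd

section

variable {B : Type u} [Bicategory.{w, v} B] [OverMfd B] {C : Type u₁}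

/-- A sub-bicategory of a bicategory over manifolds is again over manifolds. -/
instance SubData.overMfd (S : SubData B C) : OverMfd S.Obj where
  pobj a := pobj (S.obj a.val)
  pmap f := pmap (SubData.Hom.hom f)
  pmap_id _ := pmap_id _
  pmap_comp _ _ := pmap_comp _ _
  pmap_eq α := pmap_eq (SubData.Hom₂.hom α)

end

section F2

/-- The sub-presheaf `𝓕₂` of the presheaf of T-backgrounds: over each manifold `X` it has the single
object `(X × T^n, I)`, its 1-morphisms are those of the form `(f, id_I)`, and it has all
2-morphisms. (Compositions of identity 1-morphisms of `I` are only canonically 2-isomorphic to the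
identity; accordingly, 1-morphisms 2-isomorphic to `(f, id_I)` are included.) -/
def f2Data (n : ℕ) : SubData (TBA n) Mfd where
  obj X := ⟨trivialTB n X⟩
  mor X Y u := ∃ f : X.prod (T n) ⟶ Y.prod (T n),
    Nonempty ((SubData.Hom.hom u : triv (X.prod (T n)) ⟶ triv (Y.prod (T n))) ≅ trivMor f)
  id_mem X := ⟨𝟙 _, ⟨canIso (isStrict_id _) (isStrict_trivMor _) rfl⟩⟩
  comp_mem X Y Z u v := by
    rintro ⟨f, ⟨e⟩⟩ ⟨g, ⟨e'⟩⟩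
    exact ⟨f ≫ g, ⟨whiskerRightIso e _ ≪≫ whiskerLeftIso _ e' ≪≫
      canIso ((isStrict_trivMor f).comp (isStrict_trivMor g)) (isStrict_trivMor _) rfl⟩⟩

/-- The presheaf of bicategories `𝓕₂`. -/
abbrev F2Obj (n : ℕ) := (f2Data n).Obj

variable {n : ℕ}

/-- The bundle morphism `f_g(x, a) = (x, g(x) + a)`. -/
def bundleMor {X Y : BTB n} (u : X ⟶ Y) : X.base.prod (T n) ⟶ Y.base.prod (T n) :=
  ⟨fun p => (u.base p.1, u.g p.1 * p.2), (u.base.smooth.comp Mfd.smooth_fst).prodMk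
    (Smooth.mul_T (u.g.smooth.comp Mfd.smooth_fst) Mfd.smooth_snd)⟩

/-- The 1-morphism `(f_g, id_I)` of T-backgrounds. -/
def tbaMor {X Y : BTB n} (u : X ⟶ Y) :
    (SubData.Obj.mk (trivialTB n X.base) : TBA n) ⟶ SubData.Obj.mk (trivialTB n Y.base) :=
  SubData.Hom.mk (trivMor (bundleMor u))
    ⟨fun _ _ => Prod.ext rfl (mul_left_comm _ _ _), u.base, fun _ => rfl⟩

/-- The 1-morphism `(f_g, id_I)` of `𝓕₂`. -/
def f2Mor {X Y : BTB n} (u : X ⟶ Y) : (SubData.Obj.mk X.base : F2Obj n) ⟶ SubData.Obj.mk Y.base :=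
  SubData.Hom.mk (tbaMor u) ⟨bundleMor u, ⟨Iso.refl _⟩⟩

theorem pmap_f2Mor {X Y : BTB n} (u : X ⟶ Y) : pmap (f2Mor u) = u.base :=
  tba_cover_unique (SubData.Hom.mem (tbaMor u)).2.choose_spec fun _ => rfl

/-- The underlying gerbe 2-morphism of a 2-morphism in `𝓕₂`. -/
abbrev under {X Y : F2Obj n} {u v : X ⟶ Y} (α : u ⟶ v) :
    (SubData.Hom.hom (SubData.Hom.hom u) : triv (X.val.prod (T n)) ⟶ triv (Y.val.prod (T n))) ⟶
      SubData.Hom.hom (SubData.Hom.hom v) :=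
  SubData.Hom₂.hom (SubData.Hom₂.hom α)

theorem f2_ext {X Y : F2Obj n} {u v : X ⟶ Y} {α β : u ⟶ v} (h : under α = under β) : α = β :=
  SubData.hom₂_ext (SubData.hom₂_ext h)

theorem smooth_beta {X : Mfd} {τ : X → (T n ⟶ U1)} (hτ : FrechetSmooth τ) (g : X ⟶ T n) :
    Smooth (M := X.prod (T n)) (fun p => (τ p.1 (g p.1 * p.2))⁻¹) :=
  (((frechetSmooth_iff _).1 hτ).comp (Mfd.smooth_fst.prodMk
    (Smooth.mul_T (g.smooth.comp Mfd.smooth_fst) Mfd.smooth_snd))).inv_U1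

/-- The gerbe 2-morphism `β_τ(x, a) = -τ(x)(g(x) + a)`. -/
def beta {X Y : BTB n} {u v : X ⟶ Y} (σ : u ⟶ v) : f2Mor u ⟶ f2Mor v :=
  SubData.Hom₂.mk (SubData.Hom₂.mk (mkHom₂ (isStrict_trivMor _) (isStrict_trivMor _)
    (congrArg (fun u : X ⟶ Y => bundleMor u) σ.eq) (fun p => (σ.τ p.1 (u.g p.1 * p.2))⁻¹)
    (smooth_beta σ.smooth u.g)))

theorem under_comp {X Y : F2Obj n} {u v w : X ⟶ Y} (α : u ⟶ v) (β : v ⟶ w) :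
    under (α ≫ β) = under α ≫ under β := rfl

theorem phase_comp₃ {M N : Mfd} {u v w x : triv M ⟶ triv N} (hu : IsStrict u) (hv : IsStrict v)
    (hw : IsStrict w) (hx : IsStrict x) (α : u ⟶ v) (β : v ⟶ w) (γ : w ⟶ x) (y : M) :
    phase (α ≫ β ≫ γ) y = phase α y * (phase β y * phase γ y) := by
  rw [phase_comp hu hv hx, phase_comp hv hw hx]

theorem f2_mul_eq (g h a : T n) : g * h * a = h * (g * a) := by
  rw [mul_comm g h, mul_assoc]

theorem f2_mul_inv_eq (g h a : T n) : g * h * a * h⁻¹ = g * a := by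
  rw [mul_assoc, mul_assoc, mul_left_comm h, mul_inv_cancel, mul_one]

theorem f2_base_id (X : BTB n) : bundleMor (𝟙 X) = 𝟙 (X.base.prod (T n)) :=
  Mfd.hom_ext fun p => Prod.ext rfl (one_mul p.2)

theorem f2_base_eq {X Y Z : BTB n} (u : X ⟶ Y) (v : Y ⟶ Z) :
    bundleMor (u ≫ v) = bundleMor u ≫ bundleMor v :=
  Mfd.hom_ext fun p => Prod.ext rfl (f2_mul_eq _ _ _)

/-- The 2-functor `F₂`: it sends the single object over `X` to `(X × T^n, I)`, a smooth function
`g` to `(f_g, id_I)` with `f_g(x, a) = (x, g(x) + a)`, and `τ` to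
`β_τ(x, a) = -τ(x)(g(x) + a)`. -/
def F2Pseudo (n : ℕ) : BTB n ⥤ᵖ F2Obj n where
  obj X := ⟨X.base⟩
  map u := f2Mor u
  map₂ σ := beta σ
  map₂_id u := f2_ext (phase_ext (isStrict_trivMor _) (isStrict_trivMor _) fun y =>
    Eq.trans (inv_one (G := U1)) (phase_id (trivMor (bundleMor u)) (isStrict_trivMor _) y).symm)
  map₂_comp {_ _ u v w} σ τ := f2_ext (phase_ext (isStrict_trivMor _) (isStrict_trivMor _)
    fun y => by
      obtain rfl := σ.eq
      exact (mul_inv (σ.τ y.1 (u.g y.1 * y.2)) (τ.τ y.1 (u.g y.1 * y.2))).trans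
        (phase_comp (isStrict_trivMor _) (isStrict_trivMor _) (isStrict_trivMor _)
          (under (beta σ)) (under (beta τ)) y).symm)
  mapId X := SubData.isoMk (SubData.isoMk (canIso (isStrict_trivMor _) (isStrict_id _)
    (f2_base_id X)))
  mapComp u v := SubData.isoMk (SubData.isoMk (canIso (isStrict_trivMor _)
    ((isStrict_trivMor _).comp (isStrict_trivMor _))
    (f2_base_eq u v)))
  map₂_whisker_left {X Y Z} u v w σ := f2_ext (phase_ext (isStrict_trivMor _) (isStrict_trivMor _)
    fun y => by
      have hu := isStrict_trivMor (bundleMor u)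
      have hv := isStrict_trivMor (bundleMor v)
      have hw := isStrict_trivMor (bundleMor w)
      refine Eq.trans ?_ (phase_comp₃ (isStrict_trivMor _) (hu.comp hv) (hu.comp hw)
        (isStrict_trivMor _) _ _ _ y).symm
      refine Eq.trans ?_ (congrArg (fun c => (1 : U1) * (c * 1))
        (phase_whiskerLeft _ hu hv hw (under (beta σ)) y).symm)
      rw [mul_one, one_mul]
      exact congrArg (fun b => (σ.τ (u.base y.1) b)⁻¹) (f2_mul_eq _ _ _))
  map₂_whisker_right {X Y Z u v} σ w := f2_ext (phase_ext (isStrict_trivMor _)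
    (isStrict_trivMor _) fun y => by
      have hu := isStrict_trivMor (bundleMor u)
      have hv := isStrict_trivMor (bundleMor v)
      have hw := isStrict_trivMor (bundleMor w)
      refine Eq.trans ?_ (phase_comp₃ (isStrict_trivMor _) (hu.comp hw) (hv.comp hw)
        (isStrict_trivMor _) _ _ _ y).symm
      refine Eq.trans ?_ (congrArg (fun c => (1 : U1) * (c * 1))
        (phase_whiskerRight _ hu hv hw (under (beta σ)) y).symm)
      rw [mul_one, one_mul]
      refine congrArg (fun b => (σ.τ y.1 b)⁻¹) ?_
      exact (f2_mul_inv_eq (u.g y.1) (w.g (u.base y.1)) y.2))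
  map₂_associator {X Y Z W} u v w := f2_ext (phase_ext (isStrict_trivMor _)
    ((isStrict_trivMor _)) fun y => by
      have hu := isStrict_trivMor (bundleMor u)
      have hv := isStrict_trivMor (bundleMor v)
      have hw := isStrict_trivMor (bundleMor w)
      have huv := isStrict_trivMor (bundleMor (u ≫ v))
      have hvw := isStrict_trivMor (bundleMor (v ≫ w))
      have e1 := phase_whiskerRight (trivMor (bundleMor w)) huv (hu.comp hv) hw
        (canIso huv (hu.comp hv) (f2_base_eq u v)).hom y
      have e2 := phase_associator_hom _ _ _ hu hv hw y
      have e3 := phase_whiskerLeft (trivMor (bundleMor u)) hu (hv.comp hw) hvw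
        (canIso hvw (hv.comp hw) (f2_base_eq v w)).inv y
      refine Eq.trans ?_ (phase_comp₃ (isStrict_trivMor _) (huv.comp hw) ((hu.comp hv).comp hw)
        (isStrict_trivMor _) _ _ _ y).symm
      refine Eq.trans ?_ (congrArg (fun c => (1 : U1) * c) (congrArg₂ (· * ·) e1
        (phase_comp₃ ((hu.comp hv).comp hw) (hu.comp (hv.comp hw)) (hu.comp hvw)
          (isStrict_trivMor _) _ _ _ y))).symm
      refine Eq.trans ?_ (congrArg (fun c : U1 => (1 : U1) * (1 * c)) (congrArg₂ (· * ·) e2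
        (congrArg (· * (1 : U1)) e3))).symm
      change (1 : U1)⁻¹ = 1 * (1 * (1 * (1 * 1)))
      simp)
  map₂_left_unitor {X Y} u := f2_ext (phase_ext (isStrict_trivMor _) (isStrict_trivMor _)
    fun y => by
      have hu := isStrict_trivMor (bundleMor u)
      have h1 := isStrict_trivMor (bundleMor (𝟙 X))
      have hi := isStrict_id (X.base.prod (T n))
      have e1 := phase_whiskerRight (trivMor (bundleMor u)) h1 hi hu
        (canIso h1 hi (f2_base_id X)).hom y
      refine Eq.trans ?_ (phase_comp₃ (isStrict_trivMor _) (h1.comp hu) (hi.comp hu) hu _ _ _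
        y).symm
      refine Eq.trans ?_ (congrArg (fun c => (1 : U1) * c) (congrArg₂ (· * ·) e1
        (phase_leftUnitor_hom _ hu y))).symm
      change (1 : U1)⁻¹ = 1 * (1 * 1)
      simp)
  map₂_right_unitor {X Y} u := f2_ext (phase_ext (isStrict_trivMor _) (isStrict_trivMor _)
    fun y => by
      have hu := isStrict_trivMor (bundleMor u)
      have h1 := isStrict_trivMor (bundleMor (𝟙 Y))
      have hi := isStrict_id (Y.base.prod (T n))
      have e1 := phase_whiskerLeft (trivMor (bundleMor u)) hu h1 hi
        (canIso h1 hi (f2_base_id Y)).hom y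
      refine Eq.trans ?_ (phase_comp₃ (isStrict_trivMor _) (hu.comp h1) (hu.comp hi) hu _ _ _
        y).symm
      refine Eq.trans ?_ (congrArg (fun c => (1 : U1) * c) (congrArg₂ (· * ·) e1
        (phase_rightUnitor_hom _ hu y))).symm
      change (1 : U1)⁻¹ = 1 * (1 * 1)
      simp)

/-- The 2-functor `F₂`, over the category of manifolds. -/
def F2 (n : ℕ) : OverFunctor (BTB n) (F2Obj n) where
  functor := F2Pseudo n
  obj_eq _ := rfl
  map_eq u := (pmap_f2Mor u).trans ((Category.id_comp _).trans (Category.comp_id _)).symm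

/-- The inclusion of a sub-bicategory, over the category of manifolds. -/
def SubData.overIncl {B : Type u} [Bicategory.{w, v} B] [OverMfd B] {C : Type u₁}
    (S : SubData B C) : OverFunctor S.Obj B where
  functor := S.incl
  obj_eq _ := rfl
  map_eq _ := ((Category.id_comp _).trans (Category.comp_id _)).symm

/-- A sub-presheaf of bicategories of the presheaf of T-backgrounds which contains `𝓕₂`: it is given
by a class of objects, a class of 1-morphisms, and all 2-morphisms between these. It is a closure of
`𝓕₂` under descent, i.e., a model for the 2-stack of `F₂` T-backgrounds, if it is a 2-stack that
2-stackifies `𝓕₂`, i.e., if the inclusion `F2Extension.incl` is a 2-stackification. -/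
structure F2Extension (n : ℕ) where
  objs : Set (TBA n)
  mor : ∀ ⦃B B' : TBA n⦄, (B ⟶ B') → Prop
  id_mem : ∀ B ∈ objs, mor (𝟙 B)
  comp_mem : ∀ ⦃B B' B'' : TBA n⦄ (u : B ⟶ B') (v : B' ⟶ B''), mor u → mor v → mor (u ≫ v)
  f2_objs : ∀ X : Mfd, (f2Data n).obj X ∈ objs
  f2_mor : ∀ (X Y : Mfd) (u : (f2Data n).obj X ⟶ (f2Data n).obj Y), (f2Data n).mor X Y u → mor u

namespace F2Extension

variable (S : F2Extension n)

/-- The underlying locally full sub-bicategory. -/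
def data : SubData (TBA n) S.objs where
  obj B := B.1
  mor _ _ u := S.mor u
  id_mem B := S.id_mem _ B.2
  comp_mem _ _ _ f g := S.comp_mem f g

/-- The objects of the sub-bicategory. -/
abbrev Obj := S.data.Obj

/-- The inclusion of `𝓕₂`. -/
def incl : OverFunctor (F2Obj n) S.Obj where
  functor :=
    { obj := fun X => ⟨⟨_, S.f2_objs X.val⟩⟩
      map := fun u => SubData.Hom.mk (SubData.Hom.hom (S := f2Data n) u)
        (S.f2_mor _ _ _ (SubData.Hom.mem (S := f2Data n) u))
      map₂ := fun α => SubData.Hom₂.mk (SubData.Hom₂.hom (S := f2Data n) α)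
      map₂_id := fun _ => rfl
      map₂_comp := fun _ _ => rfl
      mapId := fun _ => Iso.refl _
      mapComp := fun _ _ => Iso.refl _
      map₂_whisker_left := fun u _ _ α =>
        SubData.hom₂_ext ((f2Data n).incl.map₂_whisker_left u α)
      map₂_whisker_right := fun α u => SubData.hom₂_ext ((f2Data n).incl.map₂_whisker_right α u)
      map₂_associator := fun u v w => SubData.hom₂_ext ((f2Data n).incl.map₂_associator u v w)
      map₂_left_unitor := fun u => SubData.hom₂_ext ((f2Data n).incl.map₂_left_unitor u)
      map₂_right_unitor := fun u => SubData.hom₂_ext ((f2Data n).incl.map₂_right_unitor u) }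
  obj_eq _ := rfl
  map_eq _ := ((Category.id_comp _).trans (Category.comp_id _)).symm

end F2Extension

end F2
end TDual

end

-- A 2-stackification is determined up to equivalence by its universal property, so everything rests
-- on one fact: `F2 n` is already an equivalence before any stackification (`f2_isEquiv`). Then `F2
-- n` followed by the inclusion of `𝓕₂` inherits what is needed of the universal property of that
-- inclusion, and two solutions of the same universal problem are equivalent. No geometry of descent
-- is used: open covers and gluing enter only through the two hypotheses that the given maps are
-- 2-stackifications.
--
-- Why `F2 n` is an equivalence. Both sides have exactly one object over each manifold. On
-- 1-morphisms, an equivariant map `X × T^n → Y × T^n` covering `φ` is determined by its values at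
-- the points `(x, 1)`; writing them as `(φ x, g x)` identifies the map with `f_g` along `φ`
-- (`exists_f2Mor_iso`). On 2-morphisms, a 2-morphism from `(f_g, id)` to `(f_h, id)` forces `f_g =
-- f_h`, hence `g = h`, and is a smooth `U(1)`-valued function `c` on `X × T^n`. The equation `β_τ =
-- c` has the unique solution `τ(x)(a) = -c(x, a - g(x))`, which is smooth as a map into the Fréchet
-- Lie group because it is jointly smooth, by `frechetSmooth_iff` (`beta_bijective`).
--
-- The rest is bicategorical. A pseudofunctor that is bijective on objects and locally an
-- equivalence has an inverse, obtained by choosing preimages of 1-morphisms together with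
-- comparison isomorphisms. Every coherence law of the inverse can be tested after applying the
-- original functor, which is injective on 2-morphisms (`LocalInverse`). The two composites agree
-- with identities on objects, so they are compared by icons, that is, transformations with identity
-- components (`InvIcon`). Indexing pseudofunctors by their object map (`PseudoOn`) lets such
-- components be written without transport along equalities of objects.
--
-- Finally, equivalences between morphisms of presheaves are preserved by composition on either side
-- (`postcomp_equivalence`, `precomp_equivalence`), and are reflected by restriction along an
-- orthogonal map (`IsOrthogonal.equivalence`) or along an equivalence
-- (`OverFunctor.IsEquiv.equivalence`). The usual uniqueness argument for universal objects then
-- applies.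

universe w₄ v₄ u₄

noncomputable section

namespace TDual
open OverMfd
open scoped Pseudofunctor.StrongTrans

/-! ### Composition of transformations with pseudofunctors -/

section Whiskering

variable {A : Type u₁} [Bicategory.{w₁, v₁} A] {B : Type u₂} [Bicategory.{w₂, v₂} B]
variable {Z : Type u₃} [Bicategory.{w₃, v₃} Z]

/-- This and the next three lemmas are the naturality squares of the compositor of `H`, in its
second and then its first argument. They are oriented so that a 2-cell outside the compositor can be
pulled under a single `H.map₂`, where the axioms of a transformation apply. -/
theorem mapComp_hom_whiskerLeft (H : B ⥤ᵖ Z) {a b c : B} (f : a ⟶ b) {g h : b ⟶ c} (η : g ⟶ h) :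
    (H.mapComp f g).hom ≫ H.map f ◁ H.map₂ η = H.map₂ (f ◁ η) ≫ (H.mapComp f h).hom := by
  simp

theorem mapComp_inv_whiskerLeft (H : B ⥤ᵖ Z) {a b c : B} (f : a ⟶ b) {g h : b ⟶ c} (η : g ⟶ h) :
    H.map f ◁ H.map₂ η ≫ (H.mapComp f h).inv = (H.mapComp f g).inv ≫ H.map₂ (f ◁ η) := by
  simp

theorem mapComp_hom_whiskerRight (H : B ⥤ᵖ Z) {a b c : B} {f g : a ⟶ b} (η : f ⟶ g) (h : b ⟶ c) :
    (H.mapComp f h).hom ≫ H.map₂ η ▷ H.map h = H.map₂ (η ▷ h) ≫ (H.mapComp g h).hom := by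
  simp

theorem mapComp_inv_whiskerRight (H : B ⥤ᵖ Z) {a b c : B} {f g : a ⟶ b} (η : f ⟶ g) (h : b ⟶ c) :
    H.map₂ η ▷ H.map h ≫ (H.mapComp g h).inv = (H.mapComp f h).inv ≫ H.map₂ (η ▷ h) := by
  simp

/-- The pseudofunctor axiom speaks of the forward associator only. Read as an equality of
isomorphisms, it can be inverted on both sides; the two unitor lemmas below are obtained in the same
way. -/
theorem map₂_associator_inv (H : B ⥤ᵖ Z) {a b c d : B} (f : a ⟶ b) (g : b ⟶ c) (h : c ⟶ d) :
    H.map₂ (α_ f g h).inv = (H.mapComp f (g ≫ h)).hom ≫ H.map f ◁ (H.mapComp g h).hom ≫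
      (α_ (H.map f) (H.map g) (H.map h)).inv ≫ (H.mapComp f g).inv ▷ H.map h ≫
      (H.mapComp (f ≫ g) h).inv := by
  have e : H.map₂Iso (α_ f g h) = H.mapComp (f ≫ g) h ≪≫ whiskerRightIso (H.mapComp f g) (H.map h) ≪≫
      α_ (H.map f) (H.map g) (H.map h) ≪≫ whiskerLeftIso (H.map f) (H.mapComp g h).symm ≪≫
      (H.mapComp f (g ≫ h)).symm := Iso.ext (H.map₂_associator f g h)
  simpa using congrArg Iso.inv e

theorem map₂_leftUnitor_inv (H : B ⥤ᵖ Z) {a b : B} (f : a ⟶ b) :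
    H.map₂ (λ_ f).inv = (λ_ (H.map f)).inv ≫ (H.mapId a).inv ▷ H.map f ≫
      (H.mapComp (𝟙 a) f).inv := by
  have e : H.map₂Iso (λ_ f) = H.mapComp (𝟙 a) f ≪≫ whiskerRightIso (H.mapId a) (H.map f) ≪≫
      λ_ (H.map f) := Iso.ext (H.map₂_left_unitor f)
  simpa using congrArg Iso.inv e

theorem map₂_rightUnitor_inv (H : B ⥤ᵖ Z) {a b : B} (f : a ⟶ b) :
    H.map₂ (ρ_ f).inv = (ρ_ (H.map f)).inv ≫ H.map f ◁ (H.mapId b).inv ≫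
      (H.mapComp f (𝟙 b)).inv := by
  have e : H.map₂Iso (ρ_ f) = H.mapComp f (𝟙 b) ≪≫ whiskerLeftIso (H.map f) (H.mapId b) ≪≫
      ρ_ (H.map f) := Iso.ext (H.map₂_right_unitor f)
  simpa using congrArg Iso.inv e

/-- Postcomposition of a strong transformation with a pseudofunctor. -/
def postcompTrans {F G : A ⥤ᵖ B} (σ : F ⟶ G) (H : B ⥤ᵖ Z) : F.comp H ⟶ G.comp H where
  app a := H.map (σ.app a)
  naturality {a b} f := (H.mapComp (F.map f) (σ.app b)).symm ≪≫ H.map₂Iso (σ.naturality f) ≪≫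
    H.mapComp (σ.app a) (G.map f)
  naturality_naturality {a b f g} η := by
    change H.map₂ (F.map₂ η) ▷ H.map (σ.app b) ≫ (H.mapComp (F.map g) (σ.app b)).inv ≫
      H.map₂ (σ.naturality g).hom ≫ (H.mapComp (σ.app a) (G.map g)).hom =
      ((H.mapComp (F.map f) (σ.app b)).inv ≫ H.map₂ (σ.naturality f).hom ≫
        (H.mapComp (σ.app a) (G.map f)).hom) ≫ H.map (σ.app a) ◁ H.map₂ (G.map₂ η)
    -- On the right-hand side the 2-cell coming from `G` is moved through the compositor, so that
    -- the naturality square of `σ` appears under one `H.map₂`. After applying it, the 2-cell coming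
    -- from `F` is moved through the compositor on the left-hand side.
    rw [Category.assoc, Category.assoc, mapComp_hom_whiskerLeft, ← H.map₂_comp_assoc,
      ← σ.naturality_naturality, ← Category.assoc, mapComp_inv_whiskerRight, H.map₂_comp]
    simp only [Category.assoc]
  naturality_id a := by
    change ((H.mapComp (F.map (𝟙 a)) (σ.app a)).inv ≫ H.map₂ (σ.naturality (𝟙 a)).hom ≫
      (H.mapComp (σ.app a) (G.map (𝟙 a))).hom) ≫
      H.map (σ.app a) ◁ (H.map₂ (G.mapId a).hom ≫ (H.mapId (G.obj a)).hom) =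
      (H.map₂ (F.mapId a).hom ≫ (H.mapId (F.obj a)).hom) ▷ H.map (σ.app a) ≫
      (λ_ (H.map (σ.app a))).hom ≫ (ρ_ (H.map (σ.app a))).inv
    rw [Bicategory.whiskerLeft_comp, Category.assoc, Category.assoc,
      ← Category.assoc (H.mapComp _ _).hom, mapComp_hom_whiskerLeft, Category.assoc, ← H.map₂_comp_assoc, σ.naturality_id]
    -- The unit law of `σ` has produced `H.map₂` of an inverse right unitor. Expanding it gives a
    -- compositor and `H.mapId`, which cancel against those already present.
    simp [map₂_rightUnitor_inv, ← Bicategory.whiskerLeft_comp]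
  naturality_comp {a b c} f g := by
    change ((H.mapComp (F.map (f ≫ g)) (σ.app c)).inv ≫ H.map₂ (σ.naturality (f ≫ g)).hom ≫
      (H.mapComp (σ.app a) (G.map (f ≫ g))).hom) ≫
      H.map (σ.app a) ◁ (H.map₂ (G.mapComp f g).hom ≫ (H.mapComp (G.map f) (G.map g)).hom) =
      (H.map₂ (F.mapComp f g).hom ≫ (H.mapComp (F.map f) (F.map g)).hom) ▷ H.map (σ.app c) ≫
      (α_ _ _ _).hom ≫ H.map (F.map f) ◁ ((H.mapComp (F.map g) (σ.app c)).inv ≫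
        H.map₂ (σ.naturality g).hom ≫ (H.mapComp (σ.app b) (G.map g)).hom) ≫ (α_ _ _ _).inv ≫
        ((H.mapComp (F.map f) (σ.app b)).inv ≫ H.map₂ (σ.naturality f).hom ≫
          (H.mapComp (σ.app a) (G.map f)).hom) ▷ H.map (G.map g) ≫ (α_ _ _ _).hom
    rw [Bicategory.whiskerLeft_comp, Category.assoc, Category.assoc,
      ← Category.assoc (H.mapComp _ _).hom, mapComp_hom_whiskerLeft, Category.assoc, ← H.map₂_comp_assoc, σ.naturality_comp]
    simp [map₂_associator_inv]

/-- The components of an isomorphism of strong transformations. -/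
def transIsoApp {F G : A ⥤ᵖ B} {σ τ : F ⟶ G} (m : σ ≅ τ) (a : A) : σ.app a ≅ τ.app a where
  hom := m.hom.as.app a
  inv := m.inv.as.app a
  hom_inv_id := congrArg (fun x : σ ⟶ σ => x.as.app a) m.hom_inv_id
  inv_hom_id := congrArg (fun x : τ ⟶ τ => x.as.app a) m.inv_hom_id

/-- Postcomposition of an invertible modification with a pseudofunctor. -/
def postcompTransIso {F G : A ⥤ᵖ B} {σ τ : F ⟶ G} (m : σ ≅ τ) (H : B ⥤ᵖ Z) :
    postcompTrans σ H ≅ postcompTrans τ H :=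
  Pseudofunctor.StrongTrans.isoMk (fun a => H.map₂Iso (transIsoApp m a)) fun {a b} f => by
    change H.map (F.map f) ◁ H.map₂ (m.hom.as.app b) ≫ (H.mapComp _ (τ.app b)).inv ≫
      H.map₂ (τ.naturality f).hom ≫ (H.mapComp (τ.app a) _).hom =
      ((H.mapComp _ (σ.app b)).inv ≫ H.map₂ (σ.naturality f).hom ≫
        (H.mapComp (σ.app a) _).hom) ≫ H.map₂ (m.hom.as.app a) ▷ H.map (G.map f)
    -- The same pattern as for naturality: gather everything under `H.map₂`, use the modification
    -- square of `m` there, and distribute again.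
    rw [Category.assoc, Category.assoc, mapComp_hom_whiskerRight, ← H.map₂_comp_assoc,
      ← m.hom.as.naturality, ← Category.assoc, mapComp_inv_whiskerLeft, H.map₂_comp]
    simp only [Category.assoc]

/-- Postcomposition with a pseudofunctor preserves identities. -/
def postcompTransId (F : A ⥤ᵖ B) (H : B ⥤ᵖ Z) : postcompTrans (𝟙 F) H ≅ 𝟙 (F.comp H) :=
  Pseudofunctor.StrongTrans.isoMk (fun a => H.mapId (F.obj a)) fun {a b} f => by
    change H.map (F.map f) ◁ (H.mapId (F.obj b)).hom ≫ (ρ_ (H.map (F.map f))).hom ≫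
      (λ_ (H.map (F.map f))).inv = ((H.mapComp (F.map f) (𝟙 (F.obj b))).inv ≫
        H.map₂ ((ρ_ (F.map f)).hom ≫ (λ_ (F.map f)).inv) ≫
        (H.mapComp (𝟙 (F.obj a)) (F.map f)).hom) ≫ (H.mapId (F.obj a)).hom ▷ _
    -- The images of the two unitors of `F.map f` expand into unitors in `Z`, compositors and
    -- `H.mapId`; the compositors cancel, and so does `H.mapId` at the source of `f`.
    simp [map₂_leftUnitor_inv, ← comp_whiskerRight]

/-- Postcomposition with a pseudofunctor preserves composition. -/
def postcompTransComp {F G K : A ⥤ᵖ B} (σ : F ⟶ G) (τ : G ⟶ K) (H : B ⥤ᵖ Z) :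
    postcompTrans (σ ≫ τ) H ≅ postcompTrans σ H ≫ postcompTrans τ H :=
  Pseudofunctor.StrongTrans.isoMk (fun a => H.mapComp (σ.app a) (τ.app a)) fun {a b} f => by
    change H.map (F.map f) ◁ (H.mapComp (σ.app b) (τ.app b)).hom ≫
      (α_ _ _ _).inv ≫ ((H.mapComp _ (σ.app b)).inv ≫ H.map₂ (σ.naturality f).hom ≫
        (H.mapComp (σ.app a) _).hom) ▷ _ ≫ (α_ _ _ _).hom ≫
      _ ◁ ((H.mapComp _ (τ.app b)).inv ≫ H.map₂ (τ.naturality f).hom ≫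
        (H.mapComp (τ.app a) _).hom) ≫ (α_ _ _ _).inv =
      ((H.mapComp _ (σ.app b ≫ τ.app b)).inv ≫ H.map₂ ((α_ _ _ _).inv ≫
        (σ.naturality f).hom ▷ τ.app b ≫ (α_ _ _ _).hom ≫ σ.app a ◁ (τ.naturality f).hom ≫
        (α_ _ _ _).inv) ≫ (H.mapComp (σ.app a ≫ τ.app a) _).hom) ≫
      (H.mapComp (σ.app a) (τ.app a)).hom ▷ _
    simp [map₂_associator_inv, ← comp_whiskerRight]
    simp only [comp_whiskerRight, Category.assoc]

variable [OverMfd A] [OverMfd B] [OverMfd Z]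

/-- This is what keeps postcomposition inside `HomOver`: since `H` commutes with the projections to
manifolds up to `eqToHom`, it sends vertical components to vertical components. -/
theorem pmap_map_eqToHom (H : OverFunctor B Z) {a b : B} (f : a ⟶ b) (h : pobj a = pobj b)
    (hf : pmap f = eqToHom h) : pmap (H.functor.map f) =
      eqToHom ((H.obj_eq a).trans (h.trans (H.obj_eq b).symm)) := by
  rw [H.map_eq, hf, eqToHom_trans, eqToHom_trans]

/-- The isomorphism in the ambient bicategory underlying an isomorphism in a locally full
sub-bicategory. -/
def underIso {B : Type u} [Bicategory.{w, v} B] {C : Type u₁} {S : SubData B C} {a b : S.Obj}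
    {f g : a ⟶ b} (m : f ≅ g) : SubData.Hom.hom f ≅ SubData.Hom.hom g where
  hom := SubData.Hom₂.hom m.hom
  inv := SubData.Hom₂.hom m.inv
  hom_inv_id := congrArg (fun x : f ⟶ f => SubData.Hom₂.hom x) m.hom_inv_id
  inv_hom_id := congrArg (fun x : g ⟶ g => SubData.Hom₂.hom x) m.inv_hom_id

/-- Postcomposition with `H`, on strong transformations over the category of manifolds. -/
def postcomp (H : OverFunctor B Z) {F G : HomOver A B} (σ : F ⟶ G) :
    (F.val.comp H).toObj ⟶ (G.val.comp H).toObj :=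
  SubData.Hom.mk (postcompTrans (SubData.Hom.hom σ) H.functor) fun a => 
    pmap_map_eqToHom H _ _ (SubData.Hom.mem σ a)

/-- Postcomposition with `H`, on invertible modifications. -/
def postcompIso (H : OverFunctor B Z) {F G : HomOver A B} {σ τ : F ⟶ G} (m : σ ≅ τ) :
    postcomp H σ ≅ postcomp H τ :=
  SubData.isoMk (postcompTransIso (underIso m) H.functor)

/-- Postcomposition with `H` preserves identities. -/
def postcompId (H : OverFunctor B Z) (F : HomOver A B) :
    postcomp H (𝟙 F) ≅ 𝟙 (F.val.comp H).toObj :=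
  SubData.isoMk (postcompTransId F.val.functor H.functor)

/-- Postcomposition with `H` preserves composition. -/
def postcompComp (H : OverFunctor B Z) {F G K : HomOver A B} (σ : F ⟶ G) (τ : G ⟶ K) :
    postcomp H (σ ≫ τ) ≅ postcomp H σ ≫ postcomp H τ :=
  SubData.isoMk (postcompTransComp (SubData.Hom.hom σ) (SubData.Hom.hom τ) H.functor)

/-- Postcomposition preserves identities, composition and 2-isomorphisms up to isomorphism, hence
transports a unit and a counit. The triangle identities need not be transported, because
`mkOfAdjointifyCounit` replaces the counit by one that satisfies them. -/
theorem postcomp_equivalence (H : OverFunctor B Z) {F G : OverFunctor A B}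
    (h : Nonempty (F.toObj ≌ G.toObj)) : Nonempty ((F.comp H).toObj ≌ (G.comp H).toObj) := by
  obtain ⟨e⟩ := h
  exact ⟨Bicategory.Equivalence.mkOfAdjointifyCounit
    ((postcompId H _).symm ≪≫ postcompIso H e.unit ≪≫ postcompComp H e.hom e.inv)
    ((postcompComp H e.inv e.hom).symm ≪≫ postcompIso H e.counit ≪≫ postcompId H _)⟩

/-- Unlike postcomposition, precomposition preserves identities and composition of transformations
on the nose, so the images of the unit and counit have the required types without any comparison
isomorphism. -/
theorem precomp_equivalence (k : OverFunctor A B) {F G : OverFunctor B Z}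
    (h : Nonempty (F.toObj ≌ G.toObj)) : Nonempty ((k.comp F).toObj ≌ (k.comp G).toObj) := by
  obtain ⟨e⟩ := h
  exact ⟨Bicategory.Equivalence.mkOfAdjointifyCounit
    (f := (precomp k _ _).obj e.hom) (g := (precomp k _ _).obj e.inv)
    ((precomp k F.toObj F.toObj).mapIso e.unit) ((precomp k G.toObj G.toObj).mapIso e.counit)⟩

/-- Restriction along `k` is an equivalence on the categories of transformations. Essential
surjectivity there lifts the two 1-morphisms of an equivalence, and full faithfulness lifts its unit
and counit. This is the uniqueness half of the universal property. -/
theorem IsOrthogonal.equivalence {k : OverFunctor A B} (hk : IsOrthogonal k Z)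
    {F G : OverFunctor B Z} (h : Nonempty ((k.comp F).toObj ≌ (k.comp G).toObj)) :
    Nonempty (F.toObj ≌ G.toObj) := by
  obtain ⟨e⟩ := h
  have := hk.2
  let s := (precomp k F.toObj G.toObj).objPreimage e.hom
  let t := (precomp k G.toObj F.toObj).objPreimage e.inv
  let i : (precomp k F.toObj G.toObj).obj s ≅ e.hom := (precomp k F.toObj G.toObj).objObjPreimageIso e.hom
  let j : (precomp k G.toObj F.toObj).obj t ≅ e.inv := (precomp k G.toObj F.toObj).objObjPreimageIso e.inv
  exact ⟨Bicategory.Equivalence.mkOfAdjointifyCounit (f := s) (g := t)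
    -- The restriction of `s ≫ t` is definitionally the composite of the restrictions of `s` and
    -- `t`, so whiskering with `i` and `j` turns the unit of `e` into an isomorphism between
    -- restricted transformations, which then lifts.
    ((precomp k F.toObj F.toObj).preimageIso
      (e.unit ≪≫ whiskerRightIso i.symm _ ≪≫ whiskerLeftIso _ j.symm))
    ((precomp k G.toObj G.toObj).preimageIso
      (show (precomp k G.toObj F.toObj).obj t ≫ (precomp k F.toObj G.toObj).obj s ≅ 𝟙 _ from
        whiskerRightIso j _ ≪≫ whiskerLeftIso _ i ≪≫ e.counit))⟩

end Whiskering
end TDual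

namespace TDual
open OverMfd
open scoped Pseudofunctor.StrongTrans

/-! ### Icons, and the unit and associativity laws for composition over manifolds -/

section Icon

variable {A : Type u₁} [Bicategory.{w₁, v₁} A] {B : Type u₂} [Bicategory.{w₂, v₂} B]

/-- A pseudofunctor with prescribed action on objects. -/
structure PseudoOn (p : A → B) where
  map : ∀ {a b : A}, (a ⟶ b) → (p a ⟶ p b)
  map₂ : ∀ {a b : A} {f g : a ⟶ b}, (f ⟶ g) → (map f ⟶ map g)
  map₂_id : ∀ {a b : A} (f : a ⟶ b), map₂ (𝟙 f) = 𝟙 (map f)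
  map₂_comp : ∀ {a b : A} {f g h : a ⟶ b} (η : f ⟶ g) (θ : g ⟶ h),
    map₂ (η ≫ θ) = map₂ η ≫ map₂ θ
  mapId : ∀ a, map (𝟙 a) ≅ 𝟙 (p a)
  mapComp : ∀ {a b c : A} (f : a ⟶ b) (g : b ⟶ c), map (f ≫ g) ≅ map f ≫ map g
  map₂_whisker_left : ∀ {a b c : A} (f : a ⟶ b) {g h : b ⟶ c} (η : g ⟶ h),
    map₂ (f ◁ η) = (mapComp f g).hom ≫ map f ◁ map₂ η ≫ (mapComp f h).inv
  map₂_whisker_right : ∀ {a b c : A} {f g : a ⟶ b} (η : f ⟶ g) (h : b ⟶ c),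
    map₂ (η ▷ h) = (mapComp f h).hom ≫ map₂ η ▷ map h ≫ (mapComp g h).inv
  map₂_associator : ∀ {a b c d : A} (f : a ⟶ b) (g : b ⟶ c) (h : c ⟶ d),
    map₂ (α_ f g h).hom = (mapComp (f ≫ g) h).hom ≫ (mapComp f g).hom ▷ map h ≫
      (α_ (map f) (map g) (map h)).hom ≫ map f ◁ (mapComp g h).inv ≫ (mapComp f (g ≫ h)).inv
  map₂_left_unitor : ∀ {a b : A} (f : a ⟶ b),
    map₂ (λ_ f).hom = (mapComp (𝟙 a) f).hom ≫ (mapId a).hom ▷ map f ≫ (λ_ (map f)).hom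
  map₂_right_unitor : ∀ {a b : A} (f : a ⟶ b),
    map₂ (ρ_ f).hom = (mapComp f (𝟙 b)).hom ≫ map f ◁ (mapId b).hom ≫ (ρ_ (map f)).hom

namespace PseudoOn

/-- The underlying pseudofunctor. -/
abbrev toPseudofunctor {p : A → B} (F : PseudoOn p) : A ⥤ᵖ B where
  obj := p
  map := F.map
  map₂ := F.map₂
  map₂_id := F.map₂_id
  map₂_comp := F.map₂_comp
  mapId := F.mapId
  mapComp := F.mapComp
  map₂_whisker_left := F.map₂_whisker_left
  map₂_whisker_right := F.map₂_whisker_right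
  map₂_associator := F.map₂_associator
  map₂_left_unitor := F.map₂_left_unitor
  map₂_right_unitor := F.map₂_right_unitor

/-- A pseudofunctor, as a pseudofunctor with prescribed action on objects. -/
abbrev of (F : A ⥤ᵖ B) : PseudoOn F.obj where
  map := F.map
  map₂ := F.map₂
  map₂_id := F.map₂_id
  map₂_comp := F.map₂_comp
  mapId := F.mapId
  mapComp := F.mapComp
  map₂_whisker_left := F.map₂_whisker_left
  map₂_whisker_right := F.map₂_whisker_right
  map₂_associator := F.map₂_associator
  map₂_left_unitor := F.map₂_left_unitor
  map₂_right_unitor := F.map₂_right_unitor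

end PseudoOn

/-- An invertible icon: compatible isomorphisms between the values on 1-morphisms of two
pseudofunctors with the same action on objects. -/
structure InvIcon {p : A → B} (F G : PseudoOn p) where
  iso : ∀ {a b : A} (f : a ⟶ b), F.map f ≅ G.map f
  naturality : ∀ {a b : A} {f g : a ⟶ b} (η : f ⟶ g),
    F.map₂ η ≫ (iso g).hom = (iso f).hom ≫ G.map₂ η
  id : ∀ a, (iso (𝟙 a)).hom ≫ (G.mapId a).hom = (F.mapId a).hom
  comp : ∀ {a b c : A} (f : a ⟶ b) (g : b ⟶ c),
    (iso (f ≫ g)).hom ≫ (G.mapComp f g).hom =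
      (F.mapComp f g).hom ≫ (iso f).hom ▷ F.map g ≫ G.map f ◁ (iso g).hom

namespace InvIcon

variable {p : A → B} {F G : PseudoOn p}

/-- The inverse icon. -/
def symm (i : InvIcon F G) : InvIcon G F where
  iso f := (i.iso f).symm
  naturality {a b f g} η := by
    rw [Iso.symm_hom, Iso.symm_hom, Iso.eq_inv_comp, ← Category.assoc, ← i.naturality,
      Category.assoc, Iso.hom_inv_id, Category.comp_id]
  id a := by rw [← i.id, Iso.symm_hom, Iso.inv_hom_id_assoc]
  comp f g := by
    rw [Iso.symm_hom, Iso.inv_comp_eq, ← Category.assoc, i.comp]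
    simp [whisker_exchange_assoc]

/-- The strong transformation with identity components given by an icon. -/
def strongTrans (i : InvIcon F G) : F.toPseudofunctor ⟶ G.toPseudofunctor where
  app a := 𝟙 (p a)
  naturality f := ρ_ _ ≪≫ i.iso f ≪≫ (λ_ _).symm
  naturality_naturality {a b f g} η := by
    change F.map₂ η ▷ 𝟙 _ ≫ (ρ_ _).hom ≫ (i.iso g).hom ≫ (λ_ _).inv =
      ((ρ_ _).hom ≫ (i.iso f).hom ≫ (λ_ _).inv) ≫ 𝟙 _ ◁ G.map₂ η
    rw [rightUnitor_naturality_assoc, ← Category.assoc (F.map₂ η), i.naturality]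
    simp
  naturality_id a := by
    change ((ρ_ _).hom ≫ (i.iso (𝟙 a)).hom ≫ (λ_ _).inv) ≫ 𝟙 _ ◁ (G.mapId a).hom =
      (F.mapId a).hom ▷ 𝟙 _ ≫ (λ_ _).hom ≫ (ρ_ _).inv
    rw [← i.id]
    simp [unitors_equal, unitors_inv_equal]
  naturality_comp {a b c} f g := by
    change ((ρ_ _).hom ≫ (i.iso (f ≫ g)).hom ≫ (λ_ _).inv) ≫ 𝟙 _ ◁ (G.mapComp f g).hom =
      (F.mapComp f g).hom ▷ 𝟙 _ ≫ (α_ _ _ _).hom ≫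
        F.map f ◁ ((ρ_ _).hom ≫ (i.iso g).hom ≫ (λ_ _).inv) ≫ (α_ _ _ _).inv ≫
        ((ρ_ _).hom ≫ (i.iso f).hom ≫ (λ_ _).inv) ▷ G.map g ≫ (α_ _ _ _).hom
    -- The icon law replaces the first factor before the second, whereas the composition law of a
    -- strong transformation starts with the second factor. The exchange law makes the two orders
    -- agree.
    have h : (i.iso (f ≫ g)).hom ≫ (G.mapComp f g).hom =
      (F.mapComp f g).hom ≫ F.map f ◁ (i.iso g).hom ≫ (i.iso f).hom ▷ G.map g := by
      rw [i.comp, whisker_exchange]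
    have h' : ((ρ_ _).hom ≫ (i.iso (f ≫ g)).hom ≫ (λ_ _).inv) ≫ 𝟙 _ ◁ (G.mapComp f g).hom =
        (ρ_ _).hom ≫ ((i.iso (f ≫ g)).hom ≫ (G.mapComp f g).hom) ≫ (λ_ _).inv := by simp
    rw [h', h]
    simp

variable [OverMfd A] [OverMfd B]

/-- An invertible icon induces an equivalence. -/
theorem equivalence (i : InvIcon F G) (hF hF' hG hG') :
    Nonempty ((⟨F.toPseudofunctor, hF, hF'⟩ : OverFunctor A B).toObj ≌
      (⟨G.toPseudofunctor, hG, hG'⟩ : OverFunctor A B).toObj) :=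
  ⟨Bicategory.Equivalence.mkOfAdjointifyCounit
    -- The components are identities and the two object maps coincide, so the `eqToHom` in the
    -- verticality condition is definitionally an identity and `pmap_id` settles it.
    (f := SubData.Hom.mk i.strongTrans fun _ => pmap_id _)
    (g := SubData.Hom.mk i.symm.strongTrans fun _ => pmap_id _)
    (SubData.isoMk (Pseudofunctor.StrongTrans.isoMk (fun a => (λ_ (𝟙 (p a))).symm)
      fun {a b} f => by
        change F.map f ◁ (λ_ (𝟙 (p b))).inv ≫ (α_ _ _ _).inv ≫
          ((ρ_ _).hom ≫ (i.iso f).hom ≫ (λ_ _).inv) ▷ 𝟙 _ ≫ (α_ _ _ _).hom ≫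
          𝟙 _ ◁ ((ρ_ _).hom ≫ (i.iso f).inv ≫ (λ_ _).inv) ≫ (α_ _ _ _).inv =
          ((ρ_ _).hom ≫ (λ_ _).inv) ≫ (λ_ (𝟙 (p a))).inv ▷ F.map f
        -- The unit and counit have unitors of the unit 1-morphism as components. The left and right
        -- unitors coincide there, which is the one fact needed beyond the standard coherence
        -- rewriting.
        simp [unitors_inv_equal]
        rw [← unitors_inv_equal, leftUnitor_inv_whiskerRight]))
    (SubData.isoMk (Pseudofunctor.StrongTrans.isoMk (fun a => λ_ (𝟙 (p a)))
      fun {a b} f => by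
        change G.map f ◁ (λ_ (𝟙 (p b))).hom ≫ (ρ_ _).hom ≫ (λ_ _).inv =
          ((α_ _ _ _).inv ≫
          ((ρ_ _).hom ≫ (i.iso f).inv ≫ (λ_ _).inv) ▷ 𝟙 _ ≫ (α_ _ _ _).hom ≫
          𝟙 _ ◁ ((ρ_ _).hom ≫ (i.iso f).hom ≫ (λ_ _).inv) ≫ (α_ _ _ _).inv) ≫
           (λ_ (𝟙 (p a))).hom ▷ G.map f
        simp [unitors_equal]))⟩

end InvIcon

end Icon

/-- For an icon whose components are all identities, the composition law collapses to the equality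
of the two compositors; this puts that equality into the shape demanded by `InvIcon.comp`. -/
theorem id_comp_eq_comp_whisker {B : Type u} [Bicategory.{w, v} B] {a b c : B} {f : a ⟶ c}
    {g : a ⟶ b} {h : b ⟶ c} {x y : f ⟶ g ≫ h} (e : x = y) :
    𝟙 f ≫ x = y ≫ 𝟙 g ▷ h ≫ g ◁ 𝟙 h := by
  simp [e]

namespace OverFunctor

variable {A : Type u₁} [Bicategory.{w₁, v₁} A] [OverMfd A]
variable {B : Type u₂} [Bicategory.{w₂, v₂} B] [OverMfd B]
variable {C : Type u₃} [Bicategory.{w₃, v₃} C] [OverMfd C]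
variable {D : Type u₄} [Bicategory.{w₄, v₄} D] [OverMfd D]

/-- The two bracketings agree strictly on objects, 1-morphisms and 2-morphisms. Their unit and
composition constraints differ only in whether `H` is applied to a composite of 2-cells or to each
factor, so an icon with identity components compares them. -/
theorem comp_assoc_equivalence (F : OverFunctor A B) (G : OverFunctor B C) (H : OverFunctor C D) :
    Nonempty (((F.comp G).comp H).toObj ≌ (F.comp (G.comp H)).toObj) :=
  InvIcon.equivalence (F := PseudoOn.of ((F.comp G).comp H).functor)
    (G := PseudoOn.of (F.comp (G.comp H)).functor)
    { iso := fun f => Iso.refl _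
      naturality := fun η => (Category.comp_id _).trans (Category.id_comp _).symm
      id := fun a => by
        refine (Category.id_comp _).trans ?_
        exact ((congrArg (· ≫ _) (H.functor.map₂_comp _ _)).trans (Category.assoc _ _ _)).symm
      comp := fun f g => by
        refine id_comp_eq_comp_whisker ?_
        exact ((congrArg (· ≫ _) (H.functor.map₂_comp _ _)).trans (Category.assoc _ _ _)).symm } _ _ _ _

theorem comp_id_equivalence (F : OverFunctor A B) :
    Nonempty ((F.comp (OverFunctor.id B)).toObj ≌ F.toObj) :=
  InvIcon.equivalence (F := PseudoOn.of (F.comp (OverFunctor.id B)).functor)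
    (G := PseudoOn.of F.functor)
    { iso := fun f => Iso.refl _
      naturality := fun η => (Category.comp_id _).trans (Category.id_comp _).symm
      id := fun a => by
        exact (Category.id_comp _).trans (Category.comp_id _).symm
      comp := fun f g => by
        exact id_comp_eq_comp_whisker (Category.comp_id _).symm } _ _ _ _

/-- The only discrepancy is that `F` is applied to the identity constraints of the identity
pseudofunctor, which functoriality on 2-morphisms removes. -/
theorem id_comp_equivalence (F : OverFunctor A B) :
    Nonempty (((OverFunctor.id A).comp F).toObj ≌ F.toObj) :=
  InvIcon.equivalence (F := PseudoOn.of ((OverFunctor.id A).comp F).functor)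
    (G := PseudoOn.of F.functor)
    { iso := fun f => Iso.refl _
      naturality := fun η => (Category.comp_id _).trans (Category.id_comp _).symm
      id := fun a => by
        refine (Category.id_comp _).trans ?_
        exact ((congrArg (· ≫ _) (F.functor.map₂_id _)).trans (Category.id_comp _)).symm
      comp := fun f g => by
        refine id_comp_eq_comp_whisker ?_
        exact ((congrArg (· ≫ _) (F.functor.map₂_id _)).trans (Category.id_comp _)).symm } _ _ _ _

end OverFunctor
end TDual

namespace TDual
open OverMfd

/-! ### Inverting a pseudofunctor that is locally an equivalence -/

section LocalInverse

variable {A : Type u₁} [Bicategory.{w₁, v₁} A] {B : Type u₂} [Bicategory.{w₂, v₂} B]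

/-- A choice of local inverses of a pseudofunctor, on 1-morphisms and on 2-morphisms. -/
structure LocalInverse (F : A ⥤ᵖ B) where
  map : ∀ {a b : A}, (F.obj a ⟶ F.obj b) → (a ⟶ b)
  iso : ∀ {a b : A} (u : F.obj a ⟶ F.obj b), F.map (map u) ≅ u
  bijective : ∀ {a b : A} (f g : a ⟶ b), Function.Bijective fun η : f ⟶ g => F.map₂ η

namespace LocalInverse

variable {F : A ⥤ᵖ B} (L : LocalInverse F)

/-- The tool behind all coherence laws below: each is an equation of 2-cells in `A`, and after
applying `F` the inverse disappears, leaving only the comparison isomorphisms `iso` and the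
structure of `F`. -/
theorem map₂_injective (L : LocalInverse F) {a b : A} {f g : a ⟶ b} {η θ : f ⟶ g} (h : F.map₂ η = F.map₂ θ) : η = θ :=
  (L.bijective f g).1 h

/-- The preimage of a 2-morphism. -/
def preimage {a b : A} {f g : a ⟶ b} (α : F.map f ⟶ F.map g) : f ⟶ g :=
  ((L.bijective f g).2 α).choose

@[simp] theorem map₂_preimage {a b : A} {f g : a ⟶ b} (α : F.map f ⟶ F.map g) :
    F.map₂ (L.preimage α) = α := ((L.bijective f g).2 α).choose_spec

/-- The preimage of an invertible 2-morphism. -/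
@[simps] def preimageIso {a b : A} {f g : a ⟶ b} (α : F.map f ≅ F.map g) : f ≅ g where
  hom := L.preimage α.hom
  inv := L.preimage α.inv
  hom_inv_id := L.map₂_injective (by simp)
  inv_hom_id := L.map₂_injective (by simp)

/-- The action of the inverse pseudofunctor on 2-morphisms. -/
def map₂ {a b : A} {u v : F.obj a ⟶ F.obj b} (α : u ⟶ v) : L.map u ⟶ L.map v :=
  L.preimage ((L.iso u).hom ≫ α ≫ (L.iso v).inv)

@[simp] theorem map₂_map₂ {a b : A} {u v : F.obj a ⟶ F.obj b} (α : u ⟶ v) :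
    F.map₂ (L.map₂ α) = (L.iso u).hom ≫ α ≫ (L.iso v).inv := L.map₂_preimage _

/-- Compatibility of the inverse pseudofunctor with identities. -/
def mapId (a : A) : L.map (𝟙 (F.obj a)) ≅ 𝟙 a :=
  L.preimageIso (L.iso _ ≪≫ (F.mapId a).symm)

@[simp] theorem map₂_mapId_hom (a : A) :
    F.map₂ (L.mapId a).hom = (L.iso _).hom ≫ (F.mapId a).inv := L.map₂_preimage _

/-- Compatibility of the inverse pseudofunctor with composition. -/
def mapComp {a b c : A} (u : F.obj a ⟶ F.obj b) (v : F.obj b ⟶ F.obj c) :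
    L.map (u ≫ v) ≅ L.map u ≫ L.map v :=
  L.preimageIso (L.iso _ ≪≫ whiskerRightIso (L.iso u).symm v ≪≫ whiskerLeftIso _ (L.iso v).symm ≪≫
    (F.mapComp _ _).symm)

@[simp] theorem map₂_mapComp_hom {a b c : A} (u : F.obj a ⟶ F.obj b) (v : F.obj b ⟶ F.obj c) :
    F.map₂ (L.mapComp u v).hom = (L.iso _).hom ≫ (L.iso u).inv ▷ v ≫ F.map (L.map u) ◁ (L.iso v).inv ≫
      (F.mapComp _ _).inv := L.map₂_preimage _

@[simp] theorem map₂_mapComp_inv {a b c : A} (u : F.obj a ⟶ F.obj b) (v : F.obj b ⟶ F.obj c) :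
    F.map₂ (L.mapComp u v).inv = (F.mapComp _ _).hom ≫ F.map (L.map u) ◁ (L.iso v).hom ≫
      (L.iso u).hom ▷ v ≫ (L.iso _).inv := (L.map₂_preimage _).trans (by simp)

theorem map₂_id {a b : A} (u : F.obj a ⟶ F.obj b) : L.map₂ (𝟙 u) = 𝟙 _ :=
  L.map₂_injective (by simp)

theorem map₂_comp {a b : A} {u v w : F.obj a ⟶ F.obj b} (α : u ⟶ v) (β : v ⟶ w) :
    L.map₂ (α ≫ β) = L.map₂ α ≫ L.map₂ β :=
  L.map₂_injective (by simp)

/-- After applying `F`, the comparison isomorphisms of `u` and of `v`, `w` sit in different factors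
of a horizontal composite. Interchanging them brings each next to its inverse. -/
theorem map₂_whisker_left {a b c : A} (u : F.obj a ⟶ F.obj b) {v w : F.obj b ⟶ F.obj c}
    (α : v ⟶ w) : L.map₂ (u ◁ α) =
      (L.mapComp u v).hom ≫ L.map u ◁ L.map₂ α ≫ (L.mapComp u w).inv :=
  L.map₂_injective (by
    simp [whisker_exchange_assoc])

theorem map₂_whisker_right {a b c : A} {u v : F.obj a ⟶ F.obj b} (α : u ⟶ v)
    (w : F.obj b ⟶ F.obj c) : L.map₂ (α ▷ w) =
      (L.mapComp u w).hom ≫ L.map₂ α ▷ L.map w ≫ (L.mapComp v w).inv :=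
  L.map₂_injective (by
    simp [whisker_exchange_assoc])

theorem map₂_associator {a b c d : A} (u : F.obj a ⟶ F.obj b) (v : F.obj b ⟶ F.obj c)
    (w : F.obj c ⟶ F.obj d) : L.map₂ (α_ u v w).hom = (L.mapComp (u ≫ v) w).hom ≫
      (L.mapComp u v).hom ▷ L.map w ≫ (α_ (L.map u) (L.map v) (L.map w)).hom ≫
      L.map u ◁ (L.mapComp v w).inv ≫ (L.mapComp u (v ≫ w)).inv :=
  L.map₂_injective (by
    -- The comparison isomorphisms of the outer factors `u` and `w` are separated by an associator.
    -- Naturality of the associator and the exchange law let them pass one another, which plain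
    -- simplification does not arrange.
    have key : F.map (L.map u) ◁ v ◁ (L.iso w).hom ≫ (α_ (F.map (L.map u)) v w).inv ≫
        (L.iso u).hom ▷ v ▷ w = (α_ (F.map (L.map u)) v (F.map (L.map w))).inv ≫
        (L.iso u).hom ▷ v ▷ F.map (L.map w) ≫ (u ≫ v) ◁ (L.iso w).hom := by
      rw [associator_inv_naturality_right_assoc, whisker_exchange]
    simp [whisker_exchange_assoc, reassoc_of% key])

theorem map₂_left_unitor {a b : A} (u : F.obj a ⟶ F.obj b) : L.map₂ (λ_ u).hom =
    (L.mapComp (𝟙 (F.obj a)) u).hom ≫ (L.mapId a).hom ▷ L.map u ≫ (λ_ (L.map u)).hom :=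
  L.map₂_injective (by
    simp [whisker_exchange_assoc])

theorem map₂_right_unitor {a b : A} (u : F.obj a ⟶ F.obj b) : L.map₂ (ρ_ u).hom =
    (L.mapComp u (𝟙 (F.obj b))).hom ≫ L.map u ◁ (L.mapId b).hom ≫ (ρ_ (L.map u)).hom :=
  L.map₂_injective (by
    simp)

/-- The inverse on 1-morphisms in the image of the pseudofunctor. -/
def isoMap {a b : A} (f : a ⟶ b) : L.map (F.map f) ≅ f := L.preimageIso (L.iso (F.map f))

@[simp] theorem map₂_isoMap_hom {a b : A} (f : a ⟶ b) :
    F.map₂ (L.isoMap f).hom = (L.iso (F.map f)).hom := L.map₂_preimage _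

/-- Together with `isoMap_id` and `isoMap_comp` this says that `isoMap` is an icon from `F` followed
by the local inverse to the identity. -/
theorem isoMap_naturality {a b : A} {f g : a ⟶ b} (η : f ⟶ g) :
    L.map₂ (F.map₂ η) ≫ (L.isoMap g).hom = (L.isoMap f).hom ≫ η :=
  L.map₂_injective (by simp)

theorem isoMap_id (a : A) : (L.isoMap (𝟙 a)).hom = L.map₂ (F.mapId a).hom ≫ (L.mapId a).hom :=
  L.map₂_injective (by simp)

theorem isoMap_comp {a b c : A} (f : a ⟶ b) (g : b ⟶ c) : (L.isoMap (f ≫ g)).hom =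
    (L.map₂ (F.mapComp f g).hom ≫ (L.mapComp (F.map f) (F.map g)).hom) ≫
      (L.isoMap f).hom ▷ L.map (F.map g) ≫ f ◁ (L.isoMap g).hom :=
  L.map₂_injective (by
    simp [whisker_exchange_assoc])

/-- With `iso_id` and `iso_comp`, the counterpart for the other composite: the chosen isomorphisms
`iso` form an icon from the local inverse followed by `F` to the identity. -/
theorem iso_naturality {a b : A} {u v : F.obj a ⟶ F.obj b} (α : u ⟶ v) :
    F.map₂ (L.map₂ α) ≫ (L.iso v).hom = (L.iso u).hom ≫ α := by simp

theorem iso_id (a : A) : (L.iso (𝟙 (F.obj a))).hom = F.map₂ (L.mapId a).hom ≫ (F.mapId a).hom := by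
  simp

theorem iso_comp {a b c : A} (u : F.obj a ⟶ F.obj b) (v : F.obj b ⟶ F.obj c) :
    (L.iso (u ≫ v)).hom = (F.map₂ (L.mapComp u v).hom ≫ (F.mapComp (L.map u) (L.map v)).hom) ≫
      (L.iso u).hom ▷ F.map (L.map v) ≫ u ◁ (L.iso v).hom := by
  simp [whisker_exchange_assoc]

end LocalInverse
end LocalInverse
end TDual

namespace TDual
open OverMfd
open Mfd (Smooth U1 T)

/-! ### The 2-functor `F₂` is an equivalence onto `𝓕₂` -/

section F2Inverse

variable {n : ℕ}

/-- Evaluation at the points `(x, 1)` of the trivial bundle recovers both the map of base manifolds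
and the torus-valued function. -/
theorem bundleMor_injective {X Y : BTB n} {u v : X ⟶ Y} (h : bundleMor u = bundleMor v) : u = v := by
  have h' : ∀ x, (u.base x, u.g x * 1) = (v.base x, v.g x * 1) := fun x =>
    congrArg (fun f : X.base.prod (T n) ⟶ Y.base.prod (T n) => f (x, 1)) h
  refine BTB.ext_hom (fun x => congrArg Prod.fst (h' x)) fun x => ?_
  have := congrArg Prod.snd (h' x)
  simpa using this

/-- The function corresponding to a 2-morphism between 1-morphisms `(f, id_I)` is smooth. -/
theorem smooth_phase {M N : Mfd} {f g : M ⟶ N} (α : trivMor f ⟶ trivMor g) : Smooth (phase α) :=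
  -- Both 1-morphisms are defined on the one-element cover by all of `M`, so the smoothness
  -- condition may be tested on the identity family, which gives smoothness globally.
  Mfd.smooth_snd.comp (α.smooth M () () (𝟙 M) (fun _ => trivial) fun _ => trivial)

/-- The 2-morphism `τ` with `β_τ = c`, for a smooth `U(1)`-valued function `c`. -/
def ofPhase {X Y : BTB n} (u : X ⟶ Y) (c : X.base.prod (T n) → U1) (hc : Smooth c) : u ⟶ u :=
  -- Substituting `a - g(x)` for `a` in `-τ(x)(g(x) + a) = c(x, a)` gives `τ(x)(a) = -c(x, a -
  -- g(x))`, written multiplicatively here. Joint smoothness yields both the smoothness of each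
  -- `τ(x)` and, through `frechetSmooth_iff`, that of `τ` into the Fréchet Lie group.
  have h : Smooth (M := X.base.prod (T n)) fun p => (c (p.1, (u.g p.1)⁻¹ * p.2))⁻¹ :=
    (hc.comp (Mfd.smooth_fst.prodMk (Smooth.mul_T (u.g.smooth.comp Mfd.smooth_fst).inv_T
      Mfd.smooth_snd))).inv_U1
  BTB.Hom₂.mk rfl (fun x => ⟨fun a => (c (x, (u.g x)⁻¹ * a))⁻¹,
    h.comp (f := fun a : T n => (x, a)) ((Mfd.smooth_const x).prodMk Mfd.smooth_id)⟩)
    ((frechetSmooth_iff _).2 h)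

theorem phase_beta_ofPhase {X Y : BTB n} (u : X ⟶ Y) (c : X.base.prod (T n) → U1) (hc : Smooth c)
    (p : X.base.prod (T n)) : phase (under (beta (ofPhase u c hc))) p = c p := by
  change ((c (p.1, (u.g p.1)⁻¹ * (u.g p.1 * p.2)))⁻¹)⁻¹ = c p
  rw [inv_inv, inv_mul_cancel_left]
  rfl

/-- The passage from `τ` to `β_τ` is inversion in `U(1)` combined with the translation of the fibre
coordinate by `g(x)`, and both are invertible. Between different 1-morphisms neither side has
2-morphisms. -/
theorem beta_bijective {X Y : BTB n} (u v : X ⟶ Y) :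
    Function.Bijective fun σ : u ⟶ v => beta σ := by
  constructor
  · intro σ τ h
    refine BTB.hom₂_ext fun x a => ?_
    -- The two phases are compared at the fibre coordinate `a - g(x)`, where `β` evaluates `τ(x)`
    -- exactly at `a`.
    have h' : (σ.τ x (u.g x * ((u.g x)⁻¹ * a)))⁻¹ = (τ.τ x (u.g x * ((u.g x)⁻¹ * a)))⁻¹ :=
      congrArg (fun α : f2Mor u ⟶ f2Mor v => phase (under α) (x, (u.g x)⁻¹ * a)) h
    rw [mul_inv_cancel_left] at h'
    exact inv_injective h'
  · intro α
    -- A gerbe 2-morphism exists only between 1-morphisms along the same map of total spaces, and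
    -- that map determines the 1-morphism.
    obtain rfl : u = v := bundleMor_injective (under α).base_eq
    exact ⟨ofPhase u (phase (under α)) (smooth_phase (f := bundleMor u) (g := bundleMor u) (under α)),
      f2_ext (phase_ext (isStrict_trivMor _) (isStrict_trivMor _) (phase_beta_ofPhase _ _ _))⟩

/-- Being a 1-morphism of T-backgrounds, `u` is equivariant and covers some `φ`; being in `𝓕₂`, its
gerbe part is trivial up to 2-isomorphism. Equivariance leaves only the values at the points `(x,
1)` free, and their torus components are the desired function `g`. -/
theorem exists_f2Mor_iso {X Y : BTB n} (u : (F2Pseudo n).obj X ⟶ (F2Pseudo n).obj Y) :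
    ∃ v : X ⟶ Y, Nonempty ((F2Pseudo n).map v ≅ u) := by
  obtain ⟨f, ⟨e⟩⟩ := SubData.Hom.mem u
  obtain ⟨hact, φ, hφ⟩ := SubData.Hom.mem (SubData.Hom.hom u)
  have hb : (SubData.Hom.hom (SubData.Hom.hom u)).base = f := e.hom.base_eq
  rw [hb] at hact hφ
  have hg : Smooth (M := X.base) (N := T n) fun x => (f (x, 1)).2 :=
    Mfd.smooth_snd.comp (f.smooth.comp (Mfd.smooth_id.prodMk (Mfd.smooth_const 1)))
  refine ⟨⟨φ, ⟨_, hg⟩⟩, ⟨SubData.isoMk (SubData.isoMk (Iso.trans ?_ e.symm))⟩⟩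
  refine canIso (isStrict_trivMor _) (isStrict_trivMor _) (Mfd.hom_ext fun p => ?_)
  refine Prod.ext (hφ p).symm ?_
  -- Every point is the translate of one over the unit, `(x, a) = a · (x, 1)`, so equivariance gives
  -- `f(x, a) = a · f(x, 1)`, whose torus component is `g(x) + a`.
  have h : f (p.1, p.2 * 1) = (trivialBundle n Y.base).act p.2 (f (p.1, 1)) := hact p.2 (p.1, 1)
  have h' : (p.1, p.2 * 1) = p := Prod.ext rfl (mul_one p.2)
  rw [h'] at h
  exact (mul_comm _ _).trans (congrArg Prod.snd h).symm

variable (n) in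
/-- A choice of local inverses of the 2-functor `F₂`. -/
def f2LocalInverse : LocalInverse (F2Pseudo n) where
  map u := (exists_f2Mor_iso u).choose
  iso u := (exists_f2Mor_iso u).choose_spec.some
  bijective u v := beta_bijective u v

variable (n) in
/-- An inverse of the 2-functor `F₂`. -/
def f2Inverse : OverFunctor (F2Obj n) (BTB n) where
  functor :=
    -- Objects on both sides merely wrap a manifold, so each object of `𝓕₂` is definitionally the
    -- image under `F₂` of its wrapped manifold. The local inverse therefore applies verbatim, and
    -- the coherence laws are those already proved for it.
    { obj := fun X => ⟨X.val⟩
      map := fun {X Y} u => (f2LocalInverse n).map (a := ⟨X.val⟩) (b := ⟨Y.val⟩) u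
      map₂ := fun {X Y _ _} α => (f2LocalInverse n).map₂ (a := ⟨X.val⟩) (b := ⟨Y.val⟩) α
      map₂_id := fun {X Y} u => (f2LocalInverse n).map₂_id (a := ⟨X.val⟩) (b := ⟨Y.val⟩) u
      map₂_comp := fun {X Y _ _ _} α β =>
        (f2LocalInverse n).map₂_comp (a := ⟨X.val⟩) (b := ⟨Y.val⟩) α β
      mapId := fun X => (f2LocalInverse n).mapId ⟨X.val⟩
      mapComp := fun {X Y Z} u v =>
        (f2LocalInverse n).mapComp (a := ⟨X.val⟩) (b := ⟨Y.val⟩) (c := ⟨Z.val⟩) u v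
      map₂_whisker_left := fun {X Y Z} u _ _ α =>
        (f2LocalInverse n).map₂_whisker_left (a := ⟨X.val⟩) (b := ⟨Y.val⟩) (c := ⟨Z.val⟩) u α
      map₂_whisker_right := fun {X Y Z _ _} α w =>
        (f2LocalInverse n).map₂_whisker_right (a := ⟨X.val⟩) (b := ⟨Y.val⟩) (c := ⟨Z.val⟩) α w
      map₂_associator := fun {X Y Z W} u v w => (f2LocalInverse n).map₂_associator
        (a := ⟨X.val⟩) (b := ⟨Y.val⟩) (c := ⟨Z.val⟩) (d := ⟨W.val⟩) u v w
      map₂_left_unitor := fun {X Y} u =>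
        (f2LocalInverse n).map₂_left_unitor (a := ⟨X.val⟩) (b := ⟨Y.val⟩) u
      map₂_right_unitor := fun {X Y} u =>
        (f2LocalInverse n).map₂_right_unitor (a := ⟨X.val⟩) (b := ⟨Y.val⟩) u }
  obj_eq _ := rfl
  map_eq {X Y} u := by
    -- The chosen preimage need not be known explicitly: 2-isomorphic 1-morphisms lie over the same
    -- map of manifolds, and `F₂` preserves that map.
    have h := pmap_eq ((f2LocalInverse n).iso (a := ⟨X.val⟩) (b := ⟨Y.val⟩) u).hom
    exact (pmap_f2Mor _).symm.trans (h.trans ((Category.id_comp _).trans (Category.comp_id _)).symm)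

theorem f2_comp_f2Inverse : Nonempty (((F2 n).comp (f2Inverse n)).toObj ≌
    (OverFunctor.id (BTB n)).toObj) :=
  InvIcon.equivalence (F := PseudoOn.of ((F2 n).comp (f2Inverse n)).functor)
    (G := PseudoOn.of (OverFunctor.id (BTB n)).functor)
    { iso := fun f => (f2LocalInverse n).isoMap f
      naturality := fun η => (f2LocalInverse n).isoMap_naturality η
      id := fun X => (Category.comp_id _).trans ((f2LocalInverse n).isoMap_id X)
      comp := fun f g => (Category.comp_id _).trans ((f2LocalInverse n).isoMap_comp f g) } _ _ _ _

theorem f2Inverse_comp_f2 : Nonempty (((f2Inverse n).comp (F2 n)).toObj ≌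
    (OverFunctor.id (F2Obj n)).toObj) :=
  InvIcon.equivalence (F := PseudoOn.of ((f2Inverse n).comp (F2 n)).functor)
    (G := PseudoOn.of (OverFunctor.id (F2Obj n)).functor)
    { iso := fun {X Y} u => (f2LocalInverse n).iso (a := ⟨X.val⟩) (b := ⟨Y.val⟩) u
      naturality := fun {X Y _ _} α =>
        (f2LocalInverse n).iso_naturality (a := ⟨X.val⟩) (b := ⟨Y.val⟩) α
      id := fun X => (Category.comp_id _).trans ((f2LocalInverse n).iso_id ⟨X.val⟩)
      comp := fun {X Y Z} u v => (Category.comp_id _).trans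
        ((f2LocalInverse n).iso_comp (a := ⟨X.val⟩) (b := ⟨Y.val⟩) (c := ⟨Z.val⟩) u v) } _ _ _ _

theorem f2_isEquiv : (F2 n).IsEquiv := ⟨f2Inverse n, f2_comp_f2Inverse, f2Inverse_comp_f2⟩

end F2Inverse

/-! ### Cancelling and extending along equivalences -/

section Equivalences

variable {A : Type u₁} [Bicategory.{w₁, v₁} A] [OverMfd A]
variable {B : Type u₂} [Bicategory.{w₂, v₂} B] [OverMfd B]
variable {Z : Type u₃} [Bicategory.{w₃, v₃} Z] [OverMfd Z]

theorem equivalence_symm {F G : HomOver A Z} (h : Nonempty (F ≌ G)) : Nonempty (G ≌ F) := by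
  obtain ⟨e⟩ := h
  exact ⟨Bicategory.Equivalence.mkOfAdjointifyCounit e.counit.symm e.unit.symm⟩

/-- The unit and counit of the inner equivalence are inserted between the two 1-morphisms of the
outer one. As before, the triangle identities are left to `mkOfAdjointifyCounit`. -/
theorem equivalence_trans {F G H : HomOver A Z} (h : Nonempty (F ≌ G)) (h' : Nonempty (G ≌ H)) :
    Nonempty (F ≌ H) := by
  obtain ⟨e⟩ := h
  obtain ⟨e'⟩ := h'
  exact ⟨Bicategory.Equivalence.mkOfAdjointifyCounit (f := e.hom ≫ e'.hom) (g := e'.inv ≫ e.inv)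
    (e.unit ≪≫ whiskerLeftIso _ ((λ_ _).symm ≪≫ whiskerRightIso e'.unit _ ≪≫ α_ _ _ _) ≪≫
      (α_ _ _ _).symm)
    (α_ _ _ _ ≪≫ whiskerLeftIso _ ((α_ _ _ _).symm ≪≫ whiskerRightIso e.counit _ ≪≫ λ_ _) ≪≫
      e'.counit)⟩

/-- Precomposition with an equivalence reflects equivalence. -/
theorem OverFunctor.IsEquiv.equivalence {k : OverFunctor A B} (hk : k.IsEquiv)
    {F G : OverFunctor B Z} (h : Nonempty ((k.comp F).toObj ≌ (k.comp G).toObj)) :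
    Nonempty (F.toObj ≌ G.toObj) := by
  obtain ⟨l, -, hl⟩ := hk
  -- Restricting along `k` and then along its inverse `l` returns every `K` up to equivalence, so
  -- restricting the given equivalence along `l` recovers one between `F` and `G`.
  have key : ∀ K : OverFunctor B Z, Nonempty ((l.comp (k.comp K)).toObj ≌ K.toObj) := fun K =>
    equivalence_trans (equivalence_symm (OverFunctor.comp_assoc_equivalence l k K))
      (equivalence_trans (postcomp_equivalence K hl) (OverFunctor.id_comp_equivalence K))
  exact equivalence_trans (equivalence_symm (key F))
    (equivalence_trans (precomp_equivalence l h) (key G))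

/-- Every pseudofunctor extends along an equivalence. -/
theorem OverFunctor.IsEquiv.exists_extension {k : OverFunctor A B} (hk : k.IsEquiv)
    (F : OverFunctor A Z) : ∃ G : OverFunctor B Z, Nonempty ((k.comp G).toObj ≌ F.toObj) := by
  obtain ⟨l, hl, -⟩ := hk
  -- The extension is `F` precomposed with an inverse `l` of `k`; only the composite `k` followed by
  -- `l` has to be cancelled.
  exact ⟨l.comp F, equivalence_trans (equivalence_symm (OverFunctor.comp_assoc_equivalence k l F))
    (equivalence_trans (postcomp_equivalence F hl) (OverFunctor.id_comp_equivalence F))⟩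

end Equivalences

end TDual

end

/-! ### Comparison of the two 2-stackifications -/

theorem mainTheorem4 (n : ℕ)
    (P : Type 1) [Bicategory.{0, 1} P] [TDual.OverMfd P]
    (ι : TDual.OverFunctor (TDual.BTB n) P) (hι : TDual.IsTwoStackification ι)
    (S : TDual.F2Extension n) (hS : TDual.IsTwoStackification S.incl) :
    (∃ Φ : TDual.OverFunctor P S.Obj,
      Nonempty ((ι.comp Φ).toObj ≌ ((TDual.F2 n).comp S.incl).toObj)) ∧
    (∀ Φ Φ' : TDual.OverFunctor P S.Obj,
      Nonempty ((ι.comp Φ).toObj ≌ ((TDual.F2 n).comp S.incl).toObj) →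
      Nonempty ((ι.comp Φ').toObj ≌ ((TDual.F2 n).comp S.incl).toObj) →
      Nonempty (Φ.toObj ≌ Φ'.toObj)) ∧
    ∀ Φ : TDual.OverFunctor P S.Obj,
      Nonempty ((ι.comp Φ).toObj ≌ ((TDual.F2 n).comp S.incl).toObj) → Φ.IsEquiv := by
  open TDual in
  -- Both `P` and `S.Obj` are 2-stacks of the size admitted as targets in the universal property, so
  -- each of the two stackifications may be tested against each of them.
  have hιS := hι.isOrthogonal S.Obj hS.is2Stack
  have hιP := hι.isOrthogonal P hι.is2Stack
  have hSS := hS.isOrthogonal S.Obj hS.is2Stack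
  have hSP := hS.isOrthogonal P hι.is2Stack
  refine ⟨hιS.1 _, fun Φ Φ' h h' => hιS.equivalence (equivalence_trans h (equivalence_symm h')),
    fun Φ h => ?_⟩
  let j := (F2 n).comp S.incl
  -- The candidate inverse is obtained by extending `ι` along `j` in two stages: across the
  -- equivalence `F2 n` to a morphism on `𝓕₂`, then across the inclusion of `𝓕₂` by its universal
  -- property.
  obtain ⟨Ψ₀, h₀⟩ := (f2_isEquiv (n := n)).exists_extension ι
  obtain ⟨Ψ, h₁⟩ := hSP.1 Ψ₀
  have hΨ : Nonempty ((j.comp Ψ).toObj ≌ ι.toObj) :=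
    equivalence_trans (OverFunctor.comp_assoc_equivalence _ _ _)
      (equivalence_trans (precomp_equivalence (F2 n) h₁) h₀)
  -- Each composite is compared with the identity after restriction: `Φ` followed by `Ψ` along `ι`,
  -- and `Ψ` followed by `Φ` along the inclusion and then along `F2 n`. Both restrictions reflect
  -- equivalence.
  refine ⟨Ψ, hιP.equivalence ?_, hSS.equivalence ((f2_isEquiv (n := n)).equivalence ?_)⟩
  -- The chain is: `ι` then `Φ` is `j`, and `j` then `Ψ` is `ι`, up to equivalence.
  · exact equivalence_trans (equivalence_symm (OverFunctor.comp_assoc_equivalence _ _ _))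
      (equivalence_trans (postcomp_equivalence Ψ h) (equivalence_trans hΨ
        (equivalence_symm (OverFunctor.comp_id_equivalence ι))))
  · refine equivalence_trans (equivalence_symm (OverFunctor.comp_assoc_equivalence _ _ _))
      (equivalence_trans ?_ (OverFunctor.comp_assoc_equivalence _ _ _))
    -- The mirror chain: `j` then `Ψ` is `ι`, and `ι` then `Φ` is `j`. The preceding reassociations
    -- serve to bring `F2 n` and the inclusion together into `j`.
    exact equivalence_trans (equivalence_symm (OverFunctor.comp_assoc_equivalence _ _ _))
      (equivalence_trans (postcomp_equivalence Φ hΨ) (equivalence_trans h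
        (equivalence_symm (OverFunctor.comp_id_equivalence j))))
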